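/- **Conventions.** Let $\ell$ be a prime, let $\mathfrak L$ be a place of $\overline{\mathbb Q}\subset\mathbb C$ above $\ell$, and let $N\ge 1$. Write $q=e^{2i\pi z}$ and $\theta=\frac1{2i\pi}\frac{d}{dz}=q\frac{d}{dq}$. Let $M_k(N,\varepsilon)$ be the space of modular forms of weight $k$, level $N$ and character $\varepsilon$, let $M(N)=\bigoplus_k M_k(\Gamma_1(N))$, and let $a_n(g)$ be the Fourier coefficients of $g$ at infinity. A congruence between forms modulo $\mathfrak L$ means that all Fourier coefficients are $\mathfrak L$-integral and pairwise congruent. For $g$, $h$ of weights $k_g$, $k_h$ put $[g,h]=k_g\,g\,\theta h-k_h\,h\,\theta g$. Let $\bar\chi_\ell$ be the mod $\ell$ cyclotomic character, so that $\bar\chi_\ell(n)=n \bmod \ell$ for $n$ prime to $\ell$. A form $g\in M_k(N,\varepsilon)$ with $\mathfrak L$-integral coefficients is normalised modulo $\mathfrak L$ if $a_1(g)\equiv1\pmod{\mathfrak L}$, and it is an eigenform for the Hecke operator $T_p^N$ modulo $\mathfrak L$ with eigenvalue $\lambda\in\overline{\mathbb F}_\ell$ if $T_p^Ng\equiv\lambda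 g\pmod{\mathfrak L}$. We say that $A\in M_{k_A}(N,\chi_A)$, with $k_A\ge1$ and $\chi_A$ a Dirichlet character modulo $N$, satisfies condition $(\ast)$ at level $N$ if $A$ and $\frac1{k_A}\theta A$ have $\mathfrak L$-integral Fourier coefficients and $$A\equiv1,\qquad \tfrac1{k_A}\theta A\equiv0,\qquad \chi_A\equiv\bar\chi_\ell^{-k_A}\pmod{\mathfrak L},$$ where the last congruence means $\chi_A(n)\equiv n^{-k_A}\pmod{\mathfrak L}$ for all $n$ prime to $N\ell$. **Part 1.** Let $A\in M_{k_A}(N,\chi_A)$ satisfy $(\ast)$. Then $\tilde\theta_A g=-\frac1{k_A}[g,A]$ (for $g$ homogeneous of weight $k$) gives a well-defined linear operator on $M(N)$, mapping weight $k$ to weight $k+k_A+2$. For every $g\in M_k(N,\varepsilon)$ with $\mathfrak L$-integral Fourier coefficients: * $\tilde\theta_Ag\in M_{k+k_A+2}(N,\varepsilon\chi_A)$, and it has $\mathfrak L$-integral Fourier coefficients; * $\tilde\theta_Ag\equiv\theta g\pmod{\mathfrak L}$; * if, for some prime $p$, $g$ is a normalised eigenform for $T_p^N$ modulo $\mathfrak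 L$, then so is $\tilde\theta_Ag$, and its eigenvalue is the reduction of $p\,a_p(g)$. **Part 2.** For Dirichlet characters $\varepsilon_1,\varepsilon_2$ modulo $\mathfrak c_1,\mathfrak c_2$, primitive (or, if $k=2$ and both are trivial, with $\mathfrak c_1=1$ and $\mathfrak c_2$ prime), let $$E_k^{\varepsilon_1,\varepsilon_2}=C+\sum_{n\ge1}\Big(\sum_{d\mid n}d^{k-1}\varepsilon_1(n/d)\varepsilon_2(d)\Big)q^n .$$ Here $C=0$ if $k\ge2$ and $\varepsilon_1\ne\mathbf 1$, or if $k=1$ and both characters are non-trivial; $C=\frac{\mathfrak c_2-1}{24}$ if $k=2$ and both are trivial; and $C=-\frac{B_{k,\varepsilon_1\varepsilon_2}}{2k}$ otherwise. The numbers $B_{m,\varepsilon}$, for $\varepsilon$ modulo $\mathfrak c$, are given by $\sum_{n=1}^{\mathfrak c}\varepsilon(n)\frac{te^{nt}}{e^{\mathfrak ct}-1}=\sum_{m\ge0}B_{m,\varepsilon}\frac{t^m}{m!}$. Put $E_k=E_k^{\mathbf 1,\mathbf 1}$ with $\mathfrak c_1=\mathfrak c_2=1$, and let $\mathbf 1_{(p)}$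 be the trivial character modulo $p$. In each of the following cases $A$ is a modular form of the indicated space, and, seen as a form of level $N$, it satisfies $(\ast)$. * $\ell\ge5$, any $N$: $A=-2\ell E_{\ell-1}\in M_{\ell-1}(1,\mathbf 1)$. * $\ell\ge5$, $\ell\mid N$: $A=2\ell E_1^{\mathbf 1,\chi_{\mathfrak L}^{-1}}\in M_1(\ell,\chi_{\mathfrak L}^{-1})$. Here $\chi_{\mathfrak L}$ is the Teichmüller lift of $\bar\chi_\ell$: the Dirichlet character modulo $\ell$, which exists and is unique, whose values at integers $n$ prime to $\ell$ are roots of unity of order prime to $\ell$ congruent to $n$ modulo $\mathfrak L$. * $\ell=2$, $4\mid N$: $A=4E_1^{\mathbf 1,\chi_4}\in M_1(4,\chi_4)$, with $\chi_4$ the non-trivial character modulo $4$. * $\ell=2$, $N$ has an odd prime divisor, $p$ is the least one, $2^m$ is the greatest power of $2$ dividing $p-1$, $\chi_N$ is a Dirichlet character modulo $p$ of order $2^m$, and $\zeta$ is a primitive $2^m$-th root of unity: $A=(\zeta-1)E_1^{\mathbf 1,\chi_N}\in M_1(p,\chi_N)$. * $\ell=2$, $N=2$: $A=24E_2^{\mathbf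 1,\mathbf 1_{(2)}}\in M_2(2,\mathbf 1_{(2)})$. * $\ell=2$, $N=1$: $A=240E_4\in M_4(1,\mathbf 1)$. * $\ell=3$, $3\mid N$: $A=6E_1^{\mathbf 1,\chi_3}\in M_1(3,\chi_3)$, with $\chi_3$ the non-trivial character modulo $3$. * $\ell=3$, $N$ has a prime divisor congruent to $2$ modulo $3$, and $p$ is the least one: $A=\frac{24}{p-1}E_2^{\mathbf 1,\mathbf 1_{(p)}}\in M_2(p,\mathbf 1_{(p)})$. * $\ell=3$, $N$ has a prime divisor congruent to $4$ modulo $9$, $p$ is the least one, and $\chi^N$ is a Dirichlet character modulo $p$ of order $3$: $A=\frac3{p-1}\big(E_2^{\mathbf 1,\chi^N}-E_2^{\chi^N,\mathbf 1}\big)\in M_2(p,\chi^N)$. * $\ell=3$, all prime divisors of $N$ are congruent to $1$ modulo $9$: $A=240E_4\in M_4(1,\mathbf 1)$. In particular, for every $N\ge1$, every $\ell$ and every $\mathfrak L$ there is a form $A$ satisfying $(\ast)$ at level $N$. -/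

import Mathlib

open scoped DirectSum MatrixGroups ModularForm
open UpperHalfPlane (qExpansion)
open UpperHalfPlane hiding I

noncomputable section

namespace ThetaLift

/-! ### Places of the field of algebraic numbers, and reduction -/

/-- The field of algebraic numbers, inside the complex numbers. -/
abbrev QBar : Type := algebraicClosure ℚ ℂ

/-- The residue field of a place, given by its valuation ring. -/
abbrev Residue (V : ValuationSubring QBar) : Type := IsLocalRing.ResidueField V

/-- The complex number `x` is algebraic and integral at the place `V`, and its reduction is `r`. -/
def Reduces (V : ValuationSubring QBar) (x : ℂ) (r : Residue V) : Prop :=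
  ∃ y : V, ((y : QBar) : ℂ) = x ∧ IsLocalRing.residue V y = r

/-- The complex number `x` is algebraic and integral at the place `V`. -/
def IsIntegralAt (V : ValuationSubring QBar) (x : ℂ) : Prop :=
  ∃ y : V, ((y : QBar) : ℂ) = x

/-- Both `x` and `x'` are integral at `V`, and they have the same reduction. -/
def Cong (V : ValuationSubring QBar) (x x' : ℂ) : Prop :=
  ∃ r : Residue V, Reduces V x r ∧ Reduces V x' r

/-! ### Modular forms, their Fourier coefficients, and operators on them -/

/-- The congruence subgroup `Γ₁(N)`, inside `GL₂(ℝ)`. -/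
abbrev G1 (N : ℕ) : Subgroup (GL (Fin 2) ℝ) :=
  (CongruenceSubgroup.Gamma1 N).map (Matrix.SpecialLinearGroup.mapGL ℝ)

/-- The space of modular forms of weight `k`, level `N` and character `ε`: the modular forms `F`
of weight `k` for `Γ₁(N)` such that `F ∣[k] γ = ε(d) F` for all `γ = (a, b; c, d)` in `Γ₀(N)`. -/
def ModForms (N k : ℕ) (ε : DirichletCharacter ℂ N) : Submodule ℂ (ℍ → ℂ) where
  carrier := {f | (∃ F : ModularForm (G1 N) (k : ℤ), (F : ℍ → ℂ) = f) ∧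
    ∀ γ : SL(2, ℤ), γ ∈ CongruenceSubgroup.Gamma0 N →
      f ∣[(k : ℤ)] γ = ε ((γ 1 1 : ℤ) : ZMod N) • f}
  add_mem' := by
    rintro _ _ ⟨⟨F, rfl⟩, hF⟩ ⟨⟨G, rfl⟩, hG⟩
    refine ⟨⟨F + G, rfl⟩, fun γ hγ => ?_⟩
    rw [SlashAction.add_slash, hF γ hγ, hG γ hγ, smul_add]
  zero_mem' := by
    refine ⟨⟨0, rfl⟩, fun γ _ => ?_⟩
    rw [SlashAction.zero_slash, smul_zero]
  smul_mem' := by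
    rintro c _ ⟨⟨F, rfl⟩, hF⟩
    refine ⟨⟨c • F, rfl⟩, fun γ hγ => ?_⟩
    rw [ModularForm.SL_smul_slash, hF γ hγ, smul_comm]

/-- The `n`-th Fourier coefficient at infinity, for `q = exp (2 π i z)`. -/
def coeffAt (n : ℕ) (f : ℍ → ℂ) : ℂ := (qExpansion 1 f).coeff n

/-- All Fourier coefficients of `f` are integral at `V`. -/
def HasIntegralCoeffs (V : ValuationSubring QBar) (f : ℍ → ℂ) : Prop :=
  ∀ n : ℕ, IsIntegralAt V (coeffAt n f)

/-- The Fourier coefficients of `f` and of `g` are integral at `V` and congruent modulo `V`. -/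
def FormCong (V : ValuationSubring QBar) (f g : ℍ → ℂ) : Prop :=
  ∀ n : ℕ, Cong V (coeffAt n f) (coeffAt n g)

/-- The operator `θ = (2 π i)⁻¹ d/dz = q d/dq`. -/
def theta (f : ℍ → ℂ) : ℍ → ℂ := Derivative.normalizedDerivOfComplex f

/-- The Rankin–Cohen bracket `[g, h] = k_g g θ(h) - k_h h θ(g)` of `g` and `h`, of respective
weights `k_g` and `k_h`. -/
def rankinCohen (kg : ℕ) (g : ℍ → ℂ) (kh : ℕ) (h : ℍ → ℂ) : ℍ → ℂ :=
  (kg : ℂ) • (g * theta h) - (kh : ℂ) • (h * theta g)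

/-- `-(1 / k_A) [g, A]`, for `g` of weight `k` and `A` of weight `k_A`. -/
def thetaTilde (kA : ℕ) (A : ℍ → ℂ) (k : ℕ) (g : ℍ → ℂ) : ℍ → ℂ :=
  (-(1 / (kA : ℂ))) • rankinCohen k g kA A

/-- The point `a z + b` of the upper half plane, for real numbers `a > 0` and `b`. -/
def affinePoint (a : ℝ) (ha : 0 < a) (b : ℝ) (z : ℍ) : ℍ :=
  ⟨(a : ℂ) * (z : ℂ) + (b : ℂ), by simpa using mul_pos ha z.im_pos⟩

/-- The Hecke operator `T_p` on modular forms of weight `k`, level `N` and character `ε`: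
`(T_p g)(z) = p⁻¹ ∑_{0 ≤ b < p} g((z + b) / p) + ε(p) p^(k-1) g(p z)`. -/
def hecke (p : ℕ) (hp : p.Prime) (N k : ℕ) (ε : DirichletCharacter ℂ N) (g : ℍ → ℂ) : ℍ → ℂ :=
  fun z =>
    (p : ℂ)⁻¹ * ∑ b ∈ Finset.range p,
      g (affinePoint ((p : ℝ)⁻¹) (inv_pos.mpr (Nat.cast_pos.mpr hp.pos)) ((b : ℝ) / (p : ℝ)) z)
    + ε (p : ZMod N) * (p : ℂ) ^ ((k : ℤ) - 1) *
      g (affinePoint (p : ℝ) (Nat.cast_pos.mpr hp.pos) 0 z)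

/-- `g` has integral Fourier coefficients at `V`, and `T_p g` is congruent to `lam g` modulo `V`. -/
def IsHeckeEigenMod (V : ValuationSubring QBar) (p : ℕ) (hp : p.Prime) (N k : ℕ)
    (ε : DirichletCharacter ℂ N) (g : ℍ → ℂ) (lam : Residue V) : Prop :=
  ∀ n : ℕ, ∃ r : Residue V,
    Reduces V (coeffAt n g) r ∧ Reduces V (coeffAt n (hecke p hp N k ε g)) (lam * r)

/-- The first Fourier coefficient of `g` is congruent to `1` modulo `V`. -/
def IsNormalisedMod (V : ValuationSubring QBar) (g : ℍ → ℂ) : Prop :=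
  Cong V (coeffAt 1 g) 1

/-- `A` is a modular form of positive weight `kA`, level `N` and character `χA`, such that `A` and
`(1 / kA) θ A` have integral coefficients at `V`, with `A ≡ 1` and `(1 / kA) θ A ≡ 0`, and such that
`χA` is congruent to the power of exponent `-kA` of the cyclotomic character modulo `ℓ`, which maps
an integer prime to `ℓ` to its class modulo `ℓ`. -/
structure ThetaCond (V : ValuationSubring QBar) (ℓ N kA : ℕ) (χA : DirichletCharacter ℂ N)
    (A : ℍ → ℂ) : Prop where
  weight_pos : 0 < kA
  mem : A ∈ ModForms N kA χA
  integral : HasIntegralCoeffs V A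
  integral_theta : HasIntegralCoeffs V ((1 / (kA : ℂ)) • theta A)
  cong_one : FormCong V A 1
  theta_cong_zero : FormCong V ((1 / (kA : ℂ)) • theta A) 0
  character : ∀ n : ℕ, n.Coprime (N * ℓ) →
    Reduces V (χA (n : ZMod N)) ((n : Residue V) ^ (-(kA : ℤ)))

/-! ### Eisenstein series -/

/-- The power series `(exp (c t) - 1) / t`. -/
def expSubOneDiv (c : ℕ) : PowerSeries ℂ :=
  PowerSeries.mk fun j => (c : ℂ) ^ (j + 1) / ((j + 1).factorial : ℂ)

/-- The power series `∑_{n = 1}^{c} ε(n) t exp (n t) / (exp (c t) - 1)`, for `ε` modulo `c`. -/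
def bernoulliSeries {c : ℕ} (ε : DirichletCharacter ℂ c) : PowerSeries ℂ :=
  (∑ n ∈ Finset.Icc 1 c,
    ε (n : ZMod c) • PowerSeries.rescale (n : ℂ) (PowerSeries.exp ℂ)) * (expSubOneDiv c)⁻¹

theorem bernoulliSeries_mul {c : ℕ} [NeZero c] (ε : DirichletCharacter ℂ c) :
    bernoulliSeries ε * (PowerSeries.rescale (c : ℂ) (PowerSeries.exp ℂ) - 1) =
      ∑ n ∈ Finset.Icc 1 c,
        ε (n : ZMod c) • (PowerSeries.X * PowerSeries.rescale (n : ℂ) (PowerSeries.exp ℂ)) := by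
  have h1 : PowerSeries.rescale (c : ℂ) (PowerSeries.exp ℂ) - 1 =
      PowerSeries.X * expSubOneDiv c := by
    ext m
    cases m with
    | zero =>
      rw [map_sub, PowerSeries.coeff_rescale]
      simp
    | succ j =>
      rw [PowerSeries.coeff_succ_X_mul]
      simp [expSubOneDiv, PowerSeries.coeff_exp, PowerSeries.coeff_one, div_eq_mul_inv]
  have h2 : (expSubOneDiv c)⁻¹ * expSubOneDiv c = 1 := by
    apply PowerSeries.inv_mul_cancel
    rw [← PowerSeries.coeff_zero_eq_constantCoeff_apply]
    simp [expSubOneDiv, NeZero.ne c]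
  rw [h1, bernoulliSeries, mul_comm PowerSeries.X, ← mul_assoc, mul_assoc _ _⁻¹, h2, mul_one,
    Finset.sum_mul]
  exact Finset.sum_congr rfl fun n _ => by rw [smul_mul_assoc, mul_comm]

/-- The generalised Bernoulli number `B_{m, ε}`, where `∑ B_{m, ε} t ^ m / m !` is the series
above. -/
def genBernoulli (m : ℕ) {c : ℕ} (ε : DirichletCharacter ℂ c) : ℂ :=
  (m.factorial : ℂ) * (bernoulliSeries ε).coeff m

/-- The product of two Dirichlet characters modulo `c₁` and `c₂`, as a character modulo `c₁ c₂`. -/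
def charMul {c₁ c₂ : ℕ} (ε₁ : DirichletCharacter ℂ c₁) (ε₂ : DirichletCharacter ℂ c₂) :
    DirichletCharacter ℂ (c₁ * c₂) :=
  DirichletCharacter.changeLevel (Nat.dvd_mul_right c₁ c₂) ε₁ *
    DirichletCharacter.changeLevel (Nat.dvd_mul_left c₂ c₁) ε₂

/-- `∑_{d ∣ n} d ^ r ε₁(n / d) ε₂(d)`. -/
def charSigma (r : ℕ) {c₁ c₂ : ℕ} (ε₁ : DirichletCharacter ℂ c₁) (ε₂ : DirichletCharacter ℂ c₂)
    (n : ℕ) : ℂ :=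
  ∑ d ∈ n.divisors, (d : ℂ) ^ r * ε₁ ((n / d : ℕ) : ZMod c₁) * ε₂ (d : ZMod c₂)

open Classical in
/-- The constant coefficient of the Eisenstein series. -/
def eisConst (k : ℕ) {c₁ c₂ : ℕ} (ε₁ : DirichletCharacter ℂ c₁) (ε₂ : DirichletCharacter ℂ c₂) :
    ℂ :=
  if (2 ≤ k ∧ ε₁ ≠ 1) ∨ (k = 1 ∧ ε₁ ≠ 1 ∧ ε₂ ≠ 1) then 0
  else if k = 2 ∧ ε₁ = 1 ∧ ε₂ = 1 then ((c₂ : ℂ) - 1) / 24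
  else -genBernoulli k (charMul ε₁ ε₂) / (2 * (k : ℂ))

/-- The Eisenstein series `E_k^{ε₁, ε₂}`, for `k ≥ 1` and Dirichlet characters `ε₁` and `ε₂` which
are primitive (or, if `k = 2` and both are trivial, of respective moduli `1` and a prime). -/
def eisenstein (k : ℕ) {c₁ c₂ : ℕ} (ε₁ : DirichletCharacter ℂ c₁) (ε₂ : DirichletCharacter ℂ c₂) :
    ℍ → ℂ :=
  fun z => eisConst k ε₁ ε₂ + ∑' n : ℕ+, charSigma (k - 1) ε₁ ε₂ (n : ℕ) *
    Complex.exp (2 * (Real.pi : ℂ) * Complex.I * (z : ℂ)) ^ (n : ℕ)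

/-- The trivial character modulo `1`. -/
abbrev triv : DirichletCharacter ℂ 1 := 1

/-- The Eisenstein series `E_k` of level one. -/
def eisensteinOne (k : ℕ) : ℍ → ℂ := eisenstein k triv triv

/-- `χ` is the Teichmüller lift with respect to `V` of the cyclotomic character modulo `ℓ`: its
values at integers prime to `ℓ` are roots of unity of order prime to `ℓ`, and they reduce to the
classes modulo `ℓ` of these integers. -/
def IsTeichmullerLift (V : ValuationSubring QBar) (ℓ : ℕ) (χ : DirichletCharacter ℂ ℓ) : Prop :=
  ∀ n : ℕ, n.Coprime ℓ →
    (∃ m : ℕ, 0 < m ∧ m.Coprime ℓ ∧ χ (n : ZMod ℓ) ^ m = 1) ∧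
      Reduces V (χ (n : ZMod ℓ)) (n : Residue V)

/-- `A` is a modular form of weight `kA`, level `M` and character `χ`, where `M` divides `N`, and
seen as a form of level `N` it satisfies the conditions above. -/
def GivesTheta (V : ValuationSubring QBar) (ℓ N M kA : ℕ) (χ : DirichletCharacter ℂ M)
    (A : ℍ → ℂ) : Prop :=
  A ∈ ModForms M kA χ ∧
    ∃ h : M ∣ N, ThetaCond V ℓ N kA (DirichletCharacter.changeLevel h χ) A

end ThetaLift

end

/-!
**The operator attached to `A`.** One has `-k_A⁻¹ [g, A] = A θ g - k g (k_A⁻¹ θ A)`, so for `A ≡ 1`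
and `k_A⁻¹ θ A ≡ 0` this is congruent to `θ g` (`ThetaCond.reduces_thetaTilde`). The bracket commutes
with the slash action (`rankinCohen_slash`), and it is bounded at the cusps because the derivative
of a holomorphic function bounded at infinity is bounded there by Cauchy's inequality. Hence modularity
(`thetaTilde_mem`). A normalised eigenform for `T_p` modulo the place satisfies
`a_{pn} + ε(p) p^{k-1} a_{n/p} ≡ a_p a_n`; multiplication by `p n` and `χ_A(p) ≡ p^{-k_A}` give the
relation for the coefficients `n a_n` (`ThetaCond.eigen_thetaTilde`).

**The Eisenstein series.** Mathlib has the series `E_k` of level one for `k ≥ 3`. Those of weights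
one and two are obtained here from the Weierstrass functions of the lattice `ℤ z + ℤ`. At a division
point `(a₀ z + a₁) / c` the `℘`-function (`eisTwo`), and the zeta function corrected by the
quasi-periods (`eisOne`), are functions of `z` which `SL₂(ℤ)` permutes through its action on the row
vector `a`, taken modulo `c`. Summed along the rows of the lattice, they become series in
`∑ (x + n)⁻²` and `π cot (π x)`, which give the boundedness at infinity and the Fourier expansion;
the series `G₂`, known to Mathlib, accounts for the conditional convergence. The weighted sums of
these functions over the division points `a / c`, with the discrete Fourier transform of `χ` as
weight, or over all division points `(r z + s) / c` with the weight `χ(r)`, have character `χ`, and a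
comparison of Fourier coefficients identifies them with multiples of `E_1^{1,χ}` and `E_2^{1,χ}`, or
of `E_2^{χ,1}`. For the constant coefficients this uses the finite formula for the cotangent and the
Fourier series of the second Bernoulli polynomial (`eisenstein_one_mem`,
`eisenstein_two_mem_of_eisConst`, `eisenstein_two_swap_mem`).

**The congruences.** By `GivesTheta.of_hasQExp` only the Fourier coefficients and the values of the
character matter. Apart from the characters of order `3`, the factor in front of the Eisenstein
series is divisible by the place, and the coefficients at `q ^ n` for `n > 0` are algebraic integers.
The constant coefficients are treated case by case: in level one through the theorem of von Staudt
and Clausen; for the Teichmüller character because `∑ n χ⁻¹(n) ≡ ℓ - 1`; for characters of order a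
power of `2` by a sum along the powers of a primitive root (`givesTheta_order_two_pow`); for
characters of order `3` by the replacement of every `χ(n)` by `1` in `B_{2,χ}`
(`reduces_genBernoulli_two`).
-/

noncomputable section

namespace ThetaLift

/-! ### Reduction at a place -/

section Reduction

variable {V : ValuationSubring QBar}

theorem Reduces.isIntegralAt {x : ℂ} {r : Residue V} (h : Reduces V x r) : IsIntegralAt V x :=
  let ⟨y, hy, _⟩ := h; ⟨y, hy⟩

theorem IsIntegralAt.exists_reduces {x : ℂ} (h : IsIntegralAt V x) : ∃ r, Reduces V x r :=
  let ⟨y, hy⟩ := h; ⟨_, y, hy, rfl⟩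

theorem Reduces.unique {x : ℂ} {r s : Residue V} (h : Reduces V x r) (h' : Reduces V x s) :
    r = s := by
  obtain ⟨y, hy, rfl⟩ := h
  obtain ⟨y', hy', rfl⟩ := h'
  have : y = y' := Subtype.ext (Subtype.ext (hy.trans hy'.symm))
  rw [this]

theorem Reduces.add {x x' : ℂ} {r r' : Residue V} (h : Reduces V x r) (h' : Reduces V x' r') :
    Reduces V (x + x') (r + r') := by
  obtain ⟨y, rfl, rfl⟩ := h
  obtain ⟨y', rfl, rfl⟩ := h'
  exact ⟨y + y', by simp, map_add _ _ _⟩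

theorem Reduces.mul {x x' : ℂ} {r r' : Residue V} (h : Reduces V x r) (h' : Reduces V x' r') :
    Reduces V (x * x') (r * r') := by
  obtain ⟨y, rfl, rfl⟩ := h
  obtain ⟨y', rfl, rfl⟩ := h'
  exact ⟨y * y', by simp, map_mul _ _ _⟩

theorem Reduces.neg {x : ℂ} {r : Residue V} (h : Reduces V x r) : Reduces V (-x) (-r) := by
  obtain ⟨y, rfl, rfl⟩ := h
  exact ⟨-y, by simp, map_neg _ _⟩

theorem Reduces.sub {x x' : ℂ} {r r' : Residue V} (h : Reduces V x r) (h' : Reduces V x' r') :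
    Reduces V (x - x') (r - r') := by
  simpa only [sub_eq_add_neg] using h.add h'.neg

theorem Reduces.pow {x : ℂ} {r : Residue V} (h : Reduces V x r) (n : ℕ) :
    Reduces V (x ^ n) (r ^ n) := by
  obtain ⟨y, rfl, rfl⟩ := h
  exact ⟨y ^ n, by simp, map_pow _ _ _⟩

theorem reduces_natCast (n : ℕ) : Reduces V (n : ℂ) (n : Residue V) :=
  ⟨n, by simp, map_natCast _ _⟩

theorem reduces_intCast (n : ℤ) : Reduces V (n : ℂ) (n : Residue V) :=
  ⟨n, by simp, map_intCast _ _⟩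

theorem reduces_zero : Reduces V 0 0 := by simpa using reduces_natCast (V := V) 0

theorem reduces_one : Reduces V 1 1 := by simpa using reduces_natCast (V := V) 1

theorem Reduces.sum {ι : Type*} (s : Finset ι) {f : ι → ℂ} {r : ι → Residue V}
    (h : ∀ i ∈ s, Reduces V (f i) (r i)) : Reduces V (∑ i ∈ s, f i) (∑ i ∈ s, r i) := by
  classical
  induction s using Finset.induction_on with
  | empty => simpa using reduces_zero
  | insert a s ha ih =>
    rw [Finset.sum_insert ha, Finset.sum_insert ha]
    exact (h a (by simp)).add (ih fun i hi => h i (by simp [hi]))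

theorem Reduces.inv {x : ℂ} {r : Residue V} (h : Reduces V x r) (hr : r ≠ 0) :
    Reduces V x⁻¹ r⁻¹ := by
  obtain ⟨y, rfl, rfl⟩ := h
  have hu : IsUnit y := by
    rwa [← IsLocalRing.residue_ne_zero_iff_isUnit]
  obtain ⟨u, rfl⟩ := hu
  refine ⟨(u⁻¹ : Vˣ), ?_, ?_⟩
  · apply eq_inv_of_mul_eq_one_left
    have : (((u⁻¹ : Vˣ) : V) : QBar) * ((u : V) : QBar) = 1 := by exact_mod_cast u.inv_mul
    exact_mod_cast congrArg (fun t : QBar => (t : ℂ)) this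
  · apply eq_inv_of_mul_eq_one_left
    rw [← map_mul]; simp

theorem Reduces.div {x x' : ℂ} {r r' : Residue V} (h : Reduces V x r) (h' : Reduces V x' r')
    (hr : r' ≠ 0) : Reduces V (x / x') (r / r') := by
  simpa only [div_eq_mul_inv] using h.mul (h'.inv hr)

theorem Cong.of_reduces {x x' : ℂ} {r : Residue V} (h : Reduces V x r) (h' : Reduces V x' r) :
    Cong V x x' := ⟨r, h, h'⟩

/-- A valuation ring is integrally closed, so it contains the algebraic integers. -/
theorem IsIntegralAt.of_isIntegral {x : ℂ} (hx : IsIntegral ℤ x) : IsIntegralAt V x := by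
  have halg : x ∈ algebraicClosure ℚ ℂ :=
    (mem_algebraicClosure_iff).2 (hx.tower_top (A := ℚ)).isAlgebraic
  have h1 : IsIntegral ℤ (⟨x, halg⟩ : QBar) := by
    refine (isIntegral_algHom_iff ((algebraicClosure ℚ ℂ).val.restrictScalars ℤ)
      (Subtype.val_injective)).1 ?_
    exact hx
  have h2 : IsIntegral V (⟨x, halg⟩ : QBar) := h1.tower_top
  obtain ⟨y, hy⟩ := IsIntegrallyClosed.isIntegral_iff.1 h2
  exact ⟨y, by rw [show ((y : QBar)) = ⟨x, halg⟩ from hy]⟩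

theorem isIntegral_of_pow_eq_one {x : ℂ} {n : ℕ} (hn : 0 < n) (h : x ^ n = 1) : IsIntegral ℤ x :=
  IsIntegral.of_pow hn (by rw [h]; exact isIntegral_one)

theorem isIntegral_dirichletCharacter {N : ℕ} [NeZero N] (χ : DirichletCharacter ℂ N)
    (a : ZMod N) : IsIntegral ℤ (χ a) := by
  by_cases ha : IsUnit a
  · obtain ⟨u, rfl⟩ := ha
    refine isIntegral_of_pow_eq_one (n := Fintype.card (ZMod N)ˣ) Fintype.card_pos ?_
    rw [← map_pow, ← Units.val_pow_eq_pow_val, pow_card_eq_one]; simp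
  · rw [χ.map_nonunit ha]; exact isIntegral_zero

theorem natCast_residue_eq_zero {ℓ : ℕ} (hV : (ℓ : QBar) ∈ V.nonunits) :
    (ℓ : Residue V) = 0 := by
  rw [← map_natCast (IsLocalRing.residue V) ℓ, IsLocalRing.residue_eq_zero_iff]
  obtain ⟨h, h'⟩ := ValuationSubring.mem_nonunits_iff_exists_mem_maximalIdeal.1 hV
  exact (Subtype.ext (by simp) : (⟨(ℓ : QBar), h⟩ : V) = (ℓ : V)) ▸ h'

theorem charP_residue {ℓ : ℕ} (hℓ : ℓ.Prime) (hV : (ℓ : QBar) ∈ V.nonunits) :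
    CharP (Residue V) ℓ :=
  have : Fact ℓ.Prime := ⟨hℓ⟩
  (CharP.charP_iff_prime_eq_zero hℓ).2 (natCast_residue_eq_zero hV)

theorem natCast_residue_ne_zero {ℓ : ℕ} (hℓ : ℓ.Prime) (hV : (ℓ : QBar) ∈ V.nonunits) {n : ℕ}
    (hn : n.Coprime ℓ) : (n : Residue V) ≠ 0 := by
  have := charP_residue hℓ hV
  rw [Ne, CharP.cast_eq_zero_iff (Residue V) ℓ]
  intro h
  exact hℓ.one_lt.ne' (Nat.Coprime.eq_one_of_dvd (Nat.coprime_comm.1 hn) h)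

/-- Reduction is injective on roots of unity of order prime to the residue characteristic. -/
theorem eq_one_of_reduces_one {ℓ : ℕ} (hℓ : ℓ.Prime) (hV : (ℓ : QBar) ∈ V.nonunits) {x : ℂ} {m : ℕ}
    (hm : m.Coprime ℓ) (hx : x ^ m = 1) (h : Reduces V x 1) : x = 1 := by
  by_contra hne
  have h0 : ∑ i ∈ Finset.range m, x ^ i = 0 := by
    rw [geom_sum_eq hne, hx, sub_self, zero_div]
  have h1 : Reduces V (∑ i ∈ Finset.range m, x ^ i) (∑ i ∈ Finset.range m, (1 : Residue V) ^ i) :=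
    Reduces.sum _ fun i _ => h.pow i
  rw [h0] at h1
  have h2 := h1.unique reduces_zero
  simp only [one_pow, Finset.sum_const, Finset.card_range, nsmul_eq_mul, mul_one] at h2
  exact natCast_residue_ne_zero hℓ hV hm h2

/-- Roots of unity of `ℓ`-power order reduce to `1`. -/
theorem reduces_one_of_pow_prime_pow {ℓ : ℕ} (hℓ : ℓ.Prime) (hV : (ℓ : QBar) ∈ V.nonunits) {x : ℂ}
    {m : ℕ} (hx : x ^ ℓ ^ m = 1) : Reduces V x 1 := by
  obtain ⟨r, hr⟩ := (IsIntegralAt.of_isIntegral (V := V)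
    (isIntegral_of_pow_eq_one (pow_pos hℓ.pos m) hx)).exists_reduces
  have := charP_residue hℓ hV
  have : Fact ℓ.Prime := ⟨hℓ⟩
  have h1 : r ^ ℓ ^ m = 1 := (hr.pow (ℓ ^ m)).unique (by rw [hx]; exact reduces_one)
  have h2 : r = 1 := by
    rw [← sub_eq_zero]
    apply eq_zero_of_pow_eq_zero (n := ℓ ^ m)
    rw [sub_pow_char_pow, h1, one_pow, sub_self]
  rwa [h2] at hr

end Reduction

/-! ### Functions given by a power series in `q` -/

section QExp

open Function.Periodic (qParam)
open Filter Topology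
open scoped Manifold

/-- The function `f` on the upper half plane is the sum of the power series `∑ c_n q ^ n`, which
converges everywhere on the upper half plane. -/
def HasQExp (f : ℍ → ℂ) (c : ℕ → ℂ) : Prop :=
  ∀ τ : ℍ, HasSum (fun m ↦ c m • qParam 1 (τ : ℂ) ^ m) (f τ)

variable {f g : ℍ → ℂ} {c d : ℕ → ℂ}

theorem HasQExp.isBoundedAtImInfty (h : HasQExp f c) : IsBoundedAtImInfty f :=
  isBoundedAtImInfty_of_hasSum_qExpansion one_pos h

theorem HasQExp.periodic (h : HasQExp f c) : Function.Periodic (f ∘ ofComplex) (1 : ℝ) := by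
  intro w
  by_cases hw : 0 < w.im
  · have hw' : 0 < (w + (1 : ℝ)).im := by simpa using hw
    simp only [Function.comp_apply, ofComplex_apply_of_im_pos hw, ofComplex_apply_of_im_pos hw']
    have h1 := h ⟨w + (1 : ℝ), hw'⟩
    have h2 := h ⟨w, hw⟩
    have e : qParam 1 ((⟨w + (1 : ℝ), hw'⟩ : ℍ) : ℂ) = qParam 1 ((⟨w, hw⟩ : ℍ) : ℂ) :=
      by simp [qParam, mul_add, Complex.exp_add, Complex.exp_two_pi_mul_I]
    rw [e] at h1
    exact h1.unique h2
  · have hw' : ¬ 0 < (w + (1 : ℝ)).im := by simpa using hw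
    simp only [Function.comp_apply, ofComplex_apply_of_im_nonpos (not_lt.1 hw),
      ofComplex_apply_of_im_nonpos (not_lt.1 hw')]

theorem HasQExp.summable_of_norm_lt_one (h : HasQExp f c) {q : ℂ} (hq : ‖q‖ < 1) :
    Summable fun m ↦ c m * q ^ m := by
  rcases eq_or_ne q 0 with rfl | hq0
  · exact summable_of_ne_finset_zero (s := {0}) (by intro b hb; simp_all)
  · have h1 := Function.Periodic.im_invQParam_pos_of_norm_lt_one one_pos hq hq0
    have h2 := (h ⟨_, h1⟩).summable
    have e : qParam 1 ((⟨Function.Periodic.invQParam 1 q, h1⟩ : ℍ) : ℂ) = q :=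
      Function.Periodic.qParam_right_inv one_ne_zero hq0
    simpa [e] using h2

theorem HasQExp.mdifferentiable (h : HasQExp f c) : MDiff f := by
  rw [UpperHalfPlane.mdifferentiable_iff]
  have hr : 1 ≤ (FormalMultilinearSeries.ofScalars ℂ c).radius := by
    refine le_of_forall_lt_imp_le_of_dense fun r hr ↦ ?_
    lift r to NNReal using hr.ne_top
    apply FormalMultilinearSeries.le_radius_of_summable
    have := (h.summable_of_norm_lt_one (q := (r : ℝ)) (by simpa using hr)).norm
    simpa [FormalMultilinearSeries.ofScalars_norm] using this
  have hP := (FormalMultilinearSeries.ofScalars ℂ c).hasFPowerSeriesOnBall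
    (lt_of_lt_of_le one_pos hr)
  have hd : DifferentiableOn ℂ (FormalMultilinearSeries.ofScalars ℂ c).sum (Metric.ball 0 1) := by
    refine hP.differentiableOn.mono ?_
    rw [← ENNReal.coe_one] at hr
    intro x hx
    rw [Metric.mem_eball]
    refine lt_of_lt_of_le ?_ hr
    rw [mem_ball_zero_iff] at hx
    simpa [edist_zero_right, enorm_eq_nnnorm, ← NNReal.coe_lt_coe] using hx
  have hq : DifferentiableOn ℂ (fun z : ℂ ↦ qParam 1 z) upperHalfPlaneSet :=
    (Function.Periodic.differentiable_qParam).differentiableOn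
  refine (hd.comp hq fun z hz ↦ ?_).congr fun z hz ↦ ?_
  · rw [mem_ball_zero_iff]
    exact Function.Periodic.norm_qParam_lt_one one_pos hz
  · simp only [Function.comp_apply, ofComplex_apply_of_im_pos hz]
    rw [← (h ⟨z, hz⟩).tsum_eq, FormalMultilinearSeries.sum]
    exact tsum_congr fun n => by simp [mul_comm]

theorem HasQExp.analyticAt (h : HasQExp f c) : AnalyticAt ℂ (cuspFunction 1 f) 0 :=
  analyticAt_cuspFunction_zero one_pos h.periodic h.mdifferentiable h.isBoundedAtImInfty

/-- Uniqueness of the expansion: the coefficients are those of Mathlib's `qExpansion`. -/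
theorem HasQExp.coeffAt_eq (h : HasQExp f c) (n : ℕ) : coeffAt n f = c n := by
  have h1 : (qExpansion 1 f).coeff n = ((n.factorial : ℂ))⁻¹ * iteratedDeriv n (cuspFunction 1 f) 0 :=
    qExpansion_coeff _ _
  have h2 := (hasFPowerSeriesOnBall_cuspFunction one_pos h.analyticAt h).hasFPowerSeriesAt
  have h3 := h2.eq_formalMultilinearSeries h.analyticAt.hasFPowerSeriesAt
  have h4 := congrArg (fun p => FormalMultilinearSeries.coeff p n) h3
  rw [FormalMultilinearSeries.coeff_ofScalars, FormalMultilinearSeries.coeff_ofScalars] at h4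
  rw [coeffAt, h1, h4, inv_mul_eq_div]

theorem hasQExp_coeffAt (hp : Function.Periodic (f ∘ ofComplex) (1 : ℝ)) (hd : MDiff f)
    (hb : IsBoundedAtImInfty f) : HasQExp f fun n => coeffAt n f :=
  fun τ => hasSum_qExpansion one_pos hp hd hb τ

theorem HasQExp.congr (h : HasQExp f c) (hc : ∀ n, c n = d n) : HasQExp f d :=
  (funext hc : c = d) ▸ h

theorem HasQExp.eq_of_coeff (h : HasQExp f c) (h' : HasQExp g c) : f = g :=
  funext fun τ => (h τ).unique (h' τ)

theorem HasQExp.sub (h : HasQExp f c) (h' : HasQExp g d) :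
    HasQExp (f - g) fun n => c n - d n := fun τ => by
  simp only [sub_smul]; exact (h τ).sub (h' τ)

theorem HasQExp.smul (h : HasQExp f c) (a : ℂ) : HasQExp (a • f) fun n => a * c n := fun τ => by
  simp only [mul_smul]; exact (h τ).const_smul a

theorem HasQExp.mul (h : HasQExp f c) (h' : HasQExp g d) :
    HasQExp (f * g) fun n => ∑ p ∈ Finset.HasAntidiagonal.antidiagonal n, c p.1 * d p.2 := fun τ => by
  have hq : ‖qParam 1 (τ : ℂ)‖ < 1 := Function.Periodic.norm_qParam_lt_one one_pos τ.im_pos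
  have h1 := (h.summable_of_norm_lt_one hq).norm
  have h2 := (h'.summable_of_norm_lt_one hq).norm
  have h3 := summable_norm_sum_mul_antidiagonal_of_summable_norm h1 h2
  have h4 := tsum_mul_tsum_eq_tsum_sum_antidiagonal_of_summable_norm h1 h2
  have e : ∀ n, ∑ kl ∈ Finset.HasAntidiagonal.antidiagonal n,
      c kl.1 * qParam 1 (τ : ℂ) ^ kl.1 * (d kl.2 * qParam 1 (τ : ℂ) ^ kl.2) =
      (∑ p ∈ Finset.HasAntidiagonal.antidiagonal n, c p.1 * d p.2) • qParam 1 (τ : ℂ) ^ n := by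
    intro n
    rw [smul_eq_mul, Finset.sum_mul]
    refine Finset.sum_congr rfl fun p hp => ?_
    rw [← Finset.HasAntidiagonal.mem_antidiagonal.1 hp, pow_add]; ring
  simp only [e] at h3 h4
  have h5 := h3.of_norm.hasSum
  rw [← h4] at h5
  simpa [← (h τ).tsum_eq, ← (h' τ).tsum_eq] using h5

/-- The operator `θ` multiplies the coefficient of `q ^ n` by `n`. -/
theorem HasQExp.theta (h : HasQExp f c) : HasQExp (theta f) fun n => n * c n := fun τ => by
  set G := cuspFunction 1 f with hG
  have hGd : DifferentiableOn ℂ G (Metric.ball 0 1) :=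
    differentiableOn_cuspFunction_ball one_pos h.periodic h.mdifferentiable h.isBoundedAtImInfty
  set q := qParam 1 (τ : ℂ) with hq
  have hq1 : ‖q‖ < 1 := Function.Periodic.norm_qParam_lt_one one_pos τ.im_pos
  have hqm : q ∈ Metric.ball (0 : ℂ) 1 := by simpa using hq1
  have h1 := Complex.hasSum_taylorSeries_on_ball (hGd.deriv Metric.isOpen_ball) hqm
  have hc : ∀ n, ((n.factorial : ℂ))⁻¹ * iteratedDeriv n G 0 = c n := fun n => by
    rw [← h.coeffAt_eq n, coeffAt, qExpansion_coeff]
  -- the chain rule, with `q' = 2 π i q`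
  have h2 : ThetaLift.theta f τ = q * deriv G q := by
    have e1 : f ∘ ofComplex =ᶠ[𝓝 (τ : ℂ)] fun z => G (qParam 1 z) := by
      filter_upwards [isOpen_upperHalfPlaneSet.mem_nhds τ.im_pos] with w hw
      rw [hG, Function.comp_apply, ofComplex_apply_of_im_pos hw]
      exact (eq_cuspFunction ⟨w, hw⟩ one_ne_zero h.periodic).symm
    have e2 : HasDerivAt (fun z : ℂ => qParam 1 z) (2 * Real.pi * Complex.I * q) (τ : ℂ) := by
      have h0 : HasDerivAt (fun z : ℂ => 2 * Real.pi * Complex.I * z / (1 : ℝ))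
          (2 * Real.pi * Complex.I) (τ : ℂ) := by
        simpa using (hasDerivAt_id (τ : ℂ)).const_mul (2 * Real.pi * Complex.I)
      have := h0.cexp
      rwa [mul_comm (Complex.exp _)] at this
    have e3 : HasDerivAt G (deriv G q) q :=
      (hGd.differentiableAt (Metric.isOpen_ball.mem_nhds hqm)).hasDerivAt
    have e4 := (e3.comp (τ : ℂ) e2)
    rw [ThetaLift.theta, Derivative.normalizedDerivOfComplex, e1.deriv_eq,
      show (fun z => G (qParam 1 z)) = G ∘ fun z => qParam 1 z from rfl, e4.deriv]
    have : (2 * Real.pi * Complex.I : ℂ) ≠ 0 := Complex.two_pi_I_ne_zero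
    field_simp
  rw [h2, ← hasSum_nat_add_iff' 1]
  simp only [Finset.range_one, Finset.sum_singleton, Nat.cast_zero, zero_mul, zero_smul, sub_zero]
  have e : (fun n : ℕ => (((n + 1 : ℕ) : ℂ) * c (n + 1)) • q ^ (n + 1)) =
      fun n => q * (((n.factorial : ℂ))⁻¹ • (q - 0) ^ n • iteratedDeriv n (deriv G) 0) := by
    funext n
    rw [← iteratedDeriv_succ', sub_zero, ← hc (n + 1), Nat.factorial_succ]
    have h3 : (n.factorial : ℂ) ≠ 0 := by exact_mod_cast n.factorial_ne_zero
    have h4 : ((n : ℂ) + 1) ≠ 0 := by exact_mod_cast n.succ_ne_zero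
    push_cast
    simp only [smul_eq_mul]
    field_simp
    ring
  rw [e]
  exact h1.mul_left q

end QExp

/-! ### Membership in spaces of modular forms -/

section ModForms

open scoped Manifold
open Filter

theorem changeLevel_natCast {M N : ℕ} (h : M ∣ N) (χ : DirichletCharacter ℂ M) {n : ℕ}
    (hn : n.Coprime N) : DirichletCharacter.changeLevel h χ (n : ZMod N) = χ (n : ZMod M) := by
  have := DirichletCharacter.changeLevel_eq_cast_of_dvd χ h (ZMod.unitOfCoprime n hn)
  rwa [ZMod.coe_unitOfCoprime, ZMod.cast_natCast h] at this

variable {N : ℕ} [NeZero N] {k : ℕ} {χ : DirichletCharacter ℂ N} {f : ℍ → ℂ}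

theorem one_mem_strictPeriods_G1 (N : ℕ) : (1 : ℝ) ∈ (G1 N).strictPeriods := by
  rw [Subgroup.strictPeriods_eq_zmultiples_one_of_T_mem]
  · exact AddSubgroup.mem_zmultiples 1
  · rw [CongruenceSubgroup.Gamma1_mem]
    simp [ModularGroup.coe_T]

theorem isCusp_G1_iff {c : OnePoint ℝ} :
    IsCusp c (G1 N) ↔ IsCusp c (Matrix.SpecialLinearGroup.mapGL (n := Fin 2) (R := ℤ) ℝ).range :=
  Subgroup.IsArithmetic.isCusp_iff_isCusp_SL2Z _

theorem isBoundedAtImInfty_slash_of_modularForm {k : ℤ} (F : ModularForm (G1 N) k) (γ : SL(2, ℤ)) :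
    IsBoundedAtImInfty ((F : ℍ → ℂ) ∣[k] γ) := by
  have hc : IsCusp (Matrix.SpecialLinearGroup.mapGL ℝ γ • OnePoint.infty)
      (Matrix.SpecialLinearGroup.mapGL (n := Fin 2) (R := ℤ) ℝ).range :=
    isCusp_SL2Z_iff'.2 ⟨γ, rfl⟩
  exact (OnePoint.isBoundedAt_iff_forall_SL2Z hc).1
    (ModularFormClass.bdd_at_cusps F (isCusp_G1_iff.2 hc)) γ rfl

/-- A modular form for `Γ₁(N)`, from a holomorphic invariant function all of whose translates by
`SL(2, ℤ)` are bounded at infinity. -/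
def modularFormOfBounded (k : ℤ) (f : ℍ → ℂ) (hd : MDiff f)
    (hs : ∀ γ ∈ CongruenceSubgroup.Gamma1 N, f ∣[k] γ = f)
    (hb : ∀ γ : SL(2, ℤ), IsBoundedAtImInfty (f ∣[k] γ)) : ModularForm (G1 N) k where
  toFun := f
  slash_action_eq' := by
    rintro _ ⟨γ, hγ, rfl⟩
    exact hs γ hγ
  holo' := hd
  bdd_at_cusps' := fun hc =>
    (OnePoint.isBoundedAt_iff_forall_SL2Z (isCusp_G1_iff.1 hc)).2 fun γ _ => hb γ

/-- Membership without bundled forms: holomorphy, the action of `Γ₀(N)` through the character, and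
boundedness at all cusps, that is, of all translates by `SL(2, ℤ)`. Invariance under `Γ₁(N)` follows
from the second condition. -/
theorem mem_modForms_iff : f ∈ ModForms N k χ ↔ MDiff f ∧
    (∀ γ ∈ CongruenceSubgroup.Gamma0 N, f ∣[(k : ℤ)] γ = χ ((γ 1 1 : ℤ) : ZMod N) • f) ∧
    ∀ γ : SL(2, ℤ), IsBoundedAtImInfty (f ∣[(k : ℤ)] γ) := by
  constructor
  · rintro ⟨⟨F, rfl⟩, h⟩
    exact ⟨ModularFormClass.holo F, h, isBoundedAtImInfty_slash_of_modularForm F⟩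
  · rintro ⟨h1, h2, h3⟩
    refine ⟨⟨modularFormOfBounded (N := N) k f h1 (fun γ hγ => ?_) h3, rfl⟩, h2⟩
    rw [h2 γ (CongruenceSubgroup.Gamma1_in_Gamma0 N hγ),
      ((CongruenceSubgroup.Gamma1_mem N γ).1 hγ).2.1, map_one, one_smul]

theorem hasQExp_of_modularForm {k : ℤ} (F : ModularForm (G1 N) k) :
    HasQExp F fun n => coeffAt n F := by
  refine hasQExp_coeffAt ?_ (ModularFormClass.holo F) ?_
  · exact SlashInvariantFormClass.periodic_comp_ofComplex F (one_mem_strictPeriods_G1 N)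
  · simpa using isBoundedAtImInfty_slash_of_modularForm F 1

theorem ModForms.hasQExp (hf : f ∈ ModForms N k χ) : HasQExp f fun n => coeffAt n f := by
  obtain ⟨⟨F, rfl⟩, -⟩ := hf
  exact hasQExp_of_modularForm F

/-- A form of level `M` is a form of each level divisible by `M`. -/
theorem ModForms.changeLevel {M : ℕ} [NeZero M] (h : M ∣ N) {χ : DirichletCharacter ℂ M}
    (hf : f ∈ ModForms M k χ) : f ∈ ModForms N k (DirichletCharacter.changeLevel h χ) := by
  rw [mem_modForms_iff] at hf ⊢
  refine ⟨hf.1, fun γ hγ => ?_, hf.2.2⟩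
  have hγ' : γ ∈ CongruenceSubgroup.Gamma0 M := by
    rw [CongruenceSubgroup.Gamma0_mem] at hγ ⊢
    rw [ZMod.intCast_zmod_eq_zero_iff_dvd] at hγ ⊢
    exact (Int.natCast_dvd_natCast.2 h).trans hγ
  rw [hf.2.1 γ hγ']
  congr 1
  have hu : IsUnit ((γ 1 1 : ℤ) : ZMod N) := by
    rw [CongruenceSubgroup.Gamma0_mem] at hγ
    have hdet := γ.det_coe
    rw [Matrix.det_fin_two] at hdet
    have := congrArg (fun t : ℤ => (t : ZMod N)) hdet
    push_cast at this
    rw [hγ, mul_zero, sub_zero] at this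
    exact IsUnit.of_mul_eq_one_right _ this
  obtain ⟨u, hu⟩ := hu
  have := DirichletCharacter.changeLevel_eq_cast_of_dvd χ h u
  rw [← hu, this, hu, ZMod.cast_intCast h]

end ModForms

/-! ### The derivative and the Rankin–Cohen bracket -/

section Bracket

open scoped Manifold
open Filter Topology

variable {f g h : ℍ → ℂ}

/-- Cauchy's inequality on discs of radius `1`. -/
theorem isBoundedAtImInfty_theta (hf : MDiff f) (hb : IsBoundedAtImInfty f) :
    IsBoundedAtImInfty (theta f) := by
  rw [isBoundedAtImInfty_iff] at hb ⊢
  obtain ⟨M, A, hM⟩ := hb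
  refine ⟨‖(2 * Real.pi * Complex.I : ℂ)⁻¹‖ * M, max A 0 + 2, fun z hz => ?_⟩
  rw [theta, Derivative.normalizedDerivOfComplex, norm_mul]
  refine mul_le_mul_of_nonneg_left ?_ (norm_nonneg _)
  have him : ∀ w ∈ Metric.closedBall (z : ℂ) 1, max A 0 + 1 ≤ w.im := by
    intro w hw
    have h1 : |(w - z).im| ≤ 1 := (Complex.abs_im_le_norm _).trans (by
      rwa [← dist_eq_norm])
    rw [Complex.sub_im, abs_le] at h1
    have : (z : ℂ).im = z.im := rfl
    linarith [h1.1]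
  have hpos : ∀ w ∈ Metric.closedBall (z : ℂ) 1, 0 < w.im := fun w hw =>
    lt_of_lt_of_le (by positivity) (him w hw)
  have hd : DiffContOnCl ℂ (f ∘ ofComplex) (Metric.ball (z : ℂ) 1) := by
    refine DifferentiableOn.diffContOnCl (fun w hw => ?_)
    rw [closure_ball _ one_ne_zero] at hw
    exact ((UpperHalfPlane.mdifferentiable_iff.1 hf).differentiableAt
      (isOpen_upperHalfPlaneSet.mem_nhds (hpos w hw))).differentiableWithinAt
  have := Complex.norm_deriv_le_of_forall_mem_sphere_norm_le one_pos hd (C := M) fun w hw => by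
    have hw' := Metric.sphere_subset_closedBall hw
    rw [Function.comp_apply, ofComplex_apply_of_im_pos (hpos w hw')]
    refine hM _ ((le_max_left A 0).trans ?_)
    have := him w hw'
    change max A 0 ≤ w.im
    linarith
  simpa using this

/-- The bracket commutes with the slash action: the terms that prevent `θ g` and `θ h` from being
modular cancel. -/
theorem rankinCohen_slash (hg : MDiff g) (hh : MDiff h) (a b : ℕ) (γ : SL(2, ℤ)) :
    rankinCohen a g b h ∣[((a + b + 2 : ℕ) : ℤ)] γ =
      rankinCohen a (g ∣[(a : ℤ)] γ) b (h ∣[(b : ℤ)] γ) := by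
  have e1 : ((a + b + 2 : ℕ) : ℤ) = (a : ℤ) + ((b : ℤ) + 2) := by push_cast; ring
  have e2 : ((a + b + 2 : ℕ) : ℤ) = (b : ℤ) + ((a : ℤ) + 2) := by push_cast; ring
  have h1 : (g * theta h) ∣[((a + b + 2 : ℕ) : ℤ)] γ =
      (g ∣[(a : ℤ)] γ) * (theta h ∣[(b : ℤ) + 2] γ) := by
    rw [e1, ModularForm.mul_slash_SL2]
  have h2 : (h * theta g) ∣[((a + b + 2 : ℕ) : ℤ)] γ =
      (h ∣[(b : ℤ)] γ) * (theta g ∣[(a : ℤ) + 2] γ) := by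
    rw [e2, ModularForm.mul_slash_SL2]
  have h3 := Derivative.normalizedDerivOfComplex_SL_slash (k := a) hg (γ := γ)
  have h4 := Derivative.normalizedDerivOfComplex_SL_slash (k := b) hh (γ := γ)
  simp only [rankinCohen]
  rw [sub_eq_add_neg, SlashAction.add_slash, SlashAction.neg_slash, ModularForm.SL_smul_slash,
    ModularForm.SL_smul_slash, h1, h2, ← sub_eq_add_neg]
  simp only [theta]
  rw [h3, h4]
  ext z
  simp only [Pi.sub_apply, Pi.smul_apply, Pi.mul_apply, smul_eq_mul, Int.cast_natCast]
  ring

theorem mdifferentiable_rankinCohen (hg : MDiff g) (hh : MDiff h) (a b : ℕ) :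
    MDiff (rankinCohen a g b h) := by
  have h1 : MDiff (theta g) := Derivative.normalizedDerivOfComplex_mdifferentiable hg
  have h2 : MDiff (theta h) := Derivative.normalizedDerivOfComplex_mdifferentiable hh
  exact ((hg.mul h2).const_smul (a : ℂ)).sub ((hh.mul h1).const_smul (b : ℂ))

theorem isBoundedAtImInfty_rankinCohen (hg : MDiff g) (hh : MDiff h) (hgb : IsBoundedAtImInfty g)
    (hhb : IsBoundedAtImInfty h) (a b : ℕ) : IsBoundedAtImInfty (rankinCohen a g b h) := by
  have h1 := isBoundedAtImInfty_theta hg hgb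
  have h2 := isBoundedAtImInfty_theta hh hhb
  have h3 : IsBoundedAtImInfty (g * theta h) := Filter.BoundedAtFilter.mul hgb h2
  have h4 : IsBoundedAtImInfty (h * theta g) := Filter.BoundedAtFilter.mul hhb h1
  have h5 : IsBoundedAtImInfty ((a : ℂ) • (g * theta h)) := Filter.BoundedAtFilter.smul _ h3
  have h6 : IsBoundedAtImInfty ((b : ℂ) • (h * theta g)) := Filter.BoundedAtFilter.smul _ h4
  rw [rankinCohen, sub_eq_add_neg]
  exact h5.add h6.neg

end Bracket

/-! ### The operator attached to a form congruent to `1` -/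

section Operator

open scoped Manifold
open Filter Topology

variable {N : ℕ} [NeZero N] {k kA : ℕ} {f g A : ℍ → ℂ}

theorem thetaTilde_slash (hg : MDiff g) (hA : MDiff A) (γ : SL(2, ℤ)) :
    thetaTilde kA A k g ∣[((k + kA + 2 : ℕ) : ℤ)] γ =
      thetaTilde kA (A ∣[(kA : ℤ)] γ) k (g ∣[(k : ℤ)] γ) := by
  rw [thetaTilde, thetaTilde, ModularForm.SL_smul_slash, rankinCohen_slash hg hA]

theorem mdifferentiable_thetaTilde (hg : MDiff g) (hA : MDiff A) : MDiff (thetaTilde kA A k g) :=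
  (mdifferentiable_rankinCohen hg hA k kA).const_smul _

theorem isBoundedAtImInfty_thetaTilde (hg : MDiff g) (hA : MDiff A) (hgb : IsBoundedAtImInfty g)
    (hAb : IsBoundedAtImInfty A) : IsBoundedAtImInfty (thetaTilde kA A k g) :=
  Filter.BoundedAtFilter.smul _ (isBoundedAtImInfty_rankinCohen hg hA hgb hAb k kA)

theorem thetaTilde_smul_smul (a b : ℂ) (hg : MDiff g) (hA : MDiff A) :
    thetaTilde kA (a • A) k (b • g) = (b * a) • thetaTilde kA A k g := by
  have h1 : theta (a • A) = a • theta A := Derivative.normalizedDerivOfComplex_smul a A hA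
  have h2 : theta (b • g) = b • theta g := Derivative.normalizedDerivOfComplex_smul b g hg
  ext z
  simp only [thetaTilde, rankinCohen, h1, h2, Pi.smul_apply, Pi.sub_apply, Pi.mul_apply,
    smul_eq_mul]
  ring

theorem thetaTilde_add (hf : MDiff f) (hg : MDiff g) :
    thetaTilde kA A k (f + g) = thetaTilde kA A k f + thetaTilde kA A k g := by
  have h1 : theta (f + g) = theta f + theta g := Derivative.normalizedDerivOfComplex_add f g hf hg
  ext z
  simp only [thetaTilde, rankinCohen, h1, Pi.smul_apply, Pi.sub_apply, Pi.mul_apply, Pi.add_apply,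
    smul_eq_mul]
  ring

theorem thetaTilde_mem {χA ε : DirichletCharacter ℂ N} (hA : A ∈ ModForms N kA χA)
    (hg : g ∈ ModForms N k ε) : thetaTilde kA A k g ∈ ModForms N (k + kA + 2) (ε * χA) := by
  rw [mem_modForms_iff] at hA hg ⊢
  refine ⟨mdifferentiable_thetaTilde hg.1 hA.1, fun γ hγ => ?_, fun γ => ?_⟩
  · rw [thetaTilde_slash hg.1 hA.1, hg.2.1 γ hγ, hA.2.1 γ hγ, thetaTilde_smul_smul _ _ hg.1 hA.1,
      MulChar.mul_apply]
  · rw [thetaTilde_slash hg.1 hA.1]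
    exact isBoundedAtImInfty_thetaTilde (hg.1.slash _ _) (hA.1.slash _ _) (hg.2.2 γ) (hA.2.2 γ)

/-- The operator `g ↦ -(1 / k_A) [g, A]` on modular forms of weight `k` for `Γ₁(N)`. -/
def thetaTildeHom (A : ModularForm (G1 N) (kA : ℤ)) (k : ℕ) :
    ModularForm (G1 N) (k : ℤ) →ₗ[ℂ] ModularForm (G1 N) ((k + kA + 2 : ℕ) : ℤ) where
  toFun g := modularFormOfBounded (N := N) _ (thetaTilde kA A k g)
    (mdifferentiable_thetaTilde (ModularFormClass.holo g) (ModularFormClass.holo A))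
    (fun γ hγ => by
      have h1 : (g : ℍ → ℂ) ∣[(k : ℤ)] γ = g :=
        SlashInvariantFormClass.slash_action_eq g _ (Subgroup.mem_map_of_mem _ hγ)
      have h2 : (A : ℍ → ℂ) ∣[(kA : ℤ)] γ = A :=
        SlashInvariantFormClass.slash_action_eq A _ (Subgroup.mem_map_of_mem _ hγ)
      rw [thetaTilde_slash (ModularFormClass.holo g) (ModularFormClass.holo A), h1, h2])
    (fun γ => by
      rw [thetaTilde_slash (ModularFormClass.holo g) (ModularFormClass.holo A)]
      exact isBoundedAtImInfty_thetaTilde ((ModularFormClass.holo g).slash _ _)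
        ((ModularFormClass.holo A).slash _ _) (isBoundedAtImInfty_slash_of_modularForm g γ)
        (isBoundedAtImInfty_slash_of_modularForm A γ))
  map_add' g h := DFunLike.coe_injective
    (thetaTilde_add (ModularFormClass.holo g) (ModularFormClass.holo h))
  map_smul' c g := DFunLike.coe_injective (by
    have := thetaTilde_smul_smul (kA := kA) (k := k) 1 c (ModularFormClass.holo g)
      (ModularFormClass.holo A)
    rw [one_smul, mul_one] at this
    exact this)

/-- The operator on the graded space of modular forms for `Γ₁(N)`, homogeneous component by component. -/
theorem exists_thetaTilde_directSum (A : ModularForm (G1 N) (kA : ℤ)) :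
    ∃ Θ : (⨁ k : ℕ, ModularForm (G1 N) (k : ℤ)) →ₗ[ℂ] (⨁ k : ℕ, ModularForm (G1 N) (k : ℤ)),
      ∀ (k : ℕ) (g : ModularForm (G1 N) (k : ℤ)),
        ∃ h : ModularForm (G1 N) ((k + kA + 2 : ℕ) : ℤ),
          (h : ℍ → ℂ) = thetaTilde kA A k g ∧
          Θ (DirectSum.lof ℂ ℕ (fun j : ℕ => ModularForm (G1 N) (j : ℤ)) k g) =
            DirectSum.lof ℂ ℕ (fun j : ℕ => ModularForm (G1 N) (j : ℤ)) (k + kA + 2) h := by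
  refine ⟨DirectSum.toModule ℂ ℕ _ fun k =>
    (DirectSum.lof ℂ ℕ (fun j : ℕ => ModularForm (G1 N) (j : ℤ)) (k + kA + 2)) ∘ₗ
      thetaTildeHom A k, fun k g => ⟨thetaTildeHom A k g, rfl, ?_⟩⟩
  rw [DirectSum.toModule_lof]
  rfl

end Operator

/-! ### Hecke operators on power series in `q` -/

section Hecke

open Function.Periodic (qParam)

variable {g : ℍ → ℂ} {c : ℕ → ℂ}

/-- The substitution of `q ^ p` for `q` in a power series. -/
theorem hasSum_of_mul_index {p : ℕ} (hp : 0 < p) {F : ℕ → ℂ} {s : ℂ}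
    (h : HasSum (fun m => F m) s) :
    HasSum (fun n => if p ∣ n then F (n / p) else 0) s := by
  have hinj : Function.Injective fun m : ℕ => p * m := mul_right_injective₀ hp.ne'
  rw [← hinj.hasSum_iff]
  · simpa [Function.comp_def, Nat.mul_div_cancel_left _ hp] using h
  · intro x hx
    rw [if_neg]
    rintro ⟨m, rfl⟩
    exact hx ⟨m, rfl⟩

theorem sum_exp_eq_ite {p : ℕ} (hp : 0 < p) (m : ℕ) :
    ∑ b ∈ Finset.range p, Complex.exp (2 * Real.pi * Complex.I * (m * b / p)) =
      if p ∣ m then (p : ℂ) else 0 := by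
  have hp0 : (p : ℂ) ≠ 0 := by exact_mod_cast hp.ne'
  have hζ := Complex.isPrimitiveRoot_exp p hp.ne'
  have e : ∀ b ∈ Finset.range p, Complex.exp (2 * Real.pi * Complex.I * (m * b / p)) =
      (Complex.exp (2 * Real.pi * Complex.I / p) ^ m) ^ b := fun b _ => by
    rw [← Complex.exp_nat_mul, ← Complex.exp_nat_mul]
    congr 1; field_simp
  rw [Finset.sum_congr rfl e]
  split_ifs with h
  · rw [(hζ.pow_eq_one_iff_dvd m).2 h]; simp
  · rw [geom_sum_eq (fun h' => h ((hζ.pow_eq_one_iff_dvd m).1 h')), ← pow_mul, mul_comm m, pow_mul,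
      hζ.pow_eq_one, one_pow, sub_self, zero_div]

/-- The Hecke operator on coefficients: `a_n` becomes `a_{pn} + ε(p) p^{k-1} a_{n/p}`. -/
theorem HasQExp.hecke {p : ℕ} (hp : p.Prime) (N k : ℕ) (ε : DirichletCharacter ℂ N)
    (h : HasQExp g c) :
    HasQExp (hecke p hp N k ε g) fun n =>
      c (p * n) + ε (p : ZMod N) * (p : ℂ) ^ ((k : ℤ) - 1) * (if p ∣ n then c (n / p) else 0) := by
  intro τ
  have hp0 : (p : ℂ) ≠ 0 := by exact_mod_cast hp.ne_zero
  set q := qParam 1 (τ : ℂ) with hq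
  -- the term `g (p z)`
  have h1 : HasSum (fun n => (if p ∣ n then c (n / p) else 0) * q ^ n)
      (g (affinePoint (p : ℝ) (Nat.cast_pos.mpr hp.pos) 0 τ)) := by
    have h2 := hasSum_of_mul_index hp.pos (h (affinePoint (p : ℝ) (Nat.cast_pos.mpr hp.pos) 0 τ))
    refine (funext fun n => ?_ : (fun n => (if p ∣ n then c (n / p) else 0) * q ^ n) = _) ▸ h2
    split_ifs with hn
    · obtain ⟨m, rfl⟩ := hn
      rw [Nat.mul_div_cancel_left _ hp.pos, smul_eq_mul]
      congr 1
      rw [hq, qParam, qParam, ← Complex.exp_nat_mul, ← Complex.exp_nat_mul]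
      congr 1
      simp [affinePoint]
      ring
    · simp
  -- the average over the translates of `g (z / p)`
  have h3 : HasSum (fun n => c (p * n) * q ^ n) ((p : ℂ)⁻¹ * ∑ b ∈ Finset.range p,
      g (affinePoint ((p : ℝ)⁻¹) (inv_pos.mpr (Nat.cast_pos.mpr hp.pos))
        ((b : ℝ) / (p : ℝ)) τ)) := by
    have h4 := (hasSum_sum (s := Finset.range p) fun b _ =>
      h (affinePoint ((p : ℝ)⁻¹) (inv_pos.mpr (Nat.cast_pos.mpr hp.pos))
        ((b : ℝ) / (p : ℝ)) τ)).mul_left (p : ℂ)⁻¹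
    have hinj : Function.Injective fun m : ℕ => p * m := mul_right_injective₀ hp.ne_zero
    have e : ∀ m : ℕ, (p : ℂ)⁻¹ * ∑ b ∈ Finset.range p, c m • qParam 1
        ((affinePoint ((p : ℝ)⁻¹) (inv_pos.mpr (Nat.cast_pos.mpr hp.pos))
        ((b : ℝ) / (p : ℝ)) τ : ℍ) : ℂ) ^ m =
        if p ∣ m then c m * Complex.exp (2 * Real.pi * Complex.I * (m * τ / p)) else 0 := by
      intro m
      have e1 : ∀ b ∈ Finset.range p, c m • qParam 1
          ((affinePoint ((p : ℝ)⁻¹) (inv_pos.mpr (Nat.cast_pos.mpr hp.pos))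
          ((b : ℝ) / (p : ℝ)) τ : ℍ) : ℂ) ^ m =
          c m * Complex.exp (2 * Real.pi * Complex.I * (m * τ / p)) *
            Complex.exp (2 * Real.pi * Complex.I * (m * b / p)) := by
        intro b _
        rw [smul_eq_mul, mul_assoc, ← Complex.exp_add, qParam, ← Complex.exp_nat_mul]
        congr 2
        simp [affinePoint]
        ring
      rw [Finset.sum_congr rfl e1, ← Finset.mul_sum, sum_exp_eq_ite hp.pos]
      split_ifs
      · field_simp
      · simp
    simp only [e] at h4
    rw [← hinj.hasSum_iff] at h4
    · refine (funext fun n => ?_ : (fun n => c (p * n) * q ^ n) = _) ▸ h4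
      simp only [Function.comp_apply, dvd_mul_right, if_true]
      rw [hq, qParam, ← Complex.exp_nat_mul]
      congr 2
      push_cast
      field_simp
    · intro x hx
      rw [if_neg]
      rintro ⟨m, rfl⟩
      exact hx ⟨m, rfl⟩
  have h5 := h3.add (h1.mul_left (ε (p : ZMod N) * (p : ℂ) ^ ((k : ℤ) - 1)))
  have e : ∀ n, (c (p * n) + ε (p : ZMod N) * (p : ℂ) ^ ((k : ℤ) - 1) *
      (if p ∣ n then c (n / p) else 0)) • q ^ n = c (p * n) * q ^ n +
      ε (p : ZMod N) * (p : ℂ) ^ ((k : ℤ) - 1) * ((if p ∣ n then c (n / p) else 0) * q ^ n) :=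
    fun n => by rw [smul_eq_mul]; ring
  simp only [e]
  exact h5

end Hecke

/-! ### Congruences for the operator -/

section Congruences

variable {V : ValuationSubring QBar} {ℓ N kA k : ℕ} [NeZero N] {χA ε : DirichletCharacter ℂ N}
  {g A : ℍ → ℂ}

theorem coeffAt_one (n : ℕ) : coeffAt n (1 : ℍ → ℂ) = if n = 0 then 1 else 0 := by
  rw [coeffAt, qExpansion_one, PowerSeries.coeff_one]

theorem coeffAt_zero (n : ℕ) : coeffAt n (0 : ℍ → ℂ) = 0 := by
  rw [coeffAt, qExpansion_zero, map_zero]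

theorem Cong.reduces {x x' : ℂ} {r : Residue V} (h : Cong V x x') (h' : Reduces V x' r) :
    Reduces V x r := by
  obtain ⟨s, h1, h2⟩ := h
  rwa [h'.unique h2]

theorem thetaTilde_eq (hk : 0 < kA) : thetaTilde kA A k g =
    A * theta g - (k : ℂ) • (g * ((1 / (kA : ℂ)) • theta A)) := by
  have : (kA : ℂ) ≠ 0 := by exact_mod_cast hk.ne'
  ext z
  simp only [thetaTilde, rankinCohen, Pi.sub_apply, Pi.smul_apply, Pi.mul_apply, smul_eq_mul]
  field_simp
  ring

/-- The reduction of `-(1 / k_A) [g, A] = A θ(g) - k g (θ(A) / k_A)` is that of `θ(g)`. -/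
theorem ThetaCond.reduces_thetaTilde (hA : ThetaCond V ℓ N kA χA A) (hg : g ∈ ModForms N k ε)
    {r : ℕ → Residue V} (hr : ∀ n, Reduces V (coeffAt n g) (r n)) (n : ℕ) :
    Reduces V (coeffAt n (thetaTilde kA A k g)) (n * r n) := by
  have qA := ModForms.hasQExp hA.mem
  have qg := ModForms.hasQExp hg
  have h1 := (qA.mul qg.theta).sub ((qg.mul (qA.theta.smul (1 / (kA : ℂ)))).smul (k : ℂ))
  rw [thetaTilde_eq hA.weight_pos, h1.coeffAt_eq]
  have hA1 : ∀ n, Reduces V (coeffAt n A) (if n = 0 then 1 else 0) := fun n => by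
    refine (hA.cong_one n).reduces ?_
    rw [coeffAt_one]
    split_ifs
    · exact reduces_one
    · exact reduces_zero
  have hA2 : ∀ n : ℕ, Reduces V (1 / (kA : ℂ) * (n * coeffAt n A)) 0 := fun n => by
    have := (hA.theta_cong_zero n).reduces (r := 0) (by rw [coeffAt_zero]; exact reduces_zero)
    rwa [(qA.theta.smul (1 / (kA : ℂ))).coeffAt_eq] at this
  have h2 := (Reduces.sum (Finset.HasAntidiagonal.antidiagonal n) fun p _ =>
    (hA1 p.1).mul ((reduces_natCast p.2).mul (hr p.2))).sub
    ((reduces_natCast k).mul (Reduces.sum (Finset.HasAntidiagonal.antidiagonal n) fun p _ =>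
      (hr p.1).mul (hA2 p.2)))
  convert h2 using 1
  rw [Finset.Nat.sum_antidiagonal_eq_sum_range_succ_mk, Finset.sum_range_succ']
  simp

/-- Comparing first coefficients, the eigenvalue of a normalised eigenform is `a_p`. The Hecke relation
for the coefficients `n a_n` is `p n` times the one for `a_n`, because `χ_A(p) p^{k_A} ≡ 1` makes up
for the change of weight and character. For `p = ℓ` or `p ∣ N` the terms with this factor vanish. -/
theorem ThetaCond.eigen_thetaTilde (hℓ : ℓ.Prime) (hV : (ℓ : QBar) ∈ V.nonunits)
    (hA : ThetaCond V ℓ N kA χA A) (hg : g ∈ ModForms N k ε) {p : ℕ} (hp : p.Prime)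
    (hnorm : IsNormalisedMod V g) {lam : Residue V} (heig : IsHeckeEigenMod V p hp N k ε g lam)
    {a : Residue V} (ha : Reduces V (coeffAt p g) a) :
    IsHeckeEigenMod V p hp N (k + kA + 2) (ε * χA) (thetaTilde kA A k g) ((p : Residue V) * a) := by
  have hp0 : (p : ℂ) ≠ 0 := by exact_mod_cast hp.ne_zero
  choose r hr heig using heig
  have qg := ModForms.hasQExp hg
  have qh := ModForms.hasQExp (thetaTilde_mem hA.mem hg)
  have hh := hA.reduces_thetaTilde hg hr
  simp only [(qg.hecke hp N k ε).coeffAt_eq] at heig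
  have hr1 : r 1 = 1 := ((hr 1).unique (hnorm.reduces reduces_one))
  have hlam : lam = a := by
    have := heig 1
    rw [if_neg (by simpa using hp.one_lt.ne'), mul_zero, add_zero, mul_one, hr1, mul_one] at this
    exact this.unique ha
  subst hlam
  obtain ⟨s, hs⟩ := (IsIntegralAt.of_isIntegral (V := V)
    (isIntegral_dirichletCharacter ε (p : ZMod N))).exists_reduces
  obtain ⟨t, ht⟩ := (IsIntegralAt.of_isIntegral (V := V)
    (isIntegral_dirichletCharacter χA (p : ZMod N))).exists_reduces
  -- if `p = ℓ` then `p` reduces to `0`, and if `p ∣ N` then `ε(p) = 0`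
  have key : s * t * (p : Residue V) ^ kA * p = s * p := by
    by_cases hpN : p.Coprime N
    · by_cases hpl : p = ℓ
      · rw [hpl, natCast_residue_eq_zero hV]; simp
      · have hpl' : p.Coprime ℓ := (Nat.coprime_primes hp hℓ).2 hpl
        have h1 := ht.unique (hA.character p (hpN.mul_right hpl'))
        have h2 := natCast_residue_ne_zero hℓ hV hpl'
        rw [h1, zpow_neg, zpow_natCast]
        field_simp
    · have h0 : ε (p : ZMod N) = 0 := by
        apply ε.map_nonunit
        rwa [ZMod.isUnit_iff_coprime]
      rw [h0] at hs
      rw [hs.unique reduces_zero]; simp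
  intro n
  refine ⟨_, hh n, ?_⟩
  rw [(qh.hecke hp N (k + kA + 2) (ε * χA)).coeffAt_eq, MulChar.mul_apply]
  have e0 : (((k + kA + 2 : ℕ) : ℤ) - 1) = ((k + kA + 1 : ℕ) : ℤ) := by push_cast; ring
  rw [e0, zpow_natCast]
  by_cases hpn : p ∣ n
  · obtain ⟨m, rfl⟩ := hpn
    have h1 := heig (p * m)
    simp only [dvd_mul_right, if_true, Nat.mul_div_cancel_left _ hp.pos] at h1 ⊢
    have h2 := (reduces_natCast (V := V) p).mul h1
    have h3 := ((reduces_natCast (V := V) p).mul (hr (p * (p * m)))).add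
      ((hs.mul ((reduces_natCast (V := V) p).pow k)).mul (hr m))
    have e1 : (p : ℂ) * (coeffAt (p * (p * m)) g +
        ε (p : ZMod N) * (p : ℂ) ^ ((k : ℤ) - 1) * coeffAt m g) =
        p * coeffAt (p * (p * m)) g + ε (p : ZMod N) * (p : ℂ) ^ k * coeffAt m g := by
      rw [zpow_sub_one₀ hp0, zpow_natCast]
      field_simp
    rw [e1] at h2
    have h4 := h2.unique h3
    have h5 := (hh (p * (p * m))).add (((hs.mul ht).mul
      ((reduces_natCast (V := V) p).pow (k + kA + 1))).mul (hh m))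
    convert h5 using 1
    push_cast
    linear_combination (p : Residue V) * m * h4 - (p : Residue V) ^ k * m * r m * key
  · have h1 := heig n
    rw [if_neg hpn, mul_zero, add_zero] at h1 ⊢
    have h2 := (hr (p * n)).unique h1
    have h3 := hh (p * n)
    rw [h2] at h3
    convert h3 using 1
    push_cast
    ring

end Congruences

/-! ### Sums over translates by the integers -/

section Cotangent

open Filter Topology
open scoped Real

/-- The function `π cot (π x)`; it has the value `0` at the integers. -/
def cotPi (x : ℂ) : ℂ := π * Complex.cot (π * x)

/-- The function `∑_n (x + n)⁻²`, where the term with `x + n = 0` is omitted. -/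
def sqInvSum (x : ℂ) : ℂ := ∑' n : ℤ, 1 / (x + n) ^ 2

theorem sum_Icc_int_succ {M : Type*} [AddCommMonoid M] (f : ℤ → M) (K : ℕ) :
    ∑ n ∈ Finset.Icc (-((K + 1 : ℕ) : ℤ)) (K + 1 : ℕ), f n =
      ∑ n ∈ Finset.Icc (-(K : ℤ)) K, f n + (f (K + 1) + f (-(K + 1))) := by
  have : Finset.Icc (-((K + 1 : ℕ) : ℤ)) (K + 1 : ℕ) =
      insert ((K : ℤ) + 1) (insert (-((K : ℤ) + 1)) (Finset.Icc (-(K : ℤ)) K)) := by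
    ext; simp only [Finset.mem_insert, Finset.mem_Icc]; push_cast; omega
  rw [this, Finset.sum_insert, Finset.sum_insert]
  · rw [← add_assoc, add_comm]
  · simp
  · simp only [Finset.mem_insert, Finset.mem_Icc]; omega

theorem sum_Icc_int_eq {M : Type*} [AddCommMonoid M] (f : ℤ → M) (K : ℕ) :
    ∑ n ∈ Finset.Icc (-(K : ℤ)) K, f n =
      f 0 + ∑ j ∈ Finset.range K, (f (j + 1) + f (-(j + 1))) := by
  induction K with
  | zero => simp
  | succ K ih => rw [sum_Icc_int_succ, ih, Finset.sum_range_succ, add_assoc]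

theorem sum_Icc_int_neg {M : Type*} [AddCommMonoid M] (f : ℤ → M) (K : ℕ) :
    ∑ n ∈ Finset.Icc (-(K : ℤ)) K, f (-n) = ∑ n ∈ Finset.Icc (-(K : ℤ)) K, f n := by
  refine Finset.sum_nbij' (fun n => -n) (fun n => -n) ?_ ?_ ?_ ?_ ?_ <;>
    simp <;> omega

theorem sum_Icc_int_add_one {M : Type*} [AddCommGroup M] (f : ℤ → M) (K : ℕ) :
    ∑ n ∈ Finset.Icc (-(K : ℤ)) K, f (n + 1) =
      ∑ n ∈ Finset.Icc (-(K : ℤ)) K, f n + f (K + 1) - f (-K) := by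
  induction K with
  | zero => simp
  | succ K ih =>
    rw [sum_Icc_int_succ, sum_Icc_int_succ, ih]
    have : (-((K : ℤ) + 1) + 1) = -K := by ring
    rw [this]; push_cast; abel

theorem cotPi_add_one (x : ℂ) : cotPi (x + 1) = cotPi x := by
  simp [cotPi, Complex.cot, mul_add, Complex.sin_add_pi, Complex.cos_add_pi]

theorem cotPi_neg (x : ℂ) : cotPi (-x) = -cotPi x := by
  simp [cotPi, Complex.cot, Complex.cos_neg, Complex.sin_neg, div_neg]

theorem cotPi_zero : cotPi 0 = 0 := by simp [cotPi, Complex.cot]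

theorem sqInvSum_add_one (x : ℂ) : sqInvSum (x + 1) = sqInvSum x := by
  rw [sqInvSum, sqInvSum, ← (Equiv.addRight (1 : ℤ)).tsum_eq (fun n : ℤ => 1 / (x + n) ^ 2)]
  exact tsum_congr fun n => by
    simp only [Equiv.coe_addRight, Int.cast_add, Int.cast_one, add_comm, add_left_comm]

theorem sqInvSum_neg (x : ℂ) : sqInvSum (-x) = sqInvSum x := by
  rw [sqInvSum, sqInvSum, ← (Equiv.neg ℤ).tsum_eq (fun n : ℤ => 1 / (x + n) ^ 2)]
  refine tsum_congr fun n => ?_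
  simp only [Equiv.neg_apply, Int.cast_neg]
  ring_nf

theorem tendsto_one_div_add_natCast (x : ℂ) :
    Tendsto (fun K : ℕ => 1 / (x + K)) atTop (𝓝 0) := by
  simp only [one_div]
  refine tendsto_inv₀_cobounded.comp ?_
  exact tendsto_const_add_cobounded x |>.comp tendsto_natCast_atTop_cobounded

theorem summable_sqInv (x : ℂ) : Summable fun n : ℤ => 1 / (x + n) ^ 2 := by
  have := EisensteinSeries.linear_right_summable x 1 (k := 2) le_rfl
  simpa [zpow_ofNat] using this

/-- The Mittag-Leffler expansion of the cotangent as a symmetric sum; it holds at the integers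
too, as the term at the pole is then `1 / 0 = 0`. -/
theorem tendsto_sum_cotPi (x : ℂ) :
    Tendsto (fun K : ℕ => ∑ n ∈ Finset.Icc (-(K : ℤ)) K, 1 / (x + n)) atTop (𝓝 (cotPi x)) := by
  by_cases hx : x ∈ Complex.integerComplement
  · have h1 := (tendsto_logDeriv_euler_cot_sub hx).const_add (1 / x)
    have e : 1 / x + ((π : ℂ) * Complex.cot (π * x) - 1 / x) = cotPi x := by rw [cotPi]; ring
    rw [e] at h1
    refine h1.congr fun K => ?_
    rw [sum_Icc_int_eq]
    simp only [Int.cast_zero, add_zero, cotTerm]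
    refine congrArg _ (Finset.sum_congr rfl fun j _ => ?_)
    push_cast; rw [add_comm]; congr 2
  · have hs : ∀ y : ℂ,
        Tendsto (fun K : ℕ => ∑ n ∈ Finset.Icc (-(K : ℤ)) K, (1 / (y + 1 + n) - 1 / (y + n)))
          atTop (𝓝 0) := by
      intro y
      have h1 := (tendsto_one_div_add_natCast (y + 1)).add (tendsto_one_div_add_natCast (-y))
      rw [add_zero] at h1
      refine h1.congr fun K => ?_
      have := sum_Icc_int_add_one (fun n : ℤ => 1 / (y + n)) K
      rw [Finset.sum_sub_distrib, eq_sub_iff_add_eq]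
      calc _ = ∑ n ∈ Finset.Icc (-(K : ℤ)) K, 1 / (y + (n : ℤ)) + 1 / (y + (K + 1 : ℤ))
            - 1 / (y + (-K : ℤ)) := by
            push_cast
            have e : -y + (K : ℂ) = -(y + -K) := by ring
            rw [e, div_neg]; ring
        _ = _ := by
          rw [← this]
          exact Finset.sum_congr rfl fun n _ => by push_cast; ring_nf
    have hs1 : ∀ y : ℂ,
        Tendsto (fun K : ℕ => ∑ n ∈ Finset.Icc (-(K : ℤ)) K, 1 / (y + n)) atTop
          (𝓝 (cotPi y)) ↔
        Tendsto (fun K : ℕ => ∑ n ∈ Finset.Icc (-(K : ℤ)) K, 1 / (y + 1 + n)) atTop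
          (𝓝 (cotPi (y + 1))) := by
      intro y
      rw [cotPi_add_one]
      constructor
      · intro h
        simpa using (hs y).add h
      · intro h
        simpa using h.sub (hs y)
    obtain ⟨k, rfl⟩ : ∃ k : ℤ, (k : ℂ) = x := by
      simpa [Complex.integerComplement] using hx
    clear hx
    have h0 : Tendsto (fun K : ℕ => ∑ n ∈ Finset.Icc (-(K : ℤ)) K, 1 / (((0 : ℤ) : ℂ) + n))
        atTop (𝓝 (cotPi (0 : ℤ))) := by
      rw [Int.cast_zero, cotPi_zero]
      refine tendsto_const_nhds.congr fun K => ?_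
      have := sum_Icc_int_neg (fun n : ℤ => 1 / ((0 : ℂ) + n)) K
      simp only [zero_add, Int.cast_neg, div_neg, Finset.sum_neg_distrib] at this ⊢
      exact (self_eq_neg.1 this.symm).symm
    induction k using Int.induction_on with
    | zero => exact h0
    | succ i ih =>
      have := (hs1 ((i : ℤ) : ℂ)).1 ih
      simpa using this
    | pred i ih =>
      apply (hs1 _).2
      simpa using ih

end Cotangent

/-! ### Eisenstein series attached to division points -/

section Lattice

open Filter Topology
open scoped Matrix
open scoped Real
open EisensteinSeries (e2Summand G2 D2)

/-- The point `v₀ z + v₁` of the lattice `ℤ z + ℤ`. -/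
def latticePoint (z : ℍ) (v : Fin 2 → ℤ) : ℂ := v 0 * z + v 1

/-- The term of the Weierstrass zeta function, at the point `u`, for the lattice point `-w`. With
`1 / 0 = 0` this is the principal part `1 / u` if `w = 0`. -/
def zetaTerm (u w : ℂ) : ℂ := 1 / (u + w) - 1 / w + u / w ^ 2

/-- The term of the Weierstrass `℘`-function, at the point `u`, for the lattice point `-w`. With
`1 / 0 = 0` this is the principal part `1 / u ^ 2` if `w = 0`. -/
def wpTerm (u w : ℂ) : ℂ := 1 / (u + w) ^ 2 - 1 / w ^ 2

/-- The sum of `zetaTerm` over the lattice. At `u` not in the lattice this is the Weierstrass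
zeta function; the convention `1 / 0 = 0` removes the poles. -/
def zetaSum (z : ℍ) (u : ℂ) : ℂ := ∑' v : Fin 2 → ℤ, zetaTerm u (latticePoint z v)

/-- The sum of `wpTerm` over the lattice. At `u` not in the lattice this is the Weierstrass
`℘`-function. -/
def wpSum (z : ℍ) (u : ℂ) : ℂ := ∑' v : Fin 2 → ℤ, wpTerm u (latticePoint z v)

theorem summable_latticePoint {f : ℂ → ℂ} {C R : ℝ}
    (hf : ∀ w, w ≠ 0 → R ≤ ‖w‖ → ‖f w‖ ≤ C / ‖w‖ ^ 3) (hC : 0 ≤ C) (z : ℍ) :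
    Summable fun v : Fin 2 → ℤ => f (latticePoint z v) := by
  refine EisensteinSeries.summable_of_isBigO_rpow_norm (a := 3) (by norm_num) ?_
  have hr := EisensteinSeries.r_pos z
  refine Asymptotics.IsBigO.of_bound (C / EisensteinSeries.r z ^ 3) ?_
  have ht : Tendsto (fun v : Fin 2 → ℤ => ‖v‖) cofinite atTop := by
    rw [← cocompact_eq_cofinite]; exact tendsto_norm_cocompact_atTop
  filter_upwards [ht.eventually_ge_atTop (R / EisensteinSeries.r z),
    ht.eventually_gt_atTop 0] with v hv hv0
  have hv1 : v ≠ 0 := by rintro rfl; simp at hv0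
  have h1 : EisensteinSeries.r z * ‖v‖ ≤ ‖latticePoint z v‖ := EisensteinSeries.r_mul_max_le z hv1
  have h2 : 0 < EisensteinSeries.r z * ‖v‖ := mul_pos hr hv0
  have h3 : latticePoint z v ≠ 0 := norm_pos_iff.1 (h2.trans_le h1)
  have h4 : R ≤ ‖latticePoint z v‖ := by
    rw [div_le_iff₀ hr] at hv; linarith
  refine (hf _ h3 h4).trans ?_
  rw [Real.norm_of_nonneg (by positivity)]
  have : (‖v‖ ^ (3 : ℝ)) = ‖v‖ ^ 3 := by norm_cast
  rw [this, ← div_eq_mul_inv, div_div, ← mul_pow]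
  gcongr

/-- Far from the origin, a lattice point is not moved much by adding `u`. -/
theorem norm_half_le {u w : ℂ} (h : 2 * ‖u‖ ≤ ‖w‖) : ‖w‖ / 2 ≤ ‖u + w‖ := by
  have := norm_sub_norm_le w (-u)
  rw [norm_neg, sub_neg_eq_add, add_comm w] at this
  linarith

theorem summable_zetaTerm (z : ℍ) (u : ℂ) :
    Summable fun v : Fin 2 → ℤ => zetaTerm u (latticePoint z v) := by
  refine summable_latticePoint (C := 2 * ‖u‖ ^ 2) (R := 2 * ‖u‖) (fun w hw hR => ?_)
    (by positivity) z
  have hw' : 0 < ‖w‖ := norm_pos_iff.2 hw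
  have h1 := norm_half_le hR
  have h2 : u + w ≠ 0 := norm_pos_iff.1 (by linarith)
  have e : zetaTerm u w = u ^ 2 / (w ^ 2 * (u + w)) := by
    rw [zetaTerm]; field_simp; ring
  rw [e, norm_div, norm_mul, norm_pow, norm_pow, div_le_div_iff₀ (by positivity) (by positivity)]
  calc ‖u‖ ^ 2 * ‖w‖ ^ 3 = 2 * ‖u‖ ^ 2 * (‖w‖ ^ 2 * (‖w‖ / 2)) := by ring
    _ ≤ _ := by gcongr

theorem summable_wpTerm (z : ℍ) (u : ℂ) :
    Summable fun v : Fin 2 → ℤ => wpTerm u (latticePoint z v) := by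
  refine summable_latticePoint (C := 12 * ‖u‖) (R := 2 * ‖u‖) (fun w hw hR => ?_)
    (by positivity) z
  have hw' : 0 < ‖w‖ := norm_pos_iff.2 hw
  have h1 := norm_half_le hR
  have h2 : u + w ≠ 0 := norm_pos_iff.1 (by linarith)
  have e : wpTerm u w = -(u * (2 * w + u)) / (w ^ 2 * (u + w) ^ 2) := by
    rw [wpTerm]; field_simp; ring
  have h3 : ‖2 * w + u‖ ≤ 3 * ‖w‖ := by
    refine (norm_add_le _ _).trans ?_
    rw [norm_mul, Complex.norm_ofNat]; linarith [norm_nonneg u]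
  rw [e, norm_div, norm_neg, norm_mul, norm_mul, norm_pow, norm_pow,
    div_le_div_iff₀ (by positivity) (by positivity)]
  calc ‖u‖ * ‖2 * w + u‖ * ‖w‖ ^ 3 ≤ ‖u‖ * (3 * ‖w‖) * ‖w‖ ^ 3 := by gcongr
    _ = 12 * ‖u‖ * (‖w‖ ^ 2 * (‖w‖ / 2) ^ 2) := by ring
    _ ≤ _ := by gcongr

/-- The action of `SL₂(ℤ)` on row vectors. -/
def vecMulEquiv (γ : SL(2, ℤ)) : (Fin 2 → ℤ) ≃ (Fin 2 → ℤ) where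
  toFun v := v ᵥ* γ
  invFun v := v ᵥ* (γ⁻¹ : SL(2, ℤ))
  left_inv v := by
    simp only [Matrix.vecMul_vecMul, ← Matrix.SpecialLinearGroup.coe_mul, mul_inv_cancel,
      Matrix.SpecialLinearGroup.coe_one, Matrix.vecMul_one]
  right_inv v := by
    simp only [Matrix.vecMul_vecMul, ← Matrix.SpecialLinearGroup.coe_mul, inv_mul_cancel,
      Matrix.SpecialLinearGroup.coe_one, Matrix.vecMul_one]

theorem latticePoint_smul (γ : SL(2, ℤ)) (z : ℍ) (v : Fin 2 → ℤ) :
    latticePoint (γ • z) v = latticePoint z (v ᵥ* γ) / denom γ z := by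
  have h1 := EisensteinSeries.eisSummand_SL2_apply (-1) v γ z
  simp only [EisensteinSeries.eisSummand, neg_neg, zpow_one, zpow_neg] at h1
  rw [latticePoint, h1, latticePoint, div_eq_inv_mul]

theorem zetaTerm_div (u w : ℂ) {j : ℂ} (hj : j ≠ 0) :
    zetaTerm (u / j) (w / j) = j * zetaTerm u w := by
  rw [zetaTerm, zetaTerm, ← add_div, one_div_div, one_div_div, div_pow, div_div_div_eq]
  rw [mul_add, mul_sub]
  congr 1
  · ring
  · rcases eq_or_ne w 0 with rfl | hw
    · simp
    · field_simp

theorem wpTerm_div (u w : ℂ) {j : ℂ} : wpTerm (u / j) (w / j) = j ^ 2 * wpTerm u w := by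
  rw [wpTerm, wpTerm, ← add_div, div_pow, div_pow, one_div_div, one_div_div]
  ring

theorem zetaSum_smul (γ : SL(2, ℤ)) (z : ℍ) (u : ℂ) :
    zetaSum (γ • z) (u / denom γ z) = denom γ z * zetaSum z u := by
  rw [zetaSum, zetaSum, ← tsum_mul_left,
    ← (vecMulEquiv γ).tsum_eq fun v => denom γ z * zetaTerm u (latticePoint z v)]
  refine tsum_congr fun v => ?_
  rw [latticePoint_smul, zetaTerm_div _ _ (denom_ne_zero _ z)]
  rfl

theorem wpSum_smul (γ : SL(2, ℤ)) (z : ℍ) (u : ℂ) :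
    wpSum (γ • z) (u / denom γ z) = denom γ z ^ 2 * wpSum z u := by
  rw [wpSum, wpSum, ← tsum_mul_left,
    ← (vecMulEquiv γ).tsum_eq fun v => denom γ z ^ 2 * wpTerm u (latticePoint z v)]
  refine tsum_congr fun v => ?_
  rw [latticePoint_smul, wpTerm_div]
  rfl

/-- The Eisenstein series of weight one attached to the division point `(a₀ z + a₁) / c`: the value
there of the Weierstrass zeta function, minus the quasi-period map `u ↦ η(u)`, which on the real
basis `z`, `1` of `ℂ` is given by `η(1) = G₂` and `η(z) = z G₂ - 2 π i`. -/
def eisOne (c : ℕ) (a : Fin 2 → ℤ) (z : ℍ) : ℂ :=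
  zetaSum z (latticePoint z a / c) - latticePoint z a / c * G2 z + 2 * π * Complex.I * a 0 / c

/-- The Eisenstein series of weight two attached to the division point `(a₀ z + a₁) / c`, a value
of the Weierstrass `℘`-function. -/
def eisTwo (c : ℕ) (a : Fin 2 → ℤ) (z : ℍ) : ℂ := wpSum z (latticePoint z a / c)

theorem eisTwo_slash (c : ℕ) (a : Fin 2 → ℤ) (γ : SL(2, ℤ)) :
    eisTwo c a ∣[(2 : ℤ)] γ = eisTwo c (a ᵥ* γ) := by
  ext z
  have hj : denom γ z ≠ 0 := denom_ne_zero _ z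
  rw [ModularForm.SL_slash_apply, eisTwo, eisTwo, latticePoint_smul, div_right_comm, wpSum_smul,
    zpow_neg, zpow_ofNat]
  field_simp

/-- The defect of modularity of `G₂` is compensated by that of the summand `2 π i a₀ / c`. -/
theorem eisOne_slash (c : ℕ) (a : Fin 2 → ℤ) (γ : SL(2, ℤ)) :
    eisOne c a ∣[(1 : ℤ)] γ = eisOne c (a ᵥ* γ) := by
  ext z
  have hj : denom γ z ≠ 0 := denom_ne_zero _ z
  have hG := congrFun (EisensteinSeries.G2_slash_action γ) z
  rw [ModularForm.SL_slash_apply, Pi.sub_apply, EisensteinSeries.D2, zpow_neg, zpow_ofNat,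
    mul_inv_eq_iff_eq_mul₀ (pow_ne_zero 2 hj)] at hG
  rw [ModularForm.SL_slash_apply, eisOne, eisOne, latticePoint_smul, div_right_comm, zetaSum_smul,
    hG]
  have hd : denom γ z = γ 1 0 * z + γ 1 1 := by simp [denom]
  have hdet : ((γ 0 0 : ℤ) : ℂ) * γ 1 1 - γ 0 1 * γ 1 0 = 1 := by
    have := γ.det_coe
    rw [Matrix.det_fin_two] at this
    exact_mod_cast this
  have h0 : (((a ᵥ* (γ : Matrix (Fin 2) (Fin 2) ℤ)) 0 : ℤ) : ℂ) = a 0 * γ 0 0 + a 1 * γ 1 0 := by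
    simp [Matrix.vecMul, dotProduct, Fin.sum_univ_two]
  have h1 : (((a ᵥ* (γ : Matrix (Fin 2) (Fin 2) ℤ)) 1 : ℤ) : ℂ) = a 0 * γ 0 1 + a 1 * γ 1 1 := by
    simp [Matrix.vecMul, dotProduct, Fin.sum_univ_two]
  have key : (γ 1 0 : ℂ) * latticePoint z (a ᵥ* (γ : Matrix (Fin 2) (Fin 2) ℤ)) + a 0 =
      denom γ z * ((a ᵥ* (γ : Matrix (Fin 2) (Fin 2) ℤ)) 0 : ℤ) := by
    rw [latticePoint, h0, h1, hd]
    linear_combination (-(a 0 : ℂ)) * hdet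
  rw [zpow_neg, zpow_one, mul_inv_eq_iff_eq_mul₀ hj]
  generalize zetaSum z _ = Z
  generalize (((a ᵥ* (γ : Matrix (Fin 2) (Fin 2) ℤ)) 0 : ℤ) : ℂ) = b at *
  generalize latticePoint z _ = w at *
  generalize denom γ z = j at *
  rw [div_eq_mul_inv w, div_eq_mul_inv _ (c : ℂ), div_eq_mul_inv _ (c : ℂ)]
  generalize (c : ℂ)⁻¹ = d
  field_simp
  linear_combination (2 * π * Complex.I * d) * key

/-! #### Row sums -/

theorem hasSum_fiber {f : (Fin 2 → ℤ) → ℂ} (hf : Summable f) :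
    HasSum (fun m : ℤ => ∑' n : ℤ, f ![m, n]) (∑' v, f v) := by
  have h1 : HasSum (f ∘ (finTwoArrowEquiv ℤ).symm) (∑' v, f v) :=
    (Equiv.hasSum_iff _).2 hf.hasSum
  have h2 : ∀ m : ℤ, HasSum (fun n => (f ∘ (finTwoArrowEquiv ℤ).symm) (m, n))
      (∑' n : ℤ, f ![m, n]) := fun m => (h1.summable.prod_factor m).hasSum
  exact h1.prod_fiberwise h2

theorem tendsto_sum_Icc_of_hasSum {f : ℤ → ℂ} {s : ℂ} (h : HasSum f s) :
    Tendsto (fun K : ℕ => ∑ n ∈ Finset.Icc (-(K : ℤ)) K, f n) atTop (𝓝 s) :=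
  SummationFilter.hasSum_symmetricIcc_iff.1 (h.mono_left SummationFilter.LeAtTop.le_atTop)

theorem summable_row {f : (Fin 2 → ℤ) → ℂ} (hf : Summable f) (m : ℤ) :
    Summable fun n : ℤ => f ![m, n] := by
  have h1 : Summable (f ∘ (finTwoArrowEquiv ℤ).symm) := (Equiv.summable_iff _).2 hf
  exact h1.prod_factor m

theorem e2Summand_eq_sqInvSum (m : ℤ) (z : ℍ) : e2Summand m z = sqInvSum (m * z) := by
  rw [e2Summand, sqInvSum]
  refine tsum_congr fun n => ?_
  simp [EisensteinSeries.eisSummand, zpow_neg, zpow_ofNat]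

/-- Along the row of the points `m z + n`, the three parts of `zetaTerm` can be summed separately, if
the sums over `n` are symmetric. -/
theorem tsum_zetaTerm_row (z : ℍ) (u : ℂ) (m : ℤ) :
    ∑' n : ℤ, zetaTerm u (latticePoint z ![m, n]) =
      cotPi (u + m * z) - cotPi (m * z) + u * e2Summand m z := by
  have h1 := tendsto_sum_Icc_of_hasSum (summable_row (summable_zetaTerm z u) m).hasSum
  have h2 := ((tendsto_sum_cotPi (u + m * z)).sub (tendsto_sum_cotPi (m * z))).add
    ((tendsto_sum_Icc_of_hasSum (summable_sqInv (m * z)).hasSum).const_mul u)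
  rw [e2Summand_eq_sqInvSum]
  refine tendsto_nhds_unique h1 (h2.congr fun K => ?_)
  rw [← Finset.sum_sub_distrib, Finset.mul_sum, ← Finset.sum_add_distrib]
  refine Finset.sum_congr rfl fun n _ => ?_
  simp [zetaTerm, latticePoint, add_assoc, div_eq_mul_inv]

theorem tsum_wpTerm_row (z : ℍ) (u : ℂ) (m : ℤ) :
    ∑' n : ℤ, wpTerm u (latticePoint z ![m, n]) = sqInvSum (u + m * z) - e2Summand m z := by
  rw [e2Summand_eq_sqInvSum, sqInvSum, sqInvSum,
    ← (summable_sqInv _).tsum_sub (summable_sqInv _)]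
  refine tsum_congr fun n => ?_
  simp [wpTerm, latticePoint, add_assoc]

theorem tendsto_sum_e2Summand (z : ℍ) :
    Tendsto (fun M : ℕ => ∑ m ∈ Finset.Icc (-(M : ℤ)) M, e2Summand m z) atTop (𝓝 (G2 z)) :=
  SummationFilter.hasSum_symmetricIcc_iff.1 (EisensteinSeries.summable_e2Summand_symmetricIcc z).hasSum

/-- Symmetric summation of `1 / (u + w)` alone, along each row and then over the rows. It gives a
value that differs from the absolutely convergent sum by a multiple of `G₂`. -/
theorem tendsto_sum_cotPi_rows (z : ℍ) (u : ℂ) :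
    Tendsto (fun M : ℕ => ∑ m ∈ Finset.Icc (-(M : ℤ)) M, cotPi (u + m * z)) atTop
      (𝓝 (zetaSum z u - u * G2 z)) := by
  have h1 := tendsto_sum_Icc_of_hasSum (hasSum_fiber (summable_zetaTerm z u))
  have h2 := h1.sub ((tendsto_sum_e2Summand z).const_mul u)
  refine h2.congr fun M => ?_
  simp only [tsum_zetaTerm_row, Finset.sum_add_distrib, Finset.sum_sub_distrib, Finset.mul_sum]
  have h3 : ∑ m ∈ Finset.Icc (-(M : ℤ)) M, cotPi (m * z) = 0 := by
    have := sum_Icc_int_neg (fun m : ℤ => cotPi (m * z)) M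
    simp only [Int.cast_neg, neg_mul, cotPi_neg, Finset.sum_neg_distrib] at this
    exact self_eq_neg.1 this.symm
  rw [h3]; ring

/-- Symmetric summation of `1 / (u + w) ^ 2` alone, along each row and then over the rows. -/
theorem tendsto_sum_sqInvSum_rows (z : ℍ) (u : ℂ) :
    Tendsto (fun M : ℕ => ∑ m ∈ Finset.Icc (-(M : ℤ)) M, sqInvSum (u + m * z)) atTop
      (𝓝 (wpSum z u + G2 z)) := by
  have h1 := tendsto_sum_Icc_of_hasSum (hasSum_fiber (summable_wpTerm z u))
  refine (h1.add (tendsto_sum_e2Summand z)).congr fun M => ?_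
  simp only [tsum_wpTerm_row, Finset.sum_sub_distrib]
  ring

end Lattice

/-! ### Boundedness at infinity and dependence on the division point -/

section Boundedness

open Filter Topology
open scoped Real Matrix
open EisensteinSeries (G2)

theorem hasSum_pnat_iff {f : ℕ → ℂ} {s : ℂ} :
    HasSum (fun n : ℕ+ => f n) s ↔ HasSum (fun n : ℕ => f (n + 1)) s := by
  rw [← Equiv.pnatEquivNat.symm.hasSum_iff]
  simp [Function.comp_def]

theorem norm_exp_two_pi_I_mul (w : ℂ) :
    ‖Complex.exp (2 * π * Complex.I * w)‖ = Real.exp (-(2 * π * w.im)) := by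
  rw [Complex.norm_exp]; simp

theorem norm_exp_two_pi_I_mul_lt_one {w : ℂ} (hw : 0 < w.im) :
    ‖Complex.exp (2 * π * Complex.I * w)‖ < 1 := by
  rw [norm_exp_two_pi_I_mul, Real.exp_lt_one_iff]
  have := Real.pi_pos
  rw [neg_lt_zero]; positivity

/-- In the upper half plane, the difference of `π cot (π w)` and `-π i` decays exponentially with
the imaginary part of `w`. -/
theorem cotPi_add_pi_I {w : ℂ} (hw : 0 < w.im) :
    cotPi w + π * Complex.I = -2 * π * Complex.I * Complex.exp (2 * π * Complex.I * w) *
      (1 - Complex.exp (2 * π * Complex.I * w))⁻¹ := by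
  have hq := norm_exp_two_pi_I_mul_lt_one hw
  have h1 := pi_mul_cot_pi_q_exp ⟨w, hw⟩
  simp only [] at h1
  rw [tsum_geometric_of_norm_lt_one hq] at h1
  have h2 : (1 - Complex.exp (2 * π * Complex.I * w)) ≠ 0 := by
    intro h
    rw [← sub_eq_zero.1 h] at hq
    simp at hq
  rw [cotPi, h1]
  linear_combination (-2 * π * Complex.I) * mul_inv_cancel₀ h2

theorem sqInvSum_eq {w : ℂ} (hw : 0 < w.im) :
    sqInvSum w = -4 * π ^ 2 * (Complex.exp (2 * π * Complex.I * w) /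
      (1 - Complex.exp (2 * π * Complex.I * w)) ^ 2) := by
  have hq := norm_exp_two_pi_I_mul_lt_one hw
  have h1 := EisensteinSeries.qExpansion_identity le_rfl ⟨w, hw⟩
  simp only [pow_one, one_add_one_eq_two] at h1
  rw [tsum_coe_mul_geometric_of_norm_lt_one hq] at h1
  rw [sqInvSum, h1, Nat.factorial_one, mul_pow, Complex.I_sq]
  push_cast; ring

theorem hasSum_cotPi {w : ℂ} (hw : 0 < w.im) :
    HasSum (fun n : ℕ+ => -2 * π * Complex.I * Complex.exp (2 * π * Complex.I * w) ^ (n : ℕ))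
      (cotPi w + π * Complex.I) := by
  rw [hasSum_pnat_iff (f := fun n => -2 * π * Complex.I * Complex.exp (2 * π * Complex.I * w) ^ n),
    cotPi_add_pi_I hw]
  refine ((hasSum_geometric_of_norm_lt_one (norm_exp_two_pi_I_mul_lt_one hw)).mul_left
    (-2 * π * Complex.I * Complex.exp (2 * π * Complex.I * w))).congr_fun ?_
  intro n
  rw [pow_succ]; ring

theorem hasSum_sqInvSum {w : ℂ} (hw : 0 < w.im) :
    HasSum (fun n : ℕ+ => -4 * π ^ 2 * (n * Complex.exp (2 * π * Complex.I * w) ^ (n : ℕ)))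
      (sqInvSum w) := by
  rw [hasSum_pnat_iff (f := fun n => -4 * π ^ 2 *
    (n * Complex.exp (2 * π * Complex.I * w) ^ (n : ℕ))), sqInvSum_eq hw]
  have := (hasSum_coe_mul_geometric_of_norm_lt_one (norm_exp_two_pi_I_mul_lt_one hw)).mul_left
    (-4 * (π : ℂ) ^ 2)
  have h2 := (hasSum_nat_add_iff' 1).2 this
  simpa using h2

theorem norm_inv_one_sub_le {δ : ℝ} (hδ : 0 < δ) {w : ℂ} (hw : δ ≤ w.im) :
    ‖(1 - Complex.exp (2 * π * Complex.I * w))⁻¹‖ ≤ (1 - Real.exp (-(2 * π * δ)))⁻¹ := by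
  have hpi := Real.pi_pos
  have h1 : Real.exp (-(2 * π * δ)) < 1 := by
    rw [Real.exp_lt_one_iff, neg_lt_zero]; positivity
  have h2 : ‖Complex.exp (2 * π * Complex.I * w)‖ ≤ Real.exp (-(2 * π * δ)) := by
    rw [norm_exp_two_pi_I_mul, Real.exp_le_exp]
    gcongr
  have h3 := norm_sub_norm_le (1 : ℂ) (Complex.exp (2 * π * Complex.I * w))
  rw [norm_one] at h3
  rw [norm_inv]
  exact inv_anti₀ (by linarith) (by linarith)

/-- The function `f` is bounded away from the real axis, and `f w₁ + f w₂` decays exponentially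
for `w₁` in the upper and `w₂` in the lower half plane. -/
def DecaysInPairs (f : ℂ → ℂ) : Prop :=
  ∀ δ > 0, ∃ K : ℝ, 0 ≤ K ∧ (∀ w : ℂ, δ ≤ w.im → ‖f w‖ ≤ K) ∧
    ∀ w₁ w₂ : ℂ, δ ≤ w₁.im → w₂.im ≤ -δ →
      ‖f w₁ + f w₂‖ ≤ K * (Real.exp (-(2 * π * w₁.im)) + Real.exp (-(2 * π * -w₂.im)))

theorem decaysInPairs_cotPi : DecaysInPairs cotPi := by
  intro δ hδ
  set A := (1 - Real.exp (-(2 * π * δ)))⁻¹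
  have hpi := Real.pi_pos
  have hA : 0 ≤ A := by
    refine inv_nonneg.2 (sub_nonneg.2 (Real.exp_le_one_iff.2 ?_))
    rw [neg_nonpos]; positivity
  have h1 : ∀ w : ℂ, δ ≤ w.im →
      ‖cotPi w + π * Complex.I‖ ≤ 2 * π * A * Real.exp (-(2 * π * w.im)) := by
    intro w hw
    rw [cotPi_add_pi_I (hδ.trans_le hw), norm_mul, norm_mul, norm_exp_two_pi_I_mul]
    have : ‖-2 * (π : ℂ) * Complex.I‖ = 2 * π := by
      simp [abs_of_pos hpi]
    rw [this, mul_right_comm]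
    gcongr
    exact norm_inv_one_sub_le hδ hw
  refine ⟨2 * π * A + π, by positivity, fun w hw => ?_, fun w₁ w₂ hw₁ hw₂ => ?_⟩
  · have h2 := norm_sub_le (cotPi w + π * Complex.I) (π * Complex.I)
    rw [add_sub_cancel_right] at h2
    have h3 : ‖(π : ℂ) * Complex.I‖ = π := by simp [abs_of_pos hpi]
    have h4 : Real.exp (-(2 * π * w.im)) ≤ 1 := by
      rw [Real.exp_le_one_iff, neg_nonpos]
      have := hδ.trans_le hw
      positivity
    have h5 : 2 * π * A * Real.exp (-(2 * π * w.im)) ≤ 2 * π * A * 1 := by gcongr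
    linarith [h1 w hw]
  · have h2 := h1 (-w₂) (by rw [Complex.neg_im]; linarith)
    have e : cotPi w₁ + cotPi w₂ =
        (cotPi w₁ + π * Complex.I) - (cotPi (-w₂) + π * Complex.I) := by
      rw [cotPi_neg]; ring
    rw [e]
    refine (norm_sub_le _ _).trans ((add_le_add (h1 w₁ hw₁) h2).trans ?_)
    rw [← mul_add, Complex.neg_im]
    gcongr
    linarith

theorem norm_sqInvSum_le {δ : ℝ} (hδ : 0 < δ) {w : ℂ} (hw : δ ≤ w.im) :
    ‖sqInvSum w‖ ≤ 4 * π ^ 2 * (1 - Real.exp (-(2 * π * δ)))⁻¹ ^ 2 *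
      Real.exp (-(2 * π * w.im)) := by
  rw [sqInvSum_eq (hδ.trans_le hw), div_eq_inv_mul, ← mul_assoc, norm_mul, norm_mul, ← inv_pow,
    norm_pow _ 2, norm_exp_two_pi_I_mul]
  have : ‖-4 * (π : ℂ) ^ 2‖ = 4 * π ^ 2 := by simp
  rw [this]
  gcongr
  exact norm_inv_one_sub_le hδ hw

theorem decaysInPairs_sqInvSum : DecaysInPairs sqInvSum := by
  intro δ hδ
  refine ⟨4 * π ^ 2 * (1 - Real.exp (-(2 * π * δ)))⁻¹ ^ 2, by positivity, fun w hw => ?_,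
    fun w₁ w₂ hw₁ hw₂ => ?_⟩
  · refine (norm_sqInvSum_le hδ hw).trans (mul_le_of_le_one_right (by positivity) ?_)
    rw [Real.exp_le_one_iff, neg_nonpos]
    have := hδ.trans_le hw
    have := Real.pi_pos
    positivity
  · have h2 := norm_sqInvSum_le hδ (w := -w₂) (by rw [Complex.neg_im]; linarith)
    rw [sqInvSum_neg, Complex.neg_im] at h2
    refine (norm_add_le _ _).trans ((add_le_add (norm_sqInvSum_le hδ hw₁) h2).trans ?_)
    rw [← mul_add]

/-- The symmetric sums of `f` along the rows of the lattice are bounded, uniformly in the number of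
rows and in `z` far from the real axis. -/
theorem norm_sum_rows_le {f : ℂ → ℂ} {δ K B : ℝ} (hδ : 0 < δ) (hδ1 : δ ≤ 1) (hK : 0 ≤ K)
    (hf : ∀ w₁ w₂ : ℂ, δ ≤ w₁.im → w₂.im ≤ -δ →
      ‖f w₁ + f w₂‖ ≤ K * (Real.exp (-(2 * π * w₁.im)) + Real.exp (-(2 * π * -w₂.im))))
    {z : ℍ} (hz : 1 ≤ z.im) {u : ℂ} (hu : 0 ≤ u.im) (hu' : u.im ≤ (1 - δ) * z.im)
    (hB : ‖f u‖ ≤ B) (M : ℕ) :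
    ‖∑ m ∈ Finset.Icc (-(M : ℤ)) M, f (u + m * z)‖ ≤
      B + K * 2 * (1 - Real.exp (-(2 * π * δ)))⁻¹ := by
  have hpi := Real.pi_pos
  rw [sum_Icc_int_eq]
  refine (norm_add_le _ _).trans (add_le_add (by simpa using hB) ?_)
  have hx1 : Real.exp (-(2 * π * δ)) < 1 := by
    rw [Real.exp_lt_one_iff, neg_lt_zero]; positivity
  have hx0 := Real.exp_pos (-(2 * π * δ))
  have h1 : ∀ j ∈ Finset.range M, ‖f (u + ((j + 1 : ℤ) : ℂ) * z) + f (u + ((-(j + 1) : ℤ) : ℂ) * z)‖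
      ≤ K * 2 * Real.exp (-(2 * π * δ)) ^ j := by
    intro j _
    have hj : (0 : ℝ) ≤ j := j.cast_nonneg
    have e1 : (u + ((j + 1 : ℤ) : ℂ) * z).im = u.im + (j + 1) * z.im := by
      simp [Complex.add_im, Complex.mul_im]
    have e2 : (u + ((-(j + 1) : ℤ) : ℂ) * z).im = u.im - (j + 1) * z.im := by
      simp [Complex.add_im, Complex.mul_im]; ring
    have b1 : δ * (j + 1) ≤ u.im + (j + 1) * z.im := by
      have : (j + 1 : ℝ) * δ ≤ (j + 1) * z.im := by gcongr; linarith
      linarith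
    have b2 : δ * (j + 1) ≤ -(u.im - (j + 1) * z.im) := by
      have h3 : (j + δ) * 1 ≤ (j + δ) * z.im := by gcongr
      have h4 : δ * j ≤ 1 * j := by gcongr
      linarith
    have b3 : δ ≤ δ * (j + 1) := by nlinarith
    refine (hf _ _ (by rw [e1]; linarith) (by rw [e2]; linarith)).trans ?_
    rw [e1, e2, mul_assoc K, ← Real.exp_nat_mul]
    have g : ∀ t : ℝ, δ * (j + 1) ≤ t → Real.exp (-(2 * π * t)) ≤ Real.exp (j * -(2 * π * δ)) := by
      intro t ht
      rw [Real.exp_le_exp]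
      have : 2 * π * (δ * j) ≤ 2 * π * t := by gcongr; linarith
      linarith
    have := g _ b1
    have := g _ b2
    gcongr
    linarith
  refine (norm_sum_le _ _).trans ((Finset.sum_le_sum h1).trans ?_)
  rw [← Finset.mul_sum, ← tsum_geometric_of_lt_one hx0.le hx1]
  gcongr
  exact (summable_geometric_of_lt_one hx0.le hx1).sum_le_tsum _ fun i _ => by positivity

/-- A function of `z` that is a limit of symmetric sums along rows is bounded at infinity. -/
theorem isBoundedAtImInfty_of_rows {f : ℂ → ℂ} (hf : DecaysInPairs f) {c : ℕ} [NeZero c]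
    {a : Fin 2 → ℤ} (ha0 : 0 ≤ a 0) (hac : a 0 < c) {F : ℍ → ℂ}
    (hF : ∀ z, Tendsto (fun M : ℕ => ∑ m ∈ Finset.Icc (-(M : ℤ)) M,
      f (latticePoint z a / c + m * z)) atTop (𝓝 (F z))) :
    IsBoundedAtImInfty F := by
  have hc : (0 : ℝ) < c := Nat.cast_pos.2 (NeZero.pos c)
  have hc1 : (1 : ℝ) ≤ c := Nat.one_le_cast.2 (NeZero.pos c)
  obtain ⟨K, hK, hK1, hK2⟩ := hf (1 / c) (by positivity)
  rw [UpperHalfPlane.isBoundedAtImInfty_iff]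
  refine ⟨(‖f ((a 1 : ℂ) / c)‖ + K) + K * 2 * (1 - Real.exp (-(2 * π * (1 / c))))⁻¹, 1,
    fun z hz => ?_⟩
  have him : (latticePoint z a / c).im = a 0 / c * z.im := by
    have : (latticePoint z a / c : ℂ) = ((a 0 / c : ℝ) : ℂ) * z + ((a 1 / c : ℝ) : ℂ) := by
      rw [latticePoint]; push_cast; ring
    rw [this]; simp [Complex.add_im, Complex.mul_im, -Complex.ofReal_div]
  have ha0' : (0 : ℝ) ≤ a 0 := by exact_mod_cast ha0
  have hac' : (a 0 : ℝ) ≤ c - 1 := by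
    have : a 0 ≤ (c : ℤ) - 1 := by omega
    exact_mod_cast this
  refine le_of_tendsto (hF z).norm (Eventually.of_forall fun M =>
    norm_sum_rows_le (by positivity) ?_ hK hK2 hz ?_ ?_ ?_ M)
  · rw [div_le_one hc]; exact hc1
  · rw [him]
    have := z.im_pos
    positivity
  · rw [him]
    have := z.im_pos
    gcongr
    rw [div_le_iff₀ hc]
    field_simp
    linarith
  · rcases ha0.eq_or_lt with h | h
    · have : latticePoint z a / c = (a 1 : ℂ) / c := by simp [latticePoint, ← h]
      rw [this]; linarith
    · refine (hK1 _ ?_).trans (by linarith [norm_nonneg (f ((a 1 : ℂ) / c))])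
      rw [him, div_mul_eq_mul_div]
      have : (1 : ℝ) ≤ a 0 := by exact_mod_cast h
      gcongr
      nlinarith

theorem cotPi_add_intCast (x : ℂ) (k : ℤ) : cotPi (x + k) = cotPi x := by
  have h : Function.Periodic cotPi 1 := cotPi_add_one
  simpa using h.int_mul k x

theorem sqInvSum_add_intCast (x : ℂ) (k : ℤ) : sqInvSum (x + k) = sqInvSum x := by
  have h : Function.Periodic sqInvSum 1 := sqInvSum_add_one
  simpa using h.int_mul k x

theorem tendsto_eisOne (c : ℕ) (a : Fin 2 → ℤ) (z : ℍ) :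
    Tendsto (fun M : ℕ => ∑ m ∈ Finset.Icc (-(M : ℤ)) M, cotPi (latticePoint z a / c + m * z))
      atTop (𝓝 (eisOne c a z - 2 * π * Complex.I * a 0 / c)) := by
  rw [eisOne, add_sub_cancel_right]
  exact tendsto_sum_cotPi_rows z _

theorem tendsto_eisTwo (c : ℕ) (a : Fin 2 → ℤ) (z : ℍ) :
    Tendsto (fun M : ℕ => ∑ m ∈ Finset.Icc (-(M : ℤ)) M, sqInvSum (latticePoint z a / c + m * z))
      atTop (𝓝 (eisTwo c a z + G2 z)) :=
  tendsto_sum_sqInvSum_rows z _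

variable {c : ℕ} [NeZero c]

theorem latticePoint_add_div (z : ℍ) {a b : Fin 2 → ℤ} (h0 : a 0 = b 0) {k : ℤ}
    (h1 : a 1 = b 1 + c * k) : latticePoint z a / c = latticePoint z b / c + k := by
  have hc : (c : ℂ) ≠ 0 := NeZero.ne _
  rw [latticePoint, latticePoint, h0, h1]
  push_cast
  field_simp
  ring

/-- The rows of the lattice are invariant under integral translations. -/
theorem eisOne_congr_right {a b : Fin 2 → ℤ} (h0 : a 0 = b 0) (h1 : (c : ℤ) ∣ a 1 - b 1) :
    eisOne c a = eisOne c b := by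
  obtain ⟨k, hk⟩ := h1
  ext z
  have e := latticePoint_add_div z h0 (sub_eq_iff_eq_add'.1 hk)
  have ha := tendsto_eisOne c a z
  simp only [e, add_right_comm _ (k : ℂ), cotPi_add_intCast] at ha
  have := tendsto_nhds_unique ha (tendsto_eisOne c b z)
  rw [h0] at this
  exact sub_left_injective this

theorem eisTwo_congr_right {a b : Fin 2 → ℤ} (h0 : a 0 = b 0) (h1 : (c : ℤ) ∣ a 1 - b 1) :
    eisTwo c a = eisTwo c b := by
  obtain ⟨k, hk⟩ := h1
  ext z
  have e := latticePoint_add_div z h0 (sub_eq_iff_eq_add'.1 hk)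
  have ha := tendsto_eisTwo c a z
  simp only [e, add_right_comm _ (k : ℂ), sqInvSum_add_intCast] at ha
  exact add_left_injective _ (tendsto_nhds_unique ha (tendsto_eisTwo c b z))

theorem vecMul_S (a : Fin 2 → ℤ) :
    a = ![-a 1, a 0] ᵥ* ((ModularGroup.S : SL(2, ℤ)) : Matrix (Fin 2) (Fin 2) ℤ) := by
  ext i
  fin_cases i <;> simp [ModularGroup.S, Matrix.vecMul, dotProduct, Fin.sum_univ_two]

/-- The series `eisOne c a` depends only on the class of `a` modulo `c`. -/
theorem eisOne_congr {a b : Fin 2 → ℤ} (h0 : (c : ℤ) ∣ a 0 - b 0) (h1 : (c : ℤ) ∣ a 1 - b 1) :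
    eisOne c a = eisOne c b := by
  have e1 : eisOne c a = eisOne c ![a 0, b 1] := eisOne_congr_right (by simp) (by simpa using h1)
  -- the element `S` exchanges the two coordinates, up to a sign
  have e2 : eisOne c ![-b 1, a 0] = eisOne c ![-b 1, b 0] :=
    eisOne_congr_right (by simp) (by simpa using h0)
  have e3 := congrArg (· ∣[(1 : ℤ)] ModularGroup.S) e2
  simp only [eisOne_slash] at e3
  exact e1.trans ((congrArg (eisOne c) (vecMul_S ![a 0, b 1])).trans
    (e3.trans (congrArg (eisOne c) (vecMul_S b)).symm))

/-- The series `eisTwo c a` depends only on the class of `a` modulo `c`. -/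
theorem eisTwo_congr {a b : Fin 2 → ℤ} (h0 : (c : ℤ) ∣ a 0 - b 0) (h1 : (c : ℤ) ∣ a 1 - b 1) :
    eisTwo c a = eisTwo c b := by
  have e1 : eisTwo c a = eisTwo c ![a 0, b 1] := eisTwo_congr_right (by simp) (by simpa using h1)
  have e2 : eisTwo c ![-b 1, a 0] = eisTwo c ![-b 1, b 0] :=
    eisTwo_congr_right (by simp) (by simpa using h0)
  have e3 := congrArg (· ∣[(2 : ℤ)] ModularGroup.S) e2
  simp only [eisTwo_slash] at e3
  exact e1.trans ((congrArg (eisTwo c) (vecMul_S ![a 0, b 1])).trans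
    (e3.trans (congrArg (eisTwo c) (vecMul_S b)).symm))

theorem isBoundedAtImInfty_const (x : ℂ) : IsBoundedAtImInfty fun _ : ℍ => x :=
  Filter.const_boundedAtFilter _ x

theorem isBoundedAtImInfty_eisOne (a : Fin 2 → ℤ) : IsBoundedAtImInfty (eisOne c a) := by
  have hc : (c : ℤ) ≠ 0 := NeZero.ne _
  have e : eisOne c a = eisOne c ![a 0 % c, a 1] :=
    eisOne_congr (by simpa using Int.dvd_self_sub_emod) (by simp)
  rw [e]
  have h1 := isBoundedAtImInfty_of_rows decaysInPairs_cotPi (c := c) (a := ![a 0 % c, a 1])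
    (by simpa using Int.emod_nonneg _ hc)
    (by simpa using Int.emod_lt_of_pos _ (by exact_mod_cast NeZero.pos c))
    (fun z => tendsto_eisOne c _ z)
  have h2 := h1.add
    (isBoundedAtImInfty_const (2 * π * Complex.I * ((![a 0 % c, a 1] : Fin 2 → ℤ) 0 : ℤ) / c))
  simp only [Pi.add_def, sub_add_cancel] at h2
  exact h2

theorem isBoundedAtImInfty_G2 : IsBoundedAtImInfty G2 := by
  have h : riemannZeta 2 ≠ 0 := riemannZeta_ne_zero_of_one_lt_re (by simp)
  have e : G2 = (fun _ => 2 * riemannZeta 2) * EisensteinSeries.E2 := by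
    ext z
    simp only [EisensteinSeries.E2, Pi.mul_apply, Pi.smul_apply, smul_eq_mul]
    field_simp
  rw [e]
  exact (isBoundedAtImInfty_const _).mul EisensteinSeries.isBoundedAtImInfty_E2

theorem isBoundedAtImInfty_eisTwo (a : Fin 2 → ℤ) : IsBoundedAtImInfty (eisTwo c a) := by
  have hc : (c : ℤ) ≠ 0 := NeZero.ne _
  have e : eisTwo c a = eisTwo c ![a 0 % c, a 1] :=
    eisTwo_congr (by simpa using Int.dvd_self_sub_emod) (by simp)
  rw [e]
  have h1 := isBoundedAtImInfty_of_rows decaysInPairs_sqInvSum (c := c) (a := ![a 0 % c, a 1])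
    (by simpa using Int.emod_nonneg _ hc)
    (by simpa using Int.emod_lt_of_pos _ (by exact_mod_cast NeZero.pos c))
    (fun z => tendsto_eisTwo c _ z)
  have h2 := h1.add isBoundedAtImInfty_G2.neg
  simp only [Pi.add_def, Pi.neg_apply, add_neg_cancel_right] at h2
  exact h2

end Boundedness

/-! ### Fourier expansions of sums over division points -/

section Expansion

open Filter Topology
open Function.Periodic (qParam)
open scoped Real Matrix
open EisensteinSeries (G2)

theorem HasQExp.sum {ι : Type*} {s : Finset ι} {f : ι → ℍ → ℂ} {c : ι → ℕ → ℂ}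
    (h : ∀ i ∈ s, HasQExp (f i) (c i)) :
    HasQExp (∑ i ∈ s, f i) fun n => ∑ i ∈ s, c i n := fun τ => by
  simp only [Finset.sum_smul, Finset.sum_apply]
  exact hasSum_sum fun i hi => h i hi τ

/-- Rearrangement of a double series `∑_m ∑_n φ(m, n) q ^ (m n)`. -/
theorem hasQExp_of_rows {F : ℍ → ℂ} {x₀ C : ℂ} {φ : ℕ → ℕ → ℂ}
    (hφ : ∀ m n, ‖φ m n‖ ≤ ‖C * n‖) {R : ℕ → ℍ → ℂ}
    (hR : ∀ (τ : ℍ) (m : ℕ), 0 < m →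
      HasSum (fun n : ℕ+ => φ m n * qParam 1 (τ : ℂ) ^ (m * n : ℕ)) (R m τ))
    (hF : ∀ τ, Tendsto (fun M : ℕ => x₀ + ∑ j ∈ Finset.range M, R (j + 1) τ) atTop (𝓝 (F τ))) :
    HasQExp F fun n => if n = 0 then x₀ else ∑ d ∈ n.divisors, φ (n / d) d := by
  intro τ
  set q := qParam 1 (τ : ℂ) with hqdef
  have hq : ‖q‖ < 1 := Function.Periodic.norm_qParam_lt_one one_pos τ.im_pos
  have hsum : Summable fun p : ℕ+ × ℕ+ => φ p.1 p.2 * q ^ (p.1 * p.2 : ℕ) := by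
    refine Summable.of_norm_bounded (((summable_prod_mul_pow 1 hq).mul_left C).norm) fun p => ?_
    rw [pow_one, ← mul_assoc, norm_mul, norm_mul (C * _)]
    exact mul_le_mul_of_nonneg_right (hφ _ _) (norm_nonneg _)
  have h1 : HasSum (fun m : ℕ+ => R m τ) (∑' p : ℕ+ × ℕ+, φ p.1 p.2 * q ^ (p.1 * p.2 : ℕ)) :=
    hsum.hasSum.prod_fiberwise fun m => hR τ m m.pos
  have h2 := ((hasSum_pnat_iff (f := fun m => R m τ)).1 h1).tendsto_sum_nat.const_add x₀
  have h3 := tendsto_nhds_unique (hF τ) h2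
  have h4 := (sigmaAntidiagonalEquivProd.hasSum_iff.2 hsum.hasSum).sigma fun n : ℕ+ =>
    hasSum_fintype (α := ℂ) _
  have h5 : ∀ n : ℕ+, ∑ x : (n : ℕ).divisorsAntidiagonal,
      ((fun p : ℕ+ × ℕ+ => φ p.1 p.2 * q ^ (p.1 * p.2 : ℕ)) ∘ sigmaAntidiagonalEquivProd) ⟨n, x⟩ =
      (∑ d ∈ (n : ℕ).divisors, φ (n / d) d) * q ^ (n : ℕ) := by
    intro n
    have e := Nat.sum_divisorsAntidiagonal' (n := (n : ℕ)) φ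
    rw [← e, Finset.sum_mul]
    refine Eq.trans (Finset.sum_congr rfl fun x _ => ?_)
      (Finset.sum_coe_sort _ fun x : ℕ × ℕ => φ x.1 x.2 * q ^ (n : ℕ))
    have hx : x.1.1 * x.1.2 = n := (Nat.mem_divisorsAntidiagonal.1 x.2).1
    exact congrArg (fun k => φ x.1.1 x.1.2 * q ^ k) hx
  simp only [h5] at h4
  rw [hasSum_pnat_iff (f := fun n => (∑ d ∈ n.divisors, φ (n / d) d) * q ^ n)] at h4
  rw [h3, ← hasSum_nat_add_iff' 1]
  simpa using h4

variable {c : ℕ} [NeZero c]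

theorem exp_mul_add_pow (τ : ℍ) (m n : ℕ) (a : ℤ) :
    Complex.exp (2 * π * Complex.I * (m * τ + a / c)) ^ n =
      ZMod.stdAddChar ((n * a : ℤ) : ZMod c) * qParam 1 (τ : ℂ) ^ (m * n : ℕ) := by
  rw [ZMod.stdAddChar_coe, qParam, ← Complex.exp_nat_mul, ← Complex.exp_nat_mul, ← Complex.exp_add]
  congr 1
  push_cast
  ring

theorem norm_stdAddChar (x : ZMod c) : ‖ZMod.stdAddChar x‖ = 1 := by
  rw [ZMod.stdAddChar_apply, Circle.norm_coe]

/-- The Fourier expansion of the series of weight one attached to a real division point. -/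
theorem hasQExp_eisOne (a : ℤ) :
    HasQExp (eisOne c ![0, a]) fun n => if n = 0 then cotPi (a / c) else
      ∑ d ∈ n.divisors, -2 * π * Complex.I *
        (ZMod.stdAddChar ((d * a : ℤ) : ZMod c) - ZMod.stdAddChar ((d * -a : ℤ) : ZMod c)) := by
  refine hasQExp_of_rows (C := 4 * π) (φ := fun _ d => -2 * π * Complex.I *
        (ZMod.stdAddChar ((d * a : ℤ) : ZMod c) - ZMod.stdAddChar ((d * -a : ℤ) : ZMod c)))
    (R := fun m τ => cotPi (a / c + m * τ) + cotPi (a / c - m * τ)) (fun m n => ?_)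
    (fun τ m hm => ?_) fun τ => ?_
  · rcases n.eq_zero_or_pos with rfl | hn
    · simp
    rw [norm_mul, norm_mul (4 * (π : ℂ))]
    have h1 : ‖-2 * (π : ℂ) * Complex.I‖ = 2 * π := by simp [abs_of_pos Real.pi_pos]
    have h2 : ‖4 * (π : ℂ)‖ = 4 * π := by simp [abs_of_pos Real.pi_pos]
    have h3 := norm_sub_le (ZMod.stdAddChar ((n * a : ℤ) : ZMod c))
      (ZMod.stdAddChar ((n * -a : ℤ) : ZMod c))
    rw [norm_stdAddChar, norm_stdAddChar] at h3
    have h4 : (1 : ℝ) ≤ n := by exact_mod_cast hn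
    rw [h1, h2, Complex.norm_natCast]
    have := Real.pi_pos
    calc 2 * π * _ ≤ 2 * π * (1 + 1) := by gcongr
      _ = 4 * π * 1 := by ring
      _ ≤ _ := by gcongr
  · have him : 0 < ((m : ℂ) * τ).im := by
      simpa using mul_pos (Nat.cast_pos.2 hm) τ.im_pos
    have hre : ∀ b : ℤ, ((b : ℂ) / c).im = 0 := fun b => by
      have : ((b : ℂ) / c) = ((b / c : ℝ) : ℂ) := by push_cast; rfl
      rw [this, Complex.ofReal_im]
    have h1 := hasSum_cotPi (w := m * τ + a / c) (by rw [Complex.add_im, hre]; simpa using him)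
    have h2 := hasSum_cotPi (w := m * τ + (-a : ℤ) / c)
      (by rw [Complex.add_im, hre]; simpa using him)
    have h3 := h1.sub h2
    simp only [exp_mul_add_pow] at h3
    have e : (m * τ + (-a : ℤ) / c : ℂ) = -(a / c - m * τ) := by push_cast; ring
    rw [e, cotPi_neg, add_sub_add_right_eq_sub, sub_neg_eq_add, add_comm (m * τ : ℂ)] at h3
    refine h3.congr_fun fun n => ?_
    push_cast
    ring
  · have h := tendsto_eisOne c ![0, a] τ
    simp only [Matrix.cons_val_zero, Int.cast_zero, mul_zero, zero_div, sub_zero] at h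
    refine h.congr fun M => ?_
    rw [sum_Icc_int_eq]
    simp only [latticePoint, Matrix.cons_val_zero, Matrix.cons_val_one, Int.cast_zero, zero_mul,
      zero_add, add_zero]
    refine congrArg _ (Finset.sum_congr rfl fun j _ => ?_)
    push_cast
    congr 2
    ring

/-- The Fourier expansion of the series of weight two attached to a real division point, up to the
series `G₂`. -/
theorem hasQExp_eisTwo (a : ℤ) :
    HasQExp (eisTwo c ![0, a] + G2) fun n => if n = 0 then sqInvSum (a / c) else
      ∑ d ∈ n.divisors, -4 * π ^ 2 * d *
        (ZMod.stdAddChar ((d * a : ℤ) : ZMod c) + ZMod.stdAddChar ((d * -a : ℤ) : ZMod c)) := by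
  refine hasQExp_of_rows (C := 8 * π ^ 2) (φ := fun _ d => -4 * π ^ 2 * d *
        (ZMod.stdAddChar ((d * a : ℤ) : ZMod c) + ZMod.stdAddChar ((d * -a : ℤ) : ZMod c)))
    (R := fun m τ => sqInvSum (a / c + m * τ) + sqInvSum (a / c - m * τ)) (fun m n => ?_)
    (fun τ m hm => ?_) fun τ => ?_
  · rw [norm_mul, norm_mul]
    have h1 : ‖-4 * (π : ℂ) ^ 2‖ = 4 * π ^ 2 := by simp
    have h2 : ‖8 * (π : ℂ) ^ 2 * n‖ = 8 * π ^ 2 * n := by simp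
    have h3 := norm_add_le (ZMod.stdAddChar ((n * a : ℤ) : ZMod c))
      (ZMod.stdAddChar ((n * -a : ℤ) : ZMod c))
    rw [norm_stdAddChar, norm_stdAddChar] at h3
    rw [h1, h2, Complex.norm_natCast]
    calc 4 * π ^ 2 * n * _ ≤ 4 * π ^ 2 * n * (1 + 1) := by gcongr
      _ = _ := by ring
  · have him : 0 < ((m : ℂ) * τ).im := by
      simpa using mul_pos (Nat.cast_pos.2 hm) τ.im_pos
    have hre : ∀ b : ℤ, ((b : ℂ) / c).im = 0 := fun b => by
      have : ((b : ℂ) / c) = ((b / c : ℝ) : ℂ) := by push_cast; rfl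
      rw [this, Complex.ofReal_im]
    have h1 := hasSum_sqInvSum (w := m * τ + a / c) (by rw [Complex.add_im, hre]; simpa using him)
    have h2 := hasSum_sqInvSum (w := m * τ + (-a : ℤ) / c)
      (by rw [Complex.add_im, hre]; simpa using him)
    have h3 := h1.add h2
    simp only [exp_mul_add_pow] at h3
    have e : (m * τ + (-a : ℤ) / c : ℂ) = -(a / c - m * τ) := by push_cast; ring
    rw [e, sqInvSum_neg, add_comm (m * τ : ℂ)] at h3
    refine h3.congr_fun fun n => ?_
    push_cast
    ring
  · have h := tendsto_eisTwo c ![0, a] τ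
    refine h.congr fun M => ?_
    rw [sum_Icc_int_eq]
    simp only [latticePoint, Matrix.cons_val_zero, Matrix.cons_val_one, Int.cast_zero, zero_mul,
      zero_add, add_zero]
    refine congrArg _ (Finset.sum_congr rfl fun j _ => ?_)
    push_cast
    congr 2
    ring

theorem sum_zmod_val {M : Type*} [AddCommMonoid M] (f : ℕ → M) :
    ∑ a : ZMod c, f a.val = ∑ i ∈ Finset.range c, f i := by
  refine Finset.sum_bij' (fun a _ => a.val) (fun i _ => (i : ZMod c)) ?_ ?_ ?_ ?_ ?_
  · intro a _; simpa using a.val_lt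
  · simp
  · intro a _; simp
  · intro i hi; exact ZMod.val_cast_of_lt (Finset.mem_range.1 hi)
  · simp

/-- The distribution relation of the series `∑ (x + n)⁻²`. -/
theorem sum_sqInvSum_div (x : ℂ) :
    ∑ s ∈ Finset.range c, sqInvSum ((x + s) / c) = c ^ 2 * sqInvSum x := by
  have hc : (c : ℂ) ≠ 0 := NeZero.ne _
  have h1 := (Int.divModEquiv c).symm.hasSum_iff.2 (summable_sqInv x).hasSum
  have h2 := (Equiv.prodComm (Fin c) ℤ).hasSum_iff.2 h1
  have h3 := h2.prod_fiberwise (g := fun s : Fin c => ((c : ℂ) ^ 2)⁻¹ * sqInvSum ((x + s) / c))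
    fun s => by
      refine ((summable_sqInv ((x + s) / c)).hasSum.mul_left ((c : ℂ) ^ 2)⁻¹).congr_fun fun m => ?_
      simp only [Function.comp_apply, Equiv.prodComm_apply, Prod.swap_prod_mk,
        Int.divModEquiv_symm_apply]
      rw [one_div, one_div, ← mul_inv, ← mul_pow]
      congr 2
      push_cast
      field_simp
      ring
  have h4 := (hasSum_fintype _).unique h3
  rw [← Finset.mul_sum, inv_mul_eq_iff_eq_mul₀ (pow_ne_zero 2 hc)] at h4
  rw [sqInvSum, ← h4, Finset.sum_range]

theorem summable_mul_sqInvSum {χ : ℤ → ℂ} (hχ : ∀ k, ‖χ k‖ ≤ 1) (z : ℍ) :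
    Summable fun k : ℤ => χ k * sqInvSum (k * z) := by
  have key : ∀ χ : ℕ → ℂ, (∀ k, ‖χ k‖ ≤ 1) → Summable fun k : ℕ => χ k * sqInvSum (k * z) := by
    intro χ hχ
    rw [← summable_nat_add_iff 1]
    have hz := z.im_pos
    have hpi := Real.pi_pos
    have hx : Real.exp (-(2 * π * z.im)) < 1 := by
      rw [Real.exp_lt_one_iff, neg_lt_zero]; positivity
    refine Summable.of_norm_bounded
      ((summable_geometric_of_lt_one (Real.exp_pos _).le hx).mul_left
        (4 * π ^ 2 * (1 - Real.exp (-(2 * π * z.im)))⁻¹ ^ 2)) fun k => ?_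
    have him : (((k + 1 : ℕ) : ℂ) * z).im = (k + 1) * z.im := by
      simp [Complex.mul_im]
    have h1 := norm_sqInvSum_le (δ := z.im) hz (w := ((k + 1 : ℕ) : ℂ) * z)
      (by rw [him]; nlinarith [(Nat.cast_nonneg k : (0 : ℝ) ≤ k)])
    rw [norm_mul]
    refine (mul_le_of_le_one_left (norm_nonneg _) (hχ _)).trans (h1.trans ?_)
    rw [← Real.exp_nat_mul, him]
    gcongr
    nlinarith [mul_pos hpi hz]
  refine Summable.of_nat_of_neg ?_ ?_
  · simpa using key (fun k => χ k) fun k => hχ _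
  · simpa [sqInvSum_neg] using key (fun k => χ (-k)) fun k => hχ _

/-- The Fourier expansion of the sum over all division points `(r z + s) / c`, weighted by an even
non-trivial character evaluated at `r`. -/
theorem hasQExp_sum_eisTwo {χ : DirichletCharacter ℂ c} (hχ : χ.Even) (hχ1 : χ ≠ 1) :
    HasQExp (∑ r : ZMod c, ∑ s : ZMod c, χ r • eisTwo c ![(r.val : ℤ), (s.val : ℤ)])
      fun n => ∑ d ∈ n.divisors, -8 * π ^ 2 * c ^ 2 * (χ ((n / d : ℕ) : ZMod c) * d) := by
  have hc1 : c ≠ 1 := by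
    rintro rfl
    exact hχ1 (DirichletCharacter.level_one χ)
  have hχ0 : χ 0 = 0 := by
    refine χ.map_nonunit ?_
    have : Nontrivial (ZMod c) := ZMod.nontrivial_iff.2 hc1
    exact not_isUnit_zero
  have hnorm : ∀ k : ℤ, ‖χ (k : ZMod c)‖ ≤ 1 := fun k => χ.norm_le_one _
  have hlim : ∀ z : ℍ, HasSum (fun k : ℤ => χ (k : ZMod c) * sqInvSum (k * z))
      (((c : ℂ) ^ 2)⁻¹ *
        (∑ r : ZMod c, ∑ s : ZMod c, χ r • eisTwo c ![(r.val : ℤ), (s.val : ℤ)]) z) := by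
    intro z
    have hc : (c : ℂ) ≠ 0 := NeZero.ne _
    have h0 := summable_mul_sqInvSum hnorm z
    have h1 := (Int.divModEquiv c).symm.hasSum_iff.2 h0.hasSum
    have h2 := h1.prod_fiberwise fun m : ℤ => hasSum_fintype (α := ℂ) _
    have h3 := tendsto_sum_Icc_of_hasSum h2
    -- the same sum, from the series at the division points
    have h4 : Tendsto (fun M : ℕ => ∑ r : ZMod c, ∑ s : ZMod c, χ r *
        ∑ m ∈ Finset.Icc (-(M : ℤ)) M,
          sqInvSum (latticePoint z ![(r.val : ℤ), (s.val : ℤ)] / c + m * z)) atTop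
        (𝓝 (∑ r : ZMod c, ∑ s : ZMod c, χ r *
          (eisTwo c ![(r.val : ℤ), (s.val : ℤ)] z + G2 z))) :=
      tendsto_finsetSum _ fun r _ => tendsto_finsetSum _ fun s _ =>
        (tendsto_eisTwo c _ z).const_mul _
    have h5 : ∑ r : ZMod c, ∑ s : ZMod c, χ r *
          (eisTwo c ![(r.val : ℤ), (s.val : ℤ)] z + G2 z) =
        (∑ r : ZMod c, ∑ s : ZMod c, χ r • eisTwo c ![(r.val : ℤ), (s.val : ℤ)]) z := by
      have hs : ∑ r : ZMod c, χ r = 0 := MulChar.sum_eq_zero_of_ne_one hχ1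
      simp only [mul_add, Finset.sum_add_distrib, Finset.sum_const, Finset.card_univ, ZMod.card,
        nsmul_eq_mul, Finset.sum_apply, Pi.smul_apply, smul_eq_mul]
      rw [← Finset.mul_sum, ← Finset.sum_mul, hs]
      simp
    have h6 : ∀ M : ℕ, ∑ r : ZMod c, ∑ s : ZMod c, χ r *
        ∑ m ∈ Finset.Icc (-(M : ℤ)) M,
          sqInvSum (latticePoint z ![(r.val : ℤ), (s.val : ℤ)] / c + m * z) =
        c ^ 2 * ∑ m ∈ Finset.Icc (-(M : ℤ)) M, ∑ r : Fin c,
          ((fun k : ℤ => χ (k : ZMod c) * sqInvSum (k * z)) ∘ (Int.divModEquiv c).symm) (m, r) := by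
      intro M
      have e1 : ∀ m : ℤ, ∑ r : Fin c,
          ((fun k : ℤ => χ (k : ZMod c) * sqInvSum (k * z)) ∘ (Int.divModEquiv c).symm) (m, r) =
          ∑ r : ZMod c, χ r * sqInvSum ((r.val + c * m) * z) := by
        intro m
        have := sum_zmod_val (c := c) fun r : ℕ => χ (r : ZMod c) * sqInvSum ((r + c * m) * z)
        simp only [ZMod.natCast_val, ZMod.cast_id', id_eq] at this
        rw [Finset.sum_range] at this
        simp only [ZMod.natCast_val]
        rw [this]
        refine Finset.sum_congr rfl fun r _ => ?_
        simp [Int.divModEquiv_symm_apply, add_comm, mul_comm]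
      simp only [e1]
      rw [Finset.sum_comm (s := Finset.Icc (-(M : ℤ)) M), Finset.mul_sum]
      refine Finset.sum_congr rfl fun r _ => ?_
      rw [← Finset.mul_sum, Finset.sum_comm, ← Finset.mul_sum, mul_left_comm,
        Finset.mul_sum (a := (c : ℂ) ^ 2)]
      refine congrArg _ ?_
      refine Finset.sum_congr rfl fun m _ => ?_
      rw [← sum_sqInvSum_div, ← sum_zmod_val fun s : ℕ => sqInvSum (((r.val + c * m) * z + s) / c)]
      refine Finset.sum_congr rfl fun s _ => ?_
      congr 1
      simp only [latticePoint, Matrix.cons_val_zero, Matrix.cons_val_one]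
      push_cast
      field_simp
      ring
    simp only [h6, h5] at h4
    have h7 := tendsto_nhds_unique (h3.const_mul ((c : ℂ) ^ 2)) h4
    rw [← h7, inv_mul_cancel_left₀ (pow_ne_zero 2 hc)]
    exact h0.hasSum
  have h := hasQExp_of_rows
    (F := ∑ r : ZMod c, ∑ s : ZMod c, χ r • eisTwo c ![(r.val : ℤ), (s.val : ℤ)]) (x₀ := 0)
    (C := 8 * π ^ 2 * c ^ 2)
    (φ := fun m d => -8 * π ^ 2 * c ^ 2 * (χ (m : ZMod c) * d))
    (R := fun m τ => 2 * c ^ 2 * (χ (m : ZMod c) * sqInvSum (m * τ))) (fun m n => ?_)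
    (fun τ m hm => ?_) fun τ => ?_
  · refine h.congr fun n => ?_
    rcases eq_or_ne n 0 with rfl | hn
    · simp
    · rw [if_neg hn]
  · have := χ.norm_le_one (m : ZMod c)
    simp only [norm_mul, norm_neg]
    rw [mul_assoc, mul_assoc, mul_assoc, mul_assoc]
    gcongr
    exact mul_le_of_le_one_left (norm_nonneg _) this
  · have him : 0 < ((m : ℂ) * τ).im := by
      simpa using mul_pos (Nat.cast_pos.2 hm) τ.im_pos
    have h1 := (hasSum_sqInvSum him).mul_left (2 * c ^ 2 * χ (m : ZMod c))
    rw [mul_assoc (2 * (c : ℂ) ^ 2)] at h1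
    refine h1.congr_fun fun n => ?_
    have := exp_mul_add_pow (c := c) τ m n 0
    simp only [Int.cast_zero, zero_div, add_zero, mul_zero, AddChar.map_zero_eq_one, one_mul]
      at this
    rw [this]
    ring
  · have h1 := (tendsto_sum_Icc_of_hasSum (hlim τ)).const_mul ((c : ℂ) ^ 2)
    have hc : (c : ℂ) ≠ 0 := NeZero.ne _
    rw [mul_inv_cancel_left₀ (pow_ne_zero 2 hc)] at h1
    refine h1.congr fun M => ?_
    rw [sum_Icc_int_eq, mul_add, Finset.mul_sum]
    congr 1
    · simp [hχ0]
    · refine Finset.sum_congr rfl fun j _ => ?_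
      have e0 := DirichletCharacter.Even.eval_neg χ ((j + 1 : ℕ) : ZMod c) hχ
      have e1 : ((-(j + 1) : ℤ) : ZMod c) = -((j + 1 : ℕ) : ZMod c) := by push_cast; ring
      have e2 : ((-(j + 1) : ℤ) : ℂ) * τ = -(((j + 1 : ℕ) : ℂ) * τ) := by push_cast; ring
      rw [e1, e0, e2, sqInvSum_neg]
      push_cast
      ring

end Expansion

/-! ### Generalised Bernoulli numbers and constant terms -/

section Bernoulli

variable {c : ℕ}

theorem sum_Icc_eq_sum_range {χ : DirichletCharacter ℂ c} (hc : c ≠ 1) (f : ℕ → ℂ) :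
    ∑ n ∈ Finset.Icc 1 c, χ (n : ZMod c) * f n = ∑ n ∈ Finset.range c, χ (n : ZMod c) * f n := by
  have hn : Nontrivial (ZMod c) := ZMod.nontrivial_iff.2 hc
  have h0 : χ 0 = 0 := χ.map_nonunit not_isUnit_zero
  have h1 : Finset.Icc 1 c = (Finset.range (c + 1)).erase 0 := by
    ext n; simp only [Finset.mem_Icc, Finset.mem_erase, Finset.mem_range]; omega
  rw [h1, Finset.sum_erase _ (by simp [h0]), Finset.sum_range_succ]
  simp [h0]

theorem ne_one_of_odd {χ : DirichletCharacter ℂ c} (hχ : χ.Odd) : χ ≠ 1 := by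
  rintro rfl
  have h : (1 : DirichletCharacter ℂ c) (-1) = -1 := hχ
  rw [MulChar.one_apply (isUnit_one.neg)] at h
  norm_num at h

/-- The constant term in weight two, for a non-trivial character. -/
theorem eisConst_two {χ : DirichletCharacter ℂ c} (hχ : χ ≠ 1) :
    eisConst 2 triv χ = -genBernoulli 2 (charMul triv χ) / 4 := by
  rw [eisConst, if_neg (by simp), if_neg (by simp [hχ])]
  norm_num

variable [NeZero c]

theorem charMul_triv_left (χ : DirichletCharacter ℂ c) (n : ℕ) :
    charMul triv χ (n : ZMod (1 * c)) = χ (n : ZMod c) := by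
  have : NeZero (1 * c) := ⟨by simpa using NeZero.ne c⟩
  by_cases hn : n.Coprime c
  · have hn' : n.Coprime (1 * c) := by rwa [one_mul]
    rw [charMul, MulChar.mul_apply, changeLevel_natCast _ _ hn', changeLevel_natCast _ _ hn',
      Subsingleton.elim (n : ZMod 1) 1, map_one, one_mul]
  · rw [MulChar.map_nonunit, MulChar.map_nonunit]
    · rwa [ZMod.isUnit_iff_coprime]
    · rwa [ZMod.isUnit_iff_coprime, one_mul]

theorem bernoulliSeries_mul_expSubOneDiv (ε : DirichletCharacter ℂ c) :
    bernoulliSeries ε * expSubOneDiv c =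
      ∑ n ∈ Finset.Icc 1 c, ε (n : ZMod c) • PowerSeries.rescale (n : ℂ) (PowerSeries.exp ℂ) := by
  have h2 : (expSubOneDiv c)⁻¹ * expSubOneDiv c = 1 := by
    apply PowerSeries.inv_mul_cancel
    rw [← PowerSeries.coeff_zero_eq_constantCoeff_apply]
    simp [expSubOneDiv, NeZero.ne c]
  rw [bernoulliSeries, mul_assoc, h2, mul_one]

theorem coeff_bernoulliSeries_mul (ε : DirichletCharacter ℂ c) (m : ℕ) :
    (bernoulliSeries ε * expSubOneDiv c).coeff m =
      (∑ n ∈ Finset.Icc 1 c, ε (n : ZMod c) * n ^ m) / m.factorial := by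
  rw [bernoulliSeries_mul_expSubOneDiv, map_sum, Finset.sum_div]
  refine Finset.sum_congr rfl fun n _ => ?_
  rw [map_smul, PowerSeries.coeff_rescale, PowerSeries.coeff_exp]
  simp [div_eq_mul_inv, mul_assoc]

theorem genBernoulli_one (ε : DirichletCharacter ℂ c) :
    genBernoulli 1 ε = (∑ n ∈ Finset.Icc 1 c, ε (n : ZMod c) * n) / c -
      (∑ n ∈ Finset.Icc 1 c, ε (n : ZMod c)) / 2 := by
  have hc : (c : ℂ) ≠ 0 := NeZero.ne _
  have h0 := coeff_bernoulliSeries_mul ε 0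
  have h1 := coeff_bernoulliSeries_mul ε 1
  simp only [PowerSeries.coeff_mul, expSubOneDiv, PowerSeries.coeff_mk, Finset.Nat.antidiagonal_succ,
    Finset.Nat.antidiagonal_zero, Finset.sum_cons, Finset.sum_singleton,
    Finset.map_singleton, Function.Embedding.prodMap, Function.Embedding.coeFn_mk, Prod.map] at h0 h1
  norm_num [Nat.factorial] at h0 h1
  rw [genBernoulli, ← h0]
  field_simp
  rw [← h1]
  norm_num [Nat.factorial]
  ring

theorem genBernoulli_two (ε : DirichletCharacter ℂ c) :
    genBernoulli 2 ε = (∑ n ∈ Finset.Icc 1 c, ε (n : ZMod c) * n ^ 2) / c -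
      (∑ n ∈ Finset.Icc 1 c, ε (n : ZMod c) * n) +
      c / 6 * (∑ n ∈ Finset.Icc 1 c, ε (n : ZMod c)) := by
  have hc : (c : ℂ) ≠ 0 := NeZero.ne _
  have h0 := coeff_bernoulliSeries_mul ε 0
  have h1 := coeff_bernoulliSeries_mul ε 1
  have h2 := coeff_bernoulliSeries_mul ε 2
  simp only [PowerSeries.coeff_mul, expSubOneDiv, PowerSeries.coeff_mk, Finset.Nat.antidiagonal_succ,
    Finset.Nat.antidiagonal_zero, Finset.sum_cons, Finset.sum_singleton,
    Finset.map_singleton, Function.Embedding.prodMap, Function.Embedding.coeFn_mk, Prod.map,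
    Finset.map_cons] at h0 h1 h2
  norm_num [Nat.factorial] at h0 h1 h2
  have h2' := (eq_div_iff (two_ne_zero' ℂ)).1 h2
  rw [genBernoulli, ← h0, ← h1, ← h2']
  norm_num [Nat.factorial]
  field_simp
  ring

theorem sum_range_char_eq_zero {χ : DirichletCharacter ℂ c} (hχ : χ ≠ 1) :
    ∑ n ∈ Finset.range c, χ (n : ZMod c) = 0 := by
  rw [← sum_zmod_val fun n : ℕ => χ (n : ZMod c)]
  simpa using MulChar.sum_eq_zero_of_ne_one hχ

theorem level_ne_one_of_ne_one {χ : DirichletCharacter ℂ c} (hχ : χ ≠ 1) : c ≠ 1 := by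
  rintro rfl
  exact hχ (DirichletCharacter.level_one χ)

theorem sum_Icc_char_eq_zero {χ : DirichletCharacter ℂ c} (hχ : χ ≠ 1) :
    ∑ n ∈ Finset.Icc 1 c, χ (n : ZMod c) = 0 := by
  have := sum_Icc_eq_sum_range (χ := χ) (level_ne_one_of_ne_one hχ) fun _ => 1
  simp only [mul_one] at this
  rw [this, sum_range_char_eq_zero hχ]

/-- The constant term in weight one. -/
theorem eisConst_one {χ : DirichletCharacter ℂ c} (hχ : χ ≠ 1) :
    eisConst 1 triv χ = -(∑ n ∈ Finset.range c, χ (n : ZMod c) * n) / (2 * c) := by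
  have : NeZero (1 * c) := ⟨by simpa using NeZero.ne c⟩
  have h := sum_Icc_char_eq_zero hχ
  rw [eisConst, if_neg (by simp), if_neg (by simp), genBernoulli_one]
  simp only [charMul_triv_left, one_mul]
  rw [h, sum_Icc_eq_sum_range (level_ne_one_of_ne_one hχ)]
  ring

theorem genBernoulli_two_charMul {χ : DirichletCharacter ℂ c} (hc : c ≠ 1) :
    genBernoulli 2 (charMul triv χ) = c * ∑ n ∈ Finset.range c,
      χ (n : ZMod c) * ((n / c : ℂ) ^ 2 - n / c + 6⁻¹) := by
  have : NeZero (1 * c) := ⟨by simpa using NeZero.ne c⟩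
  have hc0 : (c : ℂ) ≠ 0 := NeZero.ne _
  rw [genBernoulli_two]
  simp only [charMul_triv_left, one_mul]
  have h := sum_Icc_eq_sum_range (χ := χ) hc fun _ => 1
  simp only [mul_one] at h
  rw [h, sum_Icc_eq_sum_range hc, sum_Icc_eq_sum_range hc, Finset.mul_sum, Finset.mul_sum,
    Finset.sum_div, ← Finset.sum_sub_distrib, ← Finset.sum_add_distrib]
  refine Finset.sum_congr rfl fun n _ => ?_
  field_simp

/-- The constant term in weight two, for the trivial character modulo a prime. -/
theorem eisConst_two_one {p : ℕ} [Fact p.Prime] :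
    eisConst 2 triv (1 : DirichletCharacter ℂ p) =
      -genBernoulli 2 (charMul triv (1 : DirichletCharacter ℂ p)) / 4 := by
  have hp : (p : ℂ) ≠ 0 := NeZero.ne _
  rw [eisConst, if_neg (by simp), if_pos (by simp),
    genBernoulli_two_charMul (Fact.out : p.Prime).ne_one]
  have h1 : ∀ n ∈ Finset.range p, (1 : DirichletCharacter ℂ p) (n : ZMod p) *
      ((n / p : ℂ) ^ 2 - n / p + 6⁻¹) =
      ((n / p : ℂ) ^ 2 - n / p + 6⁻¹) - if n = 0 then 6⁻¹ else 0 := by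
    intro n hn
    split_ifs with h
    · subst h
      rw [MulChar.map_nonunit]
      · simp
      · simp
    · rw [MulChar.one_apply]
      · ring
      · rw [ZMod.isUnit_iff_coprime]
        exact ((Nat.Prime.coprime_iff_not_dvd Fact.out).2
          (Nat.not_dvd_of_pos_of_lt (Nat.pos_of_ne_zero h) (Finset.mem_range.1 hn))).symm
  rw [Finset.sum_congr rfl h1]
  have h2 : ∀ m : ℕ, ∑ n ∈ Finset.range m, ((n / p : ℂ) ^ 2 - n / p + 6⁻¹) =
      ((m : ℂ) * (m - 1) * (2 * m - 1) / 6) / p ^ 2 - ((m : ℂ) * (m - 1) / 2) / p + m / 6 := by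
    intro m
    induction m with
    | zero => simp
    | succ m ih => rw [Finset.sum_range_succ, ih]; push_cast; ring
  rw [Finset.sum_sub_distrib, h2, Finset.sum_ite_eq',
    if_pos (Finset.mem_range.2 (Fact.out : p.Prime).pos)]
  field_simp
  ring

end Bernoulli

/-! ### Modularity of the Eisenstein series -/

section Modularity

open Filter Topology
open Function.Periodic (qParam)
open scoped Real Matrix ZMod
open EisensteinSeries (G2)

theorem norm_charSigma_le {c₁ c₂ : ℕ} (ε₁ : DirichletCharacter ℂ c₁)
    (ε₂ : DirichletCharacter ℂ c₂) (r n : ℕ) : ‖charSigma r ε₁ ε₂ n‖ ≤ (n : ℝ) ^ (r + 1) := by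
  have h1 : ∀ d ∈ n.divisors,
      ‖(d : ℂ) ^ r * ε₁ ((n / d : ℕ) : ZMod c₁) * ε₂ (d : ZMod c₂)‖ ≤ (n : ℝ) ^ r := by
    intro d hd
    rw [norm_mul, norm_mul, norm_pow, Complex.norm_natCast]
    have h2 : (d : ℝ) ≤ n := by exact_mod_cast Nat.divisor_le hd
    calc (d : ℝ) ^ r * _ * _ ≤ (n : ℝ) ^ r * 1 * 1 := by
          gcongr
          · exact ε₁.norm_le_one _
          · exact ε₂.norm_le_one _
      _ = _ := by ring
  refine (norm_sum_le_of_le _ h1).trans ?_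
  rw [Finset.sum_const, nsmul_eq_mul, pow_succ']
  gcongr
  exact Nat.card_divisors_le_self n

/-- The defining Fourier expansion of an Eisenstein series. -/
theorem hasQExp_eisenstein (k : ℕ) {c₁ c₂ : ℕ} (ε₁ : DirichletCharacter ℂ c₁)
    (ε₂ : DirichletCharacter ℂ c₂) :
    HasQExp (eisenstein k ε₁ ε₂) fun n =>
      if n = 0 then eisConst k ε₁ ε₂ else charSigma (k - 1) ε₁ ε₂ n := by
  intro τ
  set q := qParam 1 (τ : ℂ) with hqdef
  have hq : ‖q‖ < 1 := Function.Periodic.norm_qParam_lt_one one_pos τ.im_pos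
  have hq' : q = Complex.exp (2 * (π : ℂ) * Complex.I * (τ : ℂ)) := by
    rw [hqdef, qParam]; simp
  have h1 : Summable fun n : ℕ => charSigma (k - 1) ε₁ ε₂ n * q ^ n := by
    refine Summable.of_norm_bounded
      (summable_norm_pow_mul_geometric_of_norm_lt_one (k - 1 + 1) hq) fun n => ?_
    rw [norm_mul, norm_mul, norm_pow (n : ℂ), Complex.norm_natCast]
    gcongr
    exact norm_charSigma_le ε₁ ε₂ _ n
  have h2 : HasSum (fun n : ℕ+ => charSigma (k - 1) ε₁ ε₂ (n : ℕ) * q ^ (n : ℕ))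
      (∑' n : ℕ+, charSigma (k - 1) ε₁ ε₂ (n : ℕ) * q ^ (n : ℕ)) :=
    (h1.comp_injective PNat.coe_injective).hasSum
  have h3 := (hasSum_pnat_iff (f := fun n => charSigma (k - 1) ε₁ ε₂ n * q ^ n)).1 h2
  have e : eisenstein k ε₁ ε₂ τ = eisConst k ε₁ ε₂ +
      ∑' n : ℕ+, charSigma (k - 1) ε₁ ε₂ (n : ℕ) * q ^ (n : ℕ) := by
    rw [eisenstein, hq']
  rw [e, ← hasSum_nat_add_iff' 1]
  simpa using h3

variable {c : ℕ}

theorem charSigma_triv_left (r : ℕ) (χ : DirichletCharacter ℂ c) (n : ℕ) :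
    charSigma r triv χ n = ∑ d ∈ n.divisors, (d : ℂ) ^ r * χ (d : ZMod c) := by
  refine Finset.sum_congr rfl fun d _ => ?_
  rw [Subsingleton.elim ((n / d : ℕ) : ZMod 1) 1, map_one, mul_one]

theorem charSigma_triv_right (r : ℕ) (χ : DirichletCharacter ℂ c) (n : ℕ) :
    charSigma r χ triv n = ∑ d ∈ n.divisors, (d : ℂ) ^ r * χ ((n / d : ℕ) : ZMod c) := by
  refine Finset.sum_congr rfl fun d _ => ?_
  rw [Subsingleton.elim (d : ZMod 1) 1, map_one, mul_one]

theorem intCast_isUnit_of_mem_Gamma0 {γ : SL(2, ℤ)} (hγ : γ ∈ CongruenceSubgroup.Gamma0 c) :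
    ((γ 0 0 : ℤ) : ZMod c) * (γ 1 1 : ℤ) = 1 := by
  have h1 := γ.det_coe
  rw [Matrix.det_fin_two] at h1
  rw [CongruenceSubgroup.Gamma0_mem] at hγ
  have h2 := congrArg (Int.cast : ℤ → ZMod c) h1
  push_cast at h2
  rwa [hγ, mul_zero, sub_zero] at h2

theorem dvd_intCast_sub {a b : ℤ} (h : (a : ZMod c) = b) : (c : ℤ) ∣ a - b := by
  rw [← ZMod.intCast_zmod_eq_zero_iff_dvd]
  push_cast
  rw [h, sub_self]

section Slash

variable [NeZero c] {k : ℤ} {E : (Fin 2 → ℤ) → ℍ → ℂ}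

theorem vecMul_apply_zero (a : Fin 2 → ℤ) (γ : SL(2, ℤ)) :
    (a ᵥ* (γ : Matrix (Fin 2) (Fin 2) ℤ)) 0 = a 0 * γ 0 0 + a 1 * γ 1 0 := by
  simp [Matrix.vecMul, dotProduct, Fin.sum_univ_two]

theorem vecMul_apply_one (a : Fin 2 → ℤ) (γ : SL(2, ℤ)) :
    (a ᵥ* (γ : Matrix (Fin 2) (Fin 2) ℤ)) 1 = a 0 * γ 0 1 + a 1 * γ 1 1 := by
  simp [Matrix.vecMul, dotProduct, Fin.sum_univ_two]

theorem sum_slash {ι : Type*} (s : Finset ι) (f : ι → ℍ → ℂ) (γ : SL(2, ℤ)) :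
    (∑ i ∈ s, f i) ∣[k] γ = ∑ i ∈ s, f i ∣[k] γ := by
  induction s using Finset.cons_induction with
  | empty => simp [SlashAction.zero_slash]
  | cons a s ha ih => rw [Finset.sum_cons, Finset.sum_cons, SlashAction.add_slash, ih]

/-- The sum over the real division points, weighted by the discrete Fourier transform of a
character, has that character. -/
theorem sum_dft_slash (hE : ∀ a (γ : SL(2, ℤ)), E a ∣[k] γ = E (a ᵥ* (γ : Matrix (Fin 2) (Fin 2) ℤ)))
    (hE' : ∀ {a b : Fin 2 → ℤ}, (c : ℤ) ∣ a 0 - b 0 → (c : ℤ) ∣ a 1 - b 1 → E a = E b)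
    (χ : DirichletCharacter ℂ c) {γ : SL(2, ℤ)} (hγ : γ ∈ CongruenceSubgroup.Gamma0 c) :
    (∑ a : ZMod c, 𝓕 (χ : ZMod c → ℂ) a • E ![0, (a.val : ℤ)]) ∣[k] γ =
      χ ((γ 1 1 : ℤ) : ZMod c) • ∑ a : ZMod c, 𝓕 (χ : ZMod c → ℂ) a • E ![0, (a.val : ℤ)] := by
  have hu := intCast_isUnit_of_mem_Gamma0 hγ
  set u : (ZMod c)ˣ := ⟨((γ 1 1 : ℤ) : ZMod c), ((γ 0 0 : ℤ) : ZMod c), by rw [mul_comm, hu], hu⟩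
    with hudef
  have huc : (u : ZMod c) = ((γ 1 1 : ℤ) : ZMod c) := rfl
  rw [CongruenceSubgroup.Gamma0_mem] at hγ
  rw [sum_slash, Finset.smul_sum]
  refine Fintype.sum_equiv u.mulRight _ _ fun a => ?_
  have hm : u.mulRight a = u * a := mul_comm _ _
  rw [ModularForm.SL_smul_slash, hE, smul_smul]
  have h1 : E (![0, (a.val : ℤ)] ᵥ* (γ : Matrix (Fin 2) (Fin 2) ℤ)) =
      E ![0, ((u.mulRight a).val : ℤ)] := by
    refine hE' (dvd_intCast_sub ?_) (dvd_intCast_sub ?_)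
    · rw [vecMul_apply_zero]; simp [hγ]
    · rw [vecMul_apply_one]; simp [huc]
  have h2 := ZMod.dft_comp_unitMul (χ : ZMod c → ℂ) u (u.mulRight a)
  have h3 : (fun j : ZMod c => χ (u.val * j)) = χ (u : ZMod c) • (χ : ZMod c → ℂ) := by
    ext j; simp
  rw [h3, ZMod.dft_const_smul, Pi.smul_apply, smul_eq_mul, hm,
    Units.inv_mul_cancel_left] at h2
  rw [h1, ← huc, ← h2, hm]

/-- The sum over all division points `(r z + s) / c`, weighted by a character evaluated at `r`, has
that character. -/
theorem sum_sum_slash (hE : ∀ a (γ : SL(2, ℤ)), E a ∣[k] γ = E (a ᵥ* (γ : Matrix (Fin 2) (Fin 2) ℤ)))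
    (hE' : ∀ {a b : Fin 2 → ℤ}, (c : ℤ) ∣ a 0 - b 0 → (c : ℤ) ∣ a 1 - b 1 → E a = E b)
    (χ : DirichletCharacter ℂ c) {γ : SL(2, ℤ)} (hγ : γ ∈ CongruenceSubgroup.Gamma0 c) :
    (∑ r : ZMod c, ∑ s : ZMod c, χ r • E ![(r.val : ℤ), (s.val : ℤ)]) ∣[k] γ =
      χ ((γ 1 1 : ℤ) : ZMod c) •
        ∑ r : ZMod c, ∑ s : ZMod c, χ r • E ![(r.val : ℤ), (s.val : ℤ)] := by
  have hu := intCast_isUnit_of_mem_Gamma0 hγ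
  set u : (ZMod c)ˣ := ⟨((γ 1 1 : ℤ) : ZMod c), ((γ 0 0 : ℤ) : ZMod c), by rw [mul_comm, hu], hu⟩
    with hudef
  have huc : (u : ZMod c) = ((γ 1 1 : ℤ) : ZMod c) := rfl
  have huc' : ((u⁻¹ : (ZMod c)ˣ) : ZMod c) = ((γ 0 0 : ℤ) : ZMod c) := rfl
  rw [CongruenceSubgroup.Gamma0_mem] at hγ
  rw [sum_slash, Finset.smul_sum]
  refine Fintype.sum_equiv u⁻¹.mulRight _ _ fun r => ?_
  rw [sum_slash, Finset.smul_sum]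
  refine Fintype.sum_equiv (u.mulRight.trans (Equiv.addLeft (r * ((γ 0 1 : ℤ) : ZMod c)))) _ _
    fun s => ?_
  have hm : u⁻¹.mulRight r = (u⁻¹ : (ZMod c)ˣ) * r := mul_comm _ _
  rw [ModularForm.SL_smul_slash, hE, smul_smul, ← huc, ← map_mul, hm, Units.mul_inv_cancel_left]
  congr 1
  refine hE' (dvd_intCast_sub ?_) (dvd_intCast_sub ?_)
  · rw [vecMul_apply_zero]; simp [hγ, huc', mul_comm]
  · rw [vecMul_apply_one]; simp [huc]

end Slash

variable [NeZero c]

/-- Fourier inversion on `ℤ/c`. -/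
theorem sum_stdAddChar_mul_dft (χ : DirichletCharacter ℂ c) (n : ZMod c) :
    ∑ a : ZMod c, 𝓕 (χ : ZMod c → ℂ) a * ZMod.stdAddChar (n * a) = c * χ n := by
  have hc : (c : ℂ) ≠ 0 := NeZero.ne _
  have h := congrFun (ZMod.dft.symm_apply_apply (χ : ZMod c → ℂ)) n
  rw [ZMod.invDFT_apply, smul_eq_mul, inv_mul_eq_iff_eq_mul₀ hc] at h
  rw [← h]
  refine Finset.sum_congr rfl fun a _ => ?_
  rw [smul_eq_mul, mul_comm, mul_comm n]

theorem sum_mul_pow_of_pow_eq_one {w : ℂ} {m : ℕ} (hm : w ^ m = 1) (hw : w ≠ 1) :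
    ∑ b ∈ Finset.range m, (b : ℂ) * w ^ b = m / (w - 1) := by
  have h1 : w - 1 ≠ 0 := sub_ne_zero.2 hw
  have key : ∀ j : ℕ, (∑ b ∈ Finset.range j, (b : ℂ) * w ^ b) * (w - 1) ^ 2 =
      (w - 1) * j * w ^ j - w * (w ^ j - 1) := by
    intro j
    induction j with
    | zero => simp
    | succ j ih => rw [Finset.sum_range_succ, add_mul, ih]; push_cast; ring
  have := key m
  rw [hm] at this
  rw [eq_div_iff h1]
  refine mul_right_cancel₀ h1 ?_
  linear_combination this

/-- Eisenstein's finite formula for the cotangent. -/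
theorem cotPi_div (a : ZMod c) (ha : a ≠ 0) :
    cotPi ((a.val : ℤ) / c) = π * Complex.I +
      2 * π * Complex.I / c * ∑ b ∈ Finset.range c, (b : ℂ) * ZMod.stdAddChar ((b : ZMod c) * a) := by
  have hc : (c : ℂ) ≠ 0 := NeZero.ne _
  set w := ZMod.stdAddChar a with hw
  have hw1 : w ≠ 1 := by
    intro h
    refine ha (ZMod.injective_stdAddChar ?_)
    rw [← hw, h, AddChar.map_zero_eq_one]
  have hpow : ∀ b : ℕ, ZMod.stdAddChar ((b : ZMod c) * a) = w ^ b := by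
    intro b
    rw [← nsmul_eq_mul, AddChar.map_nsmul_eq_pow]
  have hwc : w ^ c = 1 := by rw [← hpow]; simp
  simp only [hpow]
  rw [sum_mul_pow_of_pow_eq_one hwc hw1]
  have e : Complex.exp (2 * π * Complex.I * (((a.val : ℤ) : ℂ) / c)) = w := by
    have := ZMod.stdAddChar_coe (N := c) (a.val : ℤ)
    rw [hw]
    have h2 : (((a.val : ℤ) : ZMod c)) = a := by simp
    rw [h2] at this
    rw [this]
    congr 1
    ring
  rw [cotPi, Complex.cot_pi_eq_exp_ratio, e]
  have h1 : w - 1 ≠ 0 := sub_ne_zero.2 hw1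
  have h2 : 1 - w ≠ 0 := by rw [← neg_sub]; exact neg_ne_zero.2 h1
  have h3 := Complex.I_ne_zero
  field_simp
  rw [Complex.I_sq]
  ring

/-- The constant coefficient in weight one, from Eisenstein's formula and Fourier inversion. -/
theorem sum_dft_mul_cotPi {χ : DirichletCharacter ℂ c} (hχ : χ ≠ 1) :
    ∑ a : ZMod c, 𝓕 (χ : ZMod c → ℂ) a * cotPi ((a.val : ℤ) / c) =
      2 * π * Complex.I * ∑ n ∈ Finset.range c, χ (n : ZMod c) * n := by
  have hc : (c : ℂ) ≠ 0 := NeZero.ne _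
  have h0 : 𝓕 (χ : ZMod c → ℂ) 0 = 0 := by
    rw [ZMod.dft_apply_zero]; exact MulChar.sum_eq_zero_of_ne_one hχ
  have hχ0 : χ 0 = 0 := by
    have hn : Nontrivial (ZMod c) := ZMod.nontrivial_iff.2 (level_ne_one_of_ne_one hχ)
    exact χ.map_nonunit not_isUnit_zero
  have h1 : ∀ a : ZMod c, 𝓕 (χ : ZMod c → ℂ) a * cotPi ((a.val : ℤ) / c) =
      𝓕 (χ : ZMod c → ℂ) a * ZMod.stdAddChar (0 * a) * (π * Complex.I) +
      2 * π * Complex.I / c * ∑ b ∈ Finset.range c,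
        (b : ℂ) * (𝓕 (χ : ZMod c → ℂ) a * ZMod.stdAddChar ((b : ZMod c) * a)) := by
    intro a
    rcases eq_or_ne a 0 with rfl | ha
    · simp [h0]
    · rw [cotPi_div a ha, zero_mul, AddChar.map_zero_eq_one, mul_add, Finset.mul_sum,
        Finset.mul_sum, Finset.mul_sum]
      congr 1
      · ring
      · exact Finset.sum_congr rfl fun b _ => by ring
  rw [Finset.sum_congr rfl fun a _ => h1 a, Finset.sum_add_distrib, ← Finset.sum_mul,
    sum_stdAddChar_mul_dft, hχ0, ← Finset.mul_sum, Finset.sum_comm]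
  simp only [← Finset.mul_sum, sum_stdAddChar_mul_dft]
  rw [Finset.mul_sum, Finset.mul_sum, mul_zero, zero_mul, zero_add]
  refine Finset.sum_congr rfl fun b _ => ?_
  field_simp

/-- The sum of the discrete Fourier transform of an even character against `∑ (x + n)⁻²`, from the
Fourier series of the second Bernoulli polynomial. -/
theorem sum_dft_mul_sqInvSum {χ : DirichletCharacter ℂ c} (hχ : χ.Even) :
    ∑ a : ZMod c, 𝓕 (χ : ZMod c → ℂ) a * sqInvSum ((a.val : ℤ) / c) =
      2 * π ^ 2 * c ^ 2 *
        ∑ n ∈ Finset.range c, χ (n : ZMod c) * ((n / c : ℂ) ^ 2 - n / c + 6⁻¹) := by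
  have hc : (c : ℂ) ≠ 0 := NeZero.ne _
  -- the Fourier series at `n / c`
  have h1 : ∀ n ∈ Finset.range c, HasSum (fun m : ℤ => 1 / (m : ℂ) ^ 2 *
      ZMod.stdAddChar ((n : ZMod c) * (m : ZMod c))) (2 * π ^ 2 * ((n / c : ℂ) ^ 2 - n / c + 6⁻¹)) := by
    intro n hn
    have hcr : (0 : ℝ) < c := Nat.cast_pos.2 (NeZero.pos c)
    have hx : (n / c : ℝ) ∈ Set.Icc (0 : ℝ) 1 := by
      refine ⟨by positivity, ?_⟩
      rw [div_le_one hcr]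
      exact_mod_cast (Finset.mem_range.1 hn).le
    have h := hasSum_one_div_pow_mul_fourier_mul_bernoulliFun le_rfl hx
    rw [bernoulliFun_two] at h
    convert h using 1
    · ext m
      have e : (n : ZMod c) * (m : ZMod c) = ((n * m : ℤ) : ZMod c) := by push_cast; rfl
      rw [e, ZMod.stdAddChar_coe, fourier_coe_apply]
      congr 2
      push_cast
      ring
    · rw [mul_pow, mul_pow, Complex.I_sq]
      push_cast [Nat.factorial]
      ring
  have h2 := hasSum_sum fun n hn => (h1 n hn).mul_left (χ (n : ZMod c))
  -- the inner sums are values of the discrete Fourier transform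
  have h3 : ∀ m : ℤ, ∑ n ∈ Finset.range c, χ (n : ZMod c) * (1 / (m : ℂ) ^ 2 *
      ZMod.stdAddChar ((n : ZMod c) * (m : ZMod c))) = 𝓕 (χ : ZMod c → ℂ) m * (1 / (m : ℂ) ^ 2) := by
    intro m
    have e : 𝓕 (χ : ZMod c → ℂ) m = 𝓕 (χ : ZMod c → ℂ) (-m) := by
      have := congrFun (ZMod.dft_comp_neg (χ : ZMod c → ℂ)) m
      have h4 : (fun j : ZMod c => χ (-j)) = χ := by
        ext j; exact DirichletCharacter.Even.eval_neg χ j hχ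
      rwa [h4] at this
    rw [e, ZMod.dft_apply, Finset.sum_mul]
    have := sum_zmod_val (c := c) fun n : ℕ => χ (n : ZMod c) * (1 / (m : ℂ) ^ 2 *
      ZMod.stdAddChar ((n : ZMod c) * (m : ZMod c)))
    rw [← this]
    refine Finset.sum_congr rfl fun j _ => ?_
    simp only [ZMod.natCast_val, ZMod.cast_id', id_eq, mul_neg, neg_neg, smul_eq_mul]
    ring
  simp only [h3] at h2
  have h4 := (Int.divModEquiv c).symm.hasSum_iff.2 h2
  have h5 := (Equiv.prodComm (Fin c) ℤ).hasSum_iff.2 h4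
  have h6 := h5.prod_fiberwise (g := fun s : Fin c => 𝓕 (χ : ZMod c → ℂ) ((s : ℕ) : ZMod c) *
    (((c : ℂ) ^ 2)⁻¹ * sqInvSum ((s : ℕ) / c))) fun s => by
      refine (((summable_sqInv ((s : ℕ) / c)).hasSum.mul_left ((c : ℂ) ^ 2)⁻¹).mul_left
        (𝓕 (χ : ZMod c → ℂ) ((s : ℕ) : ZMod c))).congr_fun fun m => ?_
      simp only [Function.comp_apply, Equiv.prodComm_apply, Prod.swap_prod_mk,
        Int.divModEquiv_symm_apply]
      rw [one_div, one_div, ← mul_inv, ← mul_pow]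
      congr 2
      · simp
      · congr 1
        push_cast
        field_simp
        ring
  have h7 := (hasSum_fintype _).unique h6
  have h8 := sum_zmod_val (c := c) fun n : ℕ =>
    𝓕 (χ : ZMod c → ℂ) (n : ZMod c) * sqInvSum (n / c)
  rw [Finset.sum_range] at h8
  have h9 : ∑ a : ZMod c, 𝓕 (χ : ZMod c → ℂ) a * sqInvSum ((a.val : ℤ) / c) =
      c ^ 2 * ∑ s : Fin c, 𝓕 (χ : ZMod c → ℂ) ((s : ℕ) : ZMod c) *
        (((c : ℂ) ^ 2)⁻¹ * sqInvSum ((s : ℕ) / c)) := by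
    have e : ∀ a : ZMod c, ((a.val : ℕ) : ZMod c) = a := fun a => by simp
    simp only [e] at h8
    simp only [Int.cast_natCast]
    rw [h8, Finset.mul_sum]
    refine Finset.sum_congr rfl fun s _ => ?_
    field_simp
  rw [h9, h7, Finset.mul_sum, Finset.mul_sum]
  exact Finset.sum_congr rfl fun n _ => by ring

/-- The series is a multiple of the sum of the series `eisOne` over the real division points `a / c`,
weighted by the discrete Fourier transform of `χ`, as the Fourier coefficients show. -/
theorem eisenstein_one_mem {χ : DirichletCharacter ℂ c} (hχ : χ.Odd) :
    eisenstein 1 triv χ ∈ ModForms c 1 χ := by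
  have hc : (c : ℂ) ≠ 0 := NeZero.ne _
  have hχ1 := ne_one_of_odd hχ
  set F := ∑ a : ZMod c, 𝓕 (χ : ZMod c → ℂ) a • eisOne c ![0, (a.val : ℤ)] with hF
  have hpi : (π : ℂ) ≠ 0 := by exact_mod_cast Real.pi_ne_zero
  have hq : HasQExp F fun n => (-4 * π * Complex.I * c) *
      if n = 0 then eisConst 1 triv χ else charSigma (1 - 1) triv χ n := by
    have h1 := HasQExp.sum (s := Finset.univ) fun (a : ZMod c) _ =>
      (hasQExp_eisOne (c := c) (a.val : ℤ)).smul (𝓕 (χ : ZMod c → ℂ) a)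
    refine HasQExp.congr h1 fun n => ?_
    rcases eq_or_ne n 0 with rfl | hn
    · simp only [if_true]
      rw [sum_dft_mul_cotPi hχ1, eisConst_one hχ1]
      field_simp
      ring
    · simp only [if_neg hn]
      rw [charSigma_triv_left, Finset.mul_sum]
      simp only [Finset.mul_sum]
      rw [Finset.sum_comm]
      refine Finset.sum_congr rfl fun d _ => ?_
      have e1 : ∀ a : ZMod c, 𝓕 (χ : ZMod c → ℂ) a * (-2 * π * Complex.I *
          (ZMod.stdAddChar ((d * (a.val : ℤ) : ℤ) : ZMod c) -
            ZMod.stdAddChar ((d * -(a.val : ℤ) : ℤ) : ZMod c))) =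
          -2 * π * Complex.I * (𝓕 (χ : ZMod c → ℂ) a * ZMod.stdAddChar ((d : ZMod c) * a) -
            𝓕 (χ : ZMod c → ℂ) a * ZMod.stdAddChar (-(d : ZMod c) * a)) := by
        intro a
        push_cast
        simp only [ZMod.natCast_val, ZMod.cast_id', id_eq, mul_neg, neg_mul]
        ring
      rw [Finset.sum_congr rfl fun a _ => e1 a, ← Finset.mul_sum, Finset.sum_sub_distrib,
        sum_stdAddChar_mul_dft, sum_stdAddChar_mul_dft, DirichletCharacter.Odd.eval_neg χ _ hχ]
      simp only [Nat.sub_self, pow_zero]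
      ring
  have hE : eisenstein 1 triv χ = (-4 * π * Complex.I * c)⁻¹ • F := by
    refine (hasQExp_eisenstein 1 triv χ).eq_of_coeff ((hq.smul _).congr fun n => ?_)
    rw [inv_mul_cancel_left₀]
    simp [hpi, hc]
  rw [hE]
  refine Submodule.smul_mem _ _ (mem_modForms_iff.2 ⟨hq.mdifferentiable, fun γ hγ => ?_,
    fun γ => ?_⟩)
  · exact sum_dft_slash (eisOne_slash c) eisOne_congr χ hγ
  · rw [hF, sum_slash]
    refine Finset.sum_induction _ IsBoundedAtImInfty (fun f g hf hg => hf.add hg)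
      (isBoundedAtImInfty_const 0) fun a _ => ?_
    rw [ModularForm.SL_smul_slash]
    exact Filter.BoundedAtFilter.smul _
      ((congrArg IsBoundedAtImInfty (eisOne_slash c _ γ)).mpr (isBoundedAtImInfty_eisOne _))

/-- As in weight one, with values of the `℘`-function at the real division points. The hypothesis on the
constant term allows for the separate case of the trivial character in the definition of
`eisConst`. -/
theorem eisenstein_two_mem_of_eisConst {χ : DirichletCharacter ℂ c} (hχ : χ.Even) (hc1 : c ≠ 1)
    (hconst : eisConst 2 triv χ = -genBernoulli 2 (charMul triv χ) / 4) :
    eisenstein 2 triv χ ∈ ModForms c 2 χ := by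
  have hc : (c : ℂ) ≠ 0 := NeZero.ne _
  have hχ0 : χ 0 = 0 := by
    have hn : Nontrivial (ZMod c) := ZMod.nontrivial_iff.2 hc1
    exact χ.map_nonunit not_isUnit_zero
  set F := ∑ a : ZMod c, 𝓕 (χ : ZMod c → ℂ) a • eisTwo c ![0, (a.val : ℤ)] with hF
  have hpi : (π : ℂ) ≠ 0 := by exact_mod_cast Real.pi_ne_zero
  -- the weights have sum zero, so that the contributions of `G₂` cancel
  have hF' : F = ∑ a : ZMod c, 𝓕 (χ : ZMod c → ℂ) a • (eisTwo c ![0, (a.val : ℤ)] + G2) := by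
    have h0 := sum_stdAddChar_mul_dft χ 0
    simp only [zero_mul, AddChar.map_zero_eq_one, mul_one, hχ0, mul_zero] at h0
    simp only [smul_add, Finset.sum_add_distrib, ← Finset.sum_smul]
    rw [h0, zero_smul, add_zero]
  have hq : HasQExp F fun n => (-8 * π ^ 2 * c) *
      if n = 0 then eisConst 2 triv χ else charSigma (2 - 1) triv χ n := by
    rw [hF']
    have h1 := HasQExp.sum (s := Finset.univ) fun (a : ZMod c) _ =>
      (hasQExp_eisTwo (c := c) (a.val : ℤ)).smul (𝓕 (χ : ZMod c → ℂ) a)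
    refine HasQExp.congr h1 fun n => ?_
    rcases eq_or_ne n 0 with rfl | hn
    · simp only [if_true]
      rw [sum_dft_mul_sqInvSum hχ, hconst, genBernoulli_two_charMul hc1]
      ring
    · simp only [if_neg hn]
      rw [charSigma_triv_left, Finset.mul_sum]
      simp only [Finset.mul_sum]
      rw [Finset.sum_comm]
      refine Finset.sum_congr rfl fun d _ => ?_
      have e1 : ∀ a : ZMod c, 𝓕 (χ : ZMod c → ℂ) a * (-4 * π ^ 2 * d *
          (ZMod.stdAddChar ((d * (a.val : ℤ) : ℤ) : ZMod c) +
            ZMod.stdAddChar ((d * -(a.val : ℤ) : ℤ) : ZMod c))) =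
          -4 * π ^ 2 * d * (𝓕 (χ : ZMod c → ℂ) a * ZMod.stdAddChar ((d : ZMod c) * a) +
            𝓕 (χ : ZMod c → ℂ) a * ZMod.stdAddChar (-(d : ZMod c) * a)) := by
        intro a
        push_cast
        simp only [ZMod.natCast_val, ZMod.cast_id', id_eq, mul_neg, neg_mul]
        ring
      rw [Finset.sum_congr rfl fun a _ => e1 a, ← Finset.mul_sum, Finset.sum_add_distrib,
        sum_stdAddChar_mul_dft, sum_stdAddChar_mul_dft, DirichletCharacter.Even.eval_neg χ _ hχ]
      simp only [Nat.add_one_sub_one, pow_one]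
      ring
  have hE : eisenstein 2 triv χ = (-8 * π ^ 2 * c : ℂ)⁻¹ • F := by
    refine (hasQExp_eisenstein 2 triv χ).eq_of_coeff ((hq.smul _).congr fun n => ?_)
    rw [inv_mul_cancel_left₀]
    simp [hpi, hc]
  rw [hE]
  refine Submodule.smul_mem _ _ (mem_modForms_iff.2 ⟨hq.mdifferentiable, fun γ hγ => ?_,
    fun γ => ?_⟩)
  · exact sum_dft_slash (eisTwo_slash c) eisTwo_congr χ hγ
  · rw [hF, sum_slash]
    refine Finset.sum_induction _ IsBoundedAtImInfty (fun f g hf hg => hf.add hg)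
      (isBoundedAtImInfty_const 0) fun a _ => ?_
    rw [ModularForm.SL_smul_slash]
    exact Filter.BoundedAtFilter.smul _
      ((congrArg IsBoundedAtImInfty (eisTwo_slash c _ γ)).mpr (isBoundedAtImInfty_eisTwo _))

theorem eisenstein_two_mem {χ : DirichletCharacter ℂ c} (hχ : χ.Even) (hχ1 : χ ≠ 1) :
    eisenstein 2 triv χ ∈ ModForms c 2 χ :=
  eisenstein_two_mem_of_eisConst hχ (level_ne_one_of_ne_one hχ1) (eisConst_two hχ1)

theorem eisenstein_two_one_mem {p : ℕ} [Fact p.Prime] :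
    eisenstein 2 triv (1 : DirichletCharacter ℂ p) ∈ ModForms p 2 (1 : DirichletCharacter ℂ p) := by
  refine eisenstein_two_mem_of_eisConst ?_ (Fact.out : p.Prime).ne_one eisConst_two_one
  exact MulChar.one_apply isUnit_one.neg

/-- Here the sum is over all division points `(r z + s) / c`, weighted by `χ(r)`. Summing over `s` gives
`c²` times the sum over the rows of the lattice, weighted by `χ`. -/
theorem eisenstein_two_swap_mem {χ : DirichletCharacter ℂ c} (hχ : χ.Even) (hχ1 : χ ≠ 1) :
    eisenstein 2 χ triv ∈ ModForms c 2 χ := by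
  have hc : (c : ℂ) ≠ 0 := NeZero.ne _
  set F := ∑ r : ZMod c, ∑ s : ZMod c, χ r • eisTwo c ![(r.val : ℤ), (s.val : ℤ)] with hF
  have hpi : (π : ℂ) ≠ 0 := by exact_mod_cast Real.pi_ne_zero
  have hq : HasQExp F _ := hasQExp_sum_eisTwo hχ hχ1
  have hE : eisenstein 2 χ triv = (-8 * π ^ 2 * c ^ 2 : ℂ)⁻¹ • F := by
    refine (hasQExp_eisenstein 2 χ triv).eq_of_coeff ((hq.smul _).congr fun n => ?_)
    rcases eq_or_ne n 0 with rfl | hn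
    · rw [if_pos rfl, eisConst, if_pos (by simp [hχ1])]
      simp
    · rw [if_neg hn, charSigma_triv_right, ← Finset.mul_sum, inv_mul_cancel_left₀]
      · exact Finset.sum_congr rfl fun d _ => by rw [mul_comm]; simp
      · simp [hpi, hc]
  rw [hE]
  refine Submodule.smul_mem _ _ (mem_modForms_iff.2 ⟨hq.mdifferentiable, fun γ hγ => ?_,
    fun γ => ?_⟩)
  · exact sum_sum_slash (eisTwo_slash c) eisTwo_congr χ hγ
  · rw [hF, sum_slash]
    refine Finset.sum_induction _ IsBoundedAtImInfty (fun f g hf hg => hf.add hg)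
      (isBoundedAtImInfty_const 0) fun r _ => ?_
    rw [sum_slash]
    refine Finset.sum_induction _ IsBoundedAtImInfty (fun f g hf hg => hf.add hg)
      (isBoundedAtImInfty_const 0) fun s _ => ?_
    rw [ModularForm.SL_smul_slash]
    exact Filter.BoundedAtFilter.smul _
      ((congrArg IsBoundedAtImInfty (eisTwo_slash c _ γ)).mpr (isBoundedAtImInfty_eisTwo _))

end Modularity

/-! ### A criterion in terms of Fourier coefficients -/

section Criterion

variable {V : ValuationSubring QBar} {ℓ N : ℕ}

/-- A multiple of `ℓ` by an algebraic integer reduces to `0`. -/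
theorem reduces_zero_of_natCast_mul (hV : (ℓ : QBar) ∈ V.nonunits) {x : ℂ} (hx : IsIntegral ℤ x) :
    Reduces V (ℓ * x) 0 := by
  obtain ⟨r, hr⟩ := (IsIntegralAt.of_isIntegral (V := V) hx).exists_reduces
  have := (reduces_natCast (V := V) ℓ).mul hr
  rwa [natCast_residue_eq_zero hV, zero_mul] at this

theorem isIntegral_charSigma {c₁ c₂ : ℕ} [NeZero c₁] [NeZero c₂] (ε₁ : DirichletCharacter ℂ c₁)
    (ε₂ : DirichletCharacter ℂ c₂) (r n : ℕ) : IsIntegral ℤ (charSigma r ε₁ ε₂ n) :=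
  IsIntegral.sum _ fun d _ => ((((isIntegral_natCast (B := ℂ) (a := d))).pow r).mul
    (isIntegral_dirichletCharacter ε₁ _)).mul (isIntegral_dirichletCharacter ε₂ _)

/-- The conditions on `A`, in terms of its Fourier coefficients and of the values of its character at
integers prime to its own level. -/
theorem GivesTheta.of_hasQExp [NeZero N] {M k : ℕ} [NeZero M] (h : M ∣ N) (hk : 0 < k)
    {χ : DirichletCharacter ℂ M} {A : ℍ → ℂ} {c : ℕ → ℂ} (hA : A ∈ ModForms M k χ)
    (hq : HasQExp A c) (h0 : Reduces V (c 0) 1) (h1 : ∀ n ≠ 0, Reduces V (c n) 0)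
    (h2 : ∀ n ≠ 0, Reduces V (1 / (k : ℂ) * (n * c n)) 0)
    (hχ : ∀ n : ℕ, n.Coprime M → n.Coprime ℓ →
      Reduces V (χ (n : ZMod M)) ((n : Residue V) ^ (-(k : ℤ)))) :
    GivesTheta V ℓ N M k χ A := by
  have hc := hq.coeffAt_eq
  have hθ : ∀ n, coeffAt n ((1 / (k : ℂ)) • theta A) = 1 / (k : ℂ) * (n * c n) :=
    (hq.theta.smul _).coeffAt_eq
  have h1' : ∀ n, Reduces V (c n) (if n = 0 then 1 else 0) := fun n => by
    split_ifs with hn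
    · rwa [hn]
    · exact h1 n hn
  have h2' : ∀ n, Reduces V (1 / (k : ℂ) * (n * c n)) 0 := fun n => by
    rcases eq_or_ne n 0 with rfl | hn
    · simpa using reduces_zero
    · exact h2 n hn
  refine ⟨hA, h, hk, ModForms.changeLevel h hA, fun n => ?_, fun n => ?_, fun n => ?_, fun n => ?_,
    fun n hn => ?_⟩
  · rw [hc]; exact (h1' n).isIntegralAt
  · rw [hθ]; exact (h2' n).isIntegralAt
  · rw [hc, coeffAt_one]
    refine ⟨_, h1' n, ?_⟩
    split_ifs
    · exact reduces_one
    · exact reduces_zero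
  · rw [hθ, coeffAt_zero]
    exact ⟨_, h2' n, reduces_zero⟩
  · have hnN := hn.coprime_mul_right_right
    rw [changeLevel_natCast h χ hnN]
    exact hχ n (hnN.coprime_dvd_right h) hn.coprime_mul_left_right

/-- The criterion when the weight is prime to `ℓ`; the condition on `θ A` is then automatic. -/
theorem GivesTheta.of_hasQExp_of_coprime (hℓ : ℓ.Prime) (hV : (ℓ : QBar) ∈ V.nonunits) [NeZero N]
    {M k : ℕ} [NeZero M] (h : M ∣ N) (hk : 0 < k) (hkℓ : k.Coprime ℓ)
    {χ : DirichletCharacter ℂ M} {A : ℍ → ℂ} {c : ℕ → ℂ} (hA : A ∈ ModForms M k χ)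
    (hq : HasQExp A c) (h0 : Reduces V (c 0) 1) (h1 : ∀ n ≠ 0, Reduces V (c n) 0)
    (hχ : ∀ n : ℕ, n.Coprime M → n.Coprime ℓ →
      Reduces V (χ (n : ZMod M)) ((n : Residue V) ^ (-(k : ℤ)))) :
    GivesTheta V ℓ N M k χ A := by
  refine .of_hasQExp h hk hA hq h0 h1 (fun n hn => ?_) hχ
  have := (reduces_one.div (reduces_natCast k) (natCast_residue_ne_zero hℓ hV hkℓ)).mul
    ((reduces_natCast n).mul (h1 n hn))
  rwa [mul_zero, mul_zero] at this

/-- Fermat's little theorem in the residue field. -/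
theorem natCast_pow_sub_one (hℓ : ℓ.Prime) (hV : (ℓ : QBar) ∈ V.nonunits) {n : ℕ}
    (hn : n.Coprime ℓ) : (n : Residue V) ^ (ℓ - 1) = 1 := by
  have := charP_residue hℓ hV
  have h := Nat.ModEq.pow_totient hn
  rw [Nat.totient_prime hℓ] at h
  simpa using (CharP.natCast_eq_natCast (Residue V) ℓ).2 h

end Criterion

/-! ### Level one -/

section LevelOne

/-- By Euler's formula for `ζ(2m)`, which is not zero. -/
theorem bernoulli_ne_zero_of_even {k : ℕ} (hk : Even k) (hk0 : k ≠ 0) : bernoulli k ≠ 0 := by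
  intro h
  obtain ⟨m, rfl⟩ := hk
  rw [← two_mul] at h hk0
  have h1 := riemannZeta_two_mul_nat (k := m) (by omega)
  rw [h] at h1
  refine riemannZeta_ne_zero_of_one_lt_re (s := 2 * m) ?_ (by rw [h1]; simp)
  have : (1 : ℝ) ≤ m := by exact_mod_cast (by omega : 1 ≤ m)
  simp
  linarith

theorem genBernoulli_triv (k : ℕ) : genBernoulli k (charMul triv triv) = bernoulli' k := by
  have h0 := bernoulliSeries_mul (charMul triv triv)
  have h1 : charMul triv triv ((1 : ℕ) : ZMod (1 * 1)) = 1 := by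
    rw [Nat.cast_one, map_one]
  have h2 : ∑ n ∈ (Finset.Icc 1 (1 * 1) : Finset ℕ), charMul triv triv ((n : ℕ) : ZMod (1 * 1)) •
      (PowerSeries.X * PowerSeries.rescale (n : ℂ) (PowerSeries.exp ℂ)) =
      PowerSeries.X * PowerSeries.exp ℂ := by
    rw [show Finset.Icc 1 (1 * 1) = {1} from rfl, Finset.sum_singleton, h1, one_smul, Nat.cast_one,
      PowerSeries.rescale_one, RingHom.id_apply]
  rw [h2, ← bernoulli'PowerSeries_mul_exp_sub_one,
    show ((1 * 1 : ℕ) : ℂ) = 1 by norm_num, PowerSeries.rescale_one,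
    RingHom.id_apply] at h0
  have h3 : PowerSeries.exp ℂ - 1 ≠ 0 := by
    intro h
    have := congrArg (PowerSeries.coeff 1) h
    simp [PowerSeries.coeff_exp, PowerSeries.coeff_one] at this
  rw [genBernoulli, mul_right_cancel₀ h3 h0, bernoulli'PowerSeries, PowerSeries.coeff_mk]
  have : (k.factorial : ℂ) ≠ 0 := by exact_mod_cast k.factorial_ne_zero
  simp
  field_simp

theorem eisConst_triv {k : ℕ} (hk : 3 ≤ k) : eisConst k triv triv = -bernoulli k / (2 * k) := by
  rw [eisConst, if_neg (by simp), if_neg (by simp; omega), genBernoulli_triv,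
    bernoulli_eq_bernoulli'_of_ne_one (by omega)]

/-- In `eisensteinOne` the coefficient of `q` is `1`; in Mathlib's `E` it is the constant coefficient. -/
theorem eisensteinOne_eq {k : ℕ} (hk : 3 ≤ k) (hk2 : Even k) :
    eisensteinOne k = (-bernoulli k / (2 * k) : ℂ) • (ModularForm.E hk : ℍ → ℂ) := by
  have hb : (bernoulli k : ℂ) ≠ 0 := by exact_mod_cast bernoulli_ne_zero_of_even hk2 (by omega)
  have hk0 : (k : ℂ) ≠ 0 := by exact_mod_cast (by omega : k ≠ 0)
  ext z
  rw [eisensteinOne, eisenstein, eisConst_triv hk, Pi.smul_apply, smul_eq_mul,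
    EisensteinSeries.q_expansion_bernoulli hk hk2 z]
  have h : ∀ n : ℕ+, charSigma (k - 1) triv triv (n : ℕ) = ArithmeticFunction.sigma (k - 1) n := by
    intro n
    rw [charSigma_triv_left, ArithmeticFunction.sigma_apply]
    push_cast
    refine Finset.sum_congr rfl fun d _ => ?_
    rw [Subsingleton.elim (d : ZMod 1) 1, map_one, mul_one]
  simp only [h, zpow_natCast]
  field_simp
  ring

theorem eisensteinOne_mem {k : ℕ} (hk : 3 ≤ k) (hk2 : Even k) :
    eisensteinOne k ∈ ModForms 1 k triv := by
  rw [eisensteinOne_eq hk hk2]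
  refine Submodule.smul_mem _ _ ?_
  have hs : ∀ γ : SL(2, ℤ), (ModularForm.E hk : ℍ → ℂ) ∣[(k : ℤ)] γ = ModularForm.E hk :=
    fun γ => SlashInvariantForm.slash_action_eqn (ModularForm.E hk) _ ⟨γ, rfl⟩
  refine mem_modForms_iff.2 ⟨ModularFormClass.holo _, fun γ _ => ?_, fun γ => ?_⟩
  · rw [hs, Subsingleton.elim (((γ 1 1 : ℤ)) : ZMod 1) 1, map_one, one_smul]
  · rw [hs]
    exact ModularFormClass.bdd_at_infty (ModularForm.E hk)

variable {V : ValuationSubring QBar} {ℓ N : ℕ}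

/-- By the theorem of von Staudt and Clausen, `ℓ B_{ℓ-1} ≡ -1`. -/
theorem reduces_mul_bernoulli (hℓ : ℓ.Prime) (hℓ3 : 3 ≤ ℓ) (hV : (ℓ : QBar) ∈ V.nonunits) :
    Reduces V (ℓ * (bernoulli (ℓ - 1) : ℂ)) (-1) := by
  obtain ⟨m, hm⟩ := (hℓ.even_sub_one (by omega))
  obtain ⟨j, hj⟩ := Bernoulli.vonStaudt_clausen m
  set S := (Finset.range (2 * m + 2)).filter fun p => p.Prime ∧ p - 1 ∣ 2 * m with hS
  have hmem : ℓ ∈ S := by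
    rw [hS, Finset.mem_filter, Finset.mem_range]
    refine ⟨by omega, hℓ, ?_⟩
    rw [hm, two_mul]
  have hℓ0 : (ℓ : ℂ) ≠ 0 := by exact_mod_cast hℓ.ne_zero
  have hj' := congrArg (Rat.cast : ℚ → ℂ) hj
  push_cast at hj'
  rw [← Finset.add_sum_erase _ _ hmem] at hj'
  have e : (ℓ : ℂ) * bernoulli (ℓ - 1) = ℓ * j - ℓ * ∑ p ∈ S.erase ℓ, (1 / p : ℂ) - 1 := by
    rw [hm, ← two_mul, hj']
    field_simp
    ring
  rw [e]
  have h1 : Reduces V (∑ p ∈ S.erase ℓ, (1 / p : ℂ)) (∑ p ∈ S.erase ℓ, (1 / p : Residue V)) := by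
    refine Reduces.sum _ fun p hp => reduces_one.div (reduces_natCast p) ?_
    rw [Finset.mem_erase, hS, Finset.mem_filter] at hp
    exact natCast_residue_ne_zero hℓ hV ((Nat.coprime_primes hp.2.2.1 hℓ).2 hp.1)
  have h2 := (((reduces_natCast (V := V) ℓ).mul (reduces_intCast j)).sub
    ((reduces_natCast ℓ).mul h1)).sub reduces_one
  rwa [natCast_residue_eq_zero hV, zero_mul, zero_mul, sub_zero, zero_sub] at h2

theorem givesTheta_eisensteinOne (hℓ : ℓ.Prime) (hV : (ℓ : QBar) ∈ V.nonunits) [NeZero N]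
    (hℓ5 : 5 ≤ ℓ) : GivesTheta V ℓ N 1 (ℓ - 1) triv ((-2 * (ℓ : ℂ)) • eisensteinOne (ℓ - 1)) := by
  have hk : 3 ≤ ℓ - 1 := by omega
  have hk2 : Even (ℓ - 1) := hℓ.even_sub_one (by omega)
  have hcop : (ℓ - 1).Coprime ℓ :=
    ((Nat.Prime.coprime_iff_not_dvd hℓ).2 (Nat.not_dvd_of_pos_of_lt (by omega) (by omega))).symm
  refine .of_hasQExp_of_coprime hℓ hV (one_dvd N) (by omega) hcop
    (Submodule.smul_mem _ _ (eisensteinOne_mem hk hk2)) ((hasQExp_eisenstein _ triv triv).smul _)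
    ?_ (fun n hn => ?_) fun n _ hn => ?_
  · rw [if_pos rfl, eisConst_triv hk]
    have h1 := (reduces_mul_bernoulli hℓ (by omega) hV).div (reduces_natCast (ℓ - 1))
      (natCast_residue_ne_zero hℓ hV hcop)
    have e : ((ℓ - 1 : ℕ) : Residue V) = -1 := by
      rw [Nat.cast_sub hℓ.one_lt.le, natCast_residue_eq_zero hV, Nat.cast_one, zero_sub]
    rw [e, div_self (by simp)] at h1
    have h0 : ((ℓ - 1 : ℕ) : ℂ) ≠ 0 := by exact_mod_cast (by omega : ℓ - 1 ≠ 0)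
    convert h1 using 1
    field_simp
  · rw [if_neg hn]
    have := reduces_zero_of_natCast_mul hV
      ((isIntegral_charSigma triv triv (ℓ - 1 - 1) n).mul (isIntegral_intCast (B := ℂ) (n := -2)))
    convert this using 1
    push_cast
    ring
  · rw [Subsingleton.elim (n : ZMod 1) 1, map_one, zpow_neg, zpow_natCast,
      natCast_pow_sub_one hℓ hV hn, inv_one]
    exact reduces_one

/-- The constant coefficient of `240 E₄` is `1`, and the other coefficients are multiples of `240`. As
the weight `4` is not prime to `2`, for `ℓ = 2` the condition on `θ A` uses that `60 = 240 / 4` is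
still even. -/
theorem givesTheta_eisensteinOne_four (hℓ : ℓ.Prime) (hV : (ℓ : QBar) ∈ V.nonunits) [NeZero N]
    (hℓ3 : ℓ = 2 ∨ ℓ = 3) : GivesTheta V ℓ N 1 4 triv ((240 : ℂ) • eisensteinOne 4) := by
  have hb : bernoulli 4 = -1 / 30 := by norm_num [bernoulli, bernoulli'_four]
  refine .of_hasQExp (one_dvd N) (by omega)
    (Submodule.smul_mem _ _ (eisensteinOne_mem (by omega) ⟨2, rfl⟩))
    ((hasQExp_eisenstein _ triv triv).smul _) ?_ (fun n hn => ?_) (fun n hn => ?_) fun n _ hn => ?_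
  · rw [if_pos rfl, eisConst_triv (by omega), hb]
    convert reduces_one using 1
    norm_num
  · rw [if_neg hn]
    obtain ⟨j, hj⟩ : ∃ j : ℕ, 240 = ℓ * j := by
      rcases hℓ3 with rfl | rfl
      · exact ⟨120, rfl⟩
      · exact ⟨80, rfl⟩
    have e : (240 : ℂ) = ℓ * j := by exact_mod_cast hj
    rw [e, mul_assoc]
    exact reduces_zero_of_natCast_mul hV
      ((isIntegral_natCast (B := ℂ) (a := j)).mul (isIntegral_charSigma triv triv _ n))
  · rw [if_neg hn]
    obtain ⟨j, hj⟩ : ∃ j : ℕ, 60 = ℓ * j := by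
      rcases hℓ3 with rfl | rfl
      · exact ⟨30, rfl⟩
      · exact ⟨20, rfl⟩
    have e : (60 : ℂ) = ℓ * j := by exact_mod_cast hj
    have := reduces_zero_of_natCast_mul hV ((isIntegral_natCast (B := ℂ) (a := j * n)).mul
      (isIntegral_charSigma triv triv (4 - 1) n))
    convert this using 1
    push_cast
    linear_combination (n * charSigma (4 - 1) triv triv n) * e
  · have h1 : (n : Residue V) ^ 4 = 1 := by
      have h2 := natCast_pow_sub_one hℓ hV hn
      rcases hℓ3 with rfl | rfl
      · rw [show (4 : ℕ) = (2 - 1) * 4 from rfl, pow_mul, h2, one_pow]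
      · rw [show (4 : ℕ) = (3 - 1) * 2 from rfl, pow_mul, h2, one_pow]
    rw [Subsingleton.elim (n : ZMod 1) 1, map_one, zpow_neg]
    have : (n : Residue V) ^ ((4 : ℕ) : ℤ) = 1 := by rw [zpow_natCast, h1]
    rw [this, inv_one]
    exact reduces_one

end LevelOne

/-! ### Quadratic characters modulo 3 and 4, and trivial characters -/

section SmallLevel

variable {V : ValuationSubring QBar} {ℓ N : ℕ}

/-- A non-trivial character of a group of units `{1, -1}` is odd. -/
theorem odd_of_forall_unit_eq {c : ℕ} (h : ∀ a : (ZMod c)ˣ, a = 1 ∨ a = -1)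
    {χ : DirichletCharacter ℂ c} (hχ : χ ≠ 1) : χ.Odd := by
  refine χ.even_or_odd.resolve_left fun he => hχ (MulChar.ext fun a => ?_)
  rcases h a with rfl | rfl
  · simp
  · rw [MulChar.one_apply_coe, Units.val_neg, Units.val_one]
    exact he

theorem natCast_residue_eq_one_of_two (hV : ((2 : ℕ) : QBar) ∈ V.nonunits) {n : ℕ}
    (hn : n.Coprime 2) : (n : Residue V) = 1 := by
  simpa using natCast_pow_sub_one Nat.prime_two hV hn

/-- At a place above `ℓ`, a character whose order is a power of `ℓ` is trivial. -/
theorem reduces_char_of_pow_prime_pow (hℓ : ℓ.Prime) (hV : (ℓ : QBar) ∈ V.nonunits) {c m : ℕ}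
    {χ : DirichletCharacter ℂ c} (hχ : χ ^ ℓ ^ m = 1) {n : ℕ} (hn : n.Coprime c) :
    Reduces V (χ (n : ZMod c)) 1 := by
  refine reduces_one_of_pow_prime_pow hℓ hV (m := m) ?_
  rw [← MulChar.pow_apply' χ (pow_pos hℓ.pos m).ne', hχ,
    MulChar.one_apply ((ZMod.isUnit_iff_coprime n c).2 hn)]

theorem givesTheta_four (hV : ((2 : ℕ) : QBar) ∈ V.nonunits) [NeZero N] (hN : 4 ∣ N)
    {χ : DirichletCharacter ℂ 4} (hχ : χ ≠ 1) :
    GivesTheta V 2 N 4 1 χ ((4 : ℂ) • eisenstein 1 triv χ) := by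
  have hodd : χ.Odd := odd_of_forall_unit_eq (by decide) hχ
  have h3 : χ 3 = -1 := hodd
  have h2 : χ 2 = 0 := MulChar.map_nonunit _ (by decide)
  refine .of_hasQExp_of_coprime Nat.prime_two hV hN one_pos (by norm_num)
    (Submodule.smul_mem _ _ (eisenstein_one_mem hodd))
    ((hasQExp_eisenstein 1 triv χ).smul _) ?_ (fun n hn => ?_) fun n hn4 hn2 => ?_
  · rw [if_pos rfl, eisConst_one hχ]
    convert reduces_one using 1
    simp [Finset.sum_range_succ, h2, h3]
    norm_num
  · rw [if_neg hn]
    have := reduces_zero_of_natCast_mul hV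
      ((isIntegral_charSigma triv χ (1 - 1) n).mul (isIntegral_natCast (B := ℂ) (a := 2)))
    convert this using 1
    push_cast
    ring
  · rw [natCast_residue_eq_one_of_two hV hn2, one_zpow]
    refine reduces_char_of_pow_prime_pow Nat.prime_two hV (m := 1) (MulChar.ext fun a => ?_) hn4
    have : ∀ a : (ZMod 4)ˣ, a ^ 2 = 1 := by decide
    rw [MulChar.pow_apply_coe, ← map_pow, pow_one, ← Units.val_pow_eq_pow_val, this]
    simp

theorem givesTheta_three (hV : ((3 : ℕ) : QBar) ∈ V.nonunits) [NeZero N] (hN : 3 ∣ N)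
    {χ : DirichletCharacter ℂ 3} (hχ : χ ≠ 1) :
    GivesTheta V 3 N 3 1 χ ((6 : ℂ) • eisenstein 1 triv χ) := by
  have hodd : χ.Odd := odd_of_forall_unit_eq (by decide) hχ
  have h2 : χ 2 = -1 := hodd
  have h30 : ((3 : ℕ) : Residue V) = 0 := natCast_residue_eq_zero hV
  refine .of_hasQExp_of_coprime Nat.prime_three hV hN one_pos (by norm_num)
    (Submodule.smul_mem _ _ (eisenstein_one_mem hodd))
    ((hasQExp_eisenstein 1 triv χ).smul _) ?_ (fun n hn => ?_) fun n hn3 _ => ?_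
  · rw [if_pos rfl, eisConst_one hχ]
    convert reduces_one using 1
    simp [Finset.sum_range_succ, h2]
    norm_num
  · rw [if_neg hn]
    have := reduces_zero_of_natCast_mul hV
      ((isIntegral_charSigma triv χ (1 - 1) n).mul (isIntegral_natCast (B := ℂ) (a := 2)))
    convert this using 1
    push_cast
    ring
  · have hn : n = n % 3 + 3 * (n / 3) := (Nat.mod_add_div n 3).symm
    have e1 : (n : Residue V) = ((n % 3 : ℕ) : Residue V) := by
      conv_lhs => rw [hn]
      rw [Nat.cast_add, Nat.cast_mul, h30, zero_mul, add_zero]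
    have e2 : (n : ZMod 3) = ((n % 3 : ℕ) : ZMod 3) := by simp
    have h12 : n % 3 = 1 ∨ n % 3 = 2 := by
      have : ¬ 3 ∣ n := fun hd => (Nat.Prime.coprime_iff_not_dvd Nat.prime_three).1 hn3.symm hd
      omega
    rw [e1, e2]
    rcases h12 with h | h
    · rw [h]
      simpa using reduces_one
    · rw [h, Nat.cast_ofNat, h2]
      have : ((2 : ℕ) : Residue V) = -1 := by
        rw [eq_neg_iff_add_eq_zero, ← Nat.cast_add_one, h30]
      rw [this, Nat.cast_one, zpow_neg, zpow_one, inv_neg, inv_one]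
      exact reduces_one.neg

theorem eisConst_two_triv_one (p : ℕ) :
    eisConst 2 triv (1 : DirichletCharacter ℂ p) = ((p : ℂ) - 1) / 24 := by
  rw [eisConst, if_neg (by simp), if_pos (by simp)]

theorem one_apply_natCast {c n : ℕ} (hn : n.Coprime c) :
    (1 : DirichletCharacter ℂ c) (n : ZMod c) = 1 :=
  MulChar.one_apply ((ZMod.isUnit_iff_coprime n c).2 hn)

/-- The weight `2` is not prime to `ℓ = 2`, so `θ A` needs that the coefficients, multiples of `24`, stay
even after division by `2`. -/
theorem givesTheta_two (hV : ((2 : ℕ) : QBar) ∈ V.nonunits) [NeZero N] (hN : 2 ∣ N) :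
    GivesTheta V 2 N 2 2 1 ((24 : ℂ) • eisenstein 2 triv (1 : DirichletCharacter ℂ 2)) := by
  have : Fact (Nat.Prime 2) := ⟨Nat.prime_two⟩
  refine .of_hasQExp hN two_pos (Submodule.smul_mem _ _ eisenstein_two_one_mem)
    ((hasQExp_eisenstein 2 triv 1).smul _) ?_ (fun n hn => ?_) (fun n hn => ?_) fun n hn2 _ => ?_
  · rw [if_pos rfl, eisConst_two_triv_one]
    convert reduces_one using 1
    norm_num
  · rw [if_neg hn]
    have := reduces_zero_of_natCast_mul hV ((isIntegral_charSigma triv (1 : DirichletCharacter ℂ 2)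
      (2 - 1) n).mul (isIntegral_natCast (B := ℂ) (a := 12)))
    convert this using 1
    push_cast
    ring
  · rw [if_neg hn]
    have := reduces_zero_of_natCast_mul hV ((isIntegral_charSigma triv (1 : DirichletCharacter ℂ 2)
      (2 - 1) n).mul (isIntegral_natCast (B := ℂ) (a := 6 * n)))
    convert this using 1
    push_cast
    ring
  · rw [natCast_residue_eq_one_of_two hV hn2, one_zpow, one_apply_natCast hn2]
    exact reduces_one

/-- At a place above `3`, the character `n ↦ n ^ (-2)` is trivial. -/
theorem natCast_residue_zpow_neg_two (hV : ((3 : ℕ) : QBar) ∈ V.nonunits) {n : ℕ}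
    (hn : n.Coprime 3) : (n : Residue V) ^ (-((2 : ℕ) : ℤ)) = 1 := by
  rw [zpow_neg, zpow_natCast, natCast_pow_sub_one Nat.prime_three hV hn, inv_one]

/-- The constant coefficient is `1` by construction. As `p ≡ 2` modulo `3`, the factor `24 / (p - 1)` is
divisible by `3`. -/
theorem givesTheta_prime_two_mod_three (hV : ((3 : ℕ) : QBar) ∈ V.nonunits) [NeZero N] {p : ℕ}
    (hp : p.Prime) (hN : p ∣ N) (hp3 : p ≡ 2 [MOD 3]) :
    GivesTheta V 3 N p 2 1
      ((24 / ((p : ℂ) - 1)) • eisenstein 2 triv (1 : DirichletCharacter ℂ p)) := by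
  have : Fact p.Prime := ⟨hp⟩
  have hp1 : ((p - 1 : ℕ) : ℂ) = p - 1 := by rw [Nat.cast_sub hp.one_lt.le, Nat.cast_one]
  have hp0 : (p : ℂ) - 1 ≠ 0 := by
    rw [← hp1]; exact_mod_cast (Nat.sub_pos_of_lt hp.one_lt).ne'
  have hc : (p - 1).Coprime 3 := by
    refine ((Nat.Prime.coprime_iff_not_dvd Nat.prime_three).2 fun hd => ?_).symm
    have := hp.one_lt
    have hp3' : p % 3 = 2 := hp3
    omega
  refine .of_hasQExp_of_coprime Nat.prime_three hV hN two_pos (by norm_num)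
    (Submodule.smul_mem _ _ eisenstein_two_one_mem)
    ((hasQExp_eisenstein 2 triv 1).smul _) ?_ (fun n hn => ?_) fun n hnp hn3 => ?_
  · rw [if_pos rfl, eisConst_two_triv_one]
    convert reduces_one using 1
    field_simp
  · rw [if_neg hn]
    have := (reduces_zero_of_natCast_mul hV ((isIntegral_charSigma triv
      (1 : DirichletCharacter ℂ p) (2 - 1) n).mul (isIntegral_natCast (B := ℂ) (a := 8)))).div
      (reduces_natCast (p - 1)) (natCast_residue_ne_zero Nat.prime_three hV hc)
    rw [zero_div, hp1] at this
    convert this using 1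
    push_cast
    ring
  · rw [natCast_residue_zpow_neg_two hV hn3, one_apply_natCast hnp]
    exact reduces_one

end SmallLevel

/-! ### The Teichmüller lift -/

section Teichmuller

variable {V : ValuationSubring QBar} {ℓ N : ℕ}

/-- A primitive `(ℓ - 1)`-st root of unity stays primitive under reduction. Hence the class of a
generator `g` of `(ℤ/ℓ)ˣ` is the reduction of some `(ℓ - 1)`-st root of unity, and the character
with this value at `g` is the Teichmüller lift. -/
theorem exists_isTeichmullerLift (hℓ : ℓ.Prime) (hV : (ℓ : QBar) ∈ V.nonunits) :
    ∃ χ : DirichletCharacter ℂ ℓ, IsTeichmullerLift V ℓ χ := by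
  have : Fact ℓ.Prime := ⟨hℓ⟩
  have := charP_residue hℓ hV
  have hℓ1 : 0 < ℓ - 1 := Nat.sub_pos_of_lt hℓ.one_lt
  have : NeZero (ℓ - 1) := ⟨hℓ1.ne'⟩
  have hcop : (ℓ - 1).Coprime ℓ :=
    (Nat.coprime_of_lt_prime hℓ1.ne' (Nat.sub_lt hℓ.pos one_pos) hℓ).symm
  obtain ⟨ζ, hζ⟩ : ∃ ζ : ℂ, IsPrimitiveRoot ζ (ℓ - 1) :=
    ⟨_, Complex.isPrimitiveRoot_exp _ hℓ1.ne'⟩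
  obtain ⟨z, hz⟩ := (IsIntegralAt.of_isIntegral (V := V)
    (isIntegral_of_pow_eq_one hℓ1 hζ.pow_eq_one)).exists_reduces
  have hz1 : IsPrimitiveRoot z (ℓ - 1) := by
    refine IsPrimitiveRoot.mk_of_lt z hℓ1 ?_ fun d hd0 hd h => ?_
    · refine Reduces.unique (hz.pow (ℓ - 1)) ?_
      rw [hζ.pow_eq_one]
      exact reduces_one
    · refine hζ.pow_ne_one_of_pos_of_lt hd0.ne' hd
        (eq_one_of_reduces_one hℓ hV hcop ?_ (h ▸ hz.pow d))
      rw [← pow_mul, mul_comm, pow_mul, hζ.pow_eq_one, one_pow]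
  obtain ⟨g, hg⟩ := IsCyclic.exists_generator (α := (ZMod ℓ)ˣ)
  set φ : ZMod ℓ →+* Residue V := ZMod.castHom (dvd_refl ℓ) _ with hφ
  have hpow : ∀ a : (ZMod ℓ)ˣ, a ^ (ℓ - 1) = 1 := ZMod.units_pow_card_sub_one_eq_one ℓ
  obtain ⟨i, -, hi⟩ := hz1.eq_pow_of_pow_eq_one (ξ := φ (g : ZMod ℓ)) (by
    rw [← map_pow, ← Units.val_pow_eq_pow_val, hpow, Units.val_one, map_one])
  have hμ : (hζ.isUnit hℓ1.ne').unit ^ i ∈ rootsOfUnity (Fintype.card (ZMod ℓ)ˣ) ℂ := by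
    rw [ZMod.card_units, mem_rootsOfUnity, ← pow_mul, mul_comm, pow_mul]
    have : (hζ.isUnit hℓ1.ne').unit ^ (ℓ - 1) = 1 := by
      ext
      simpa using hζ.pow_eq_one
    rw [this, one_pow]
  set χ : DirichletCharacter ℂ ℓ := MulChar.ofRootOfUnity hμ hg
  have hχ : χ (g : ZMod ℓ) = ζ ^ i := by
    rw [MulChar.ofRootOfUnity_spec]
    simp
  refine ⟨χ, fun n hn => ?_⟩
  set u := ZMod.unitOfCoprime n hn with hu
  have hun : (n : ZMod ℓ) = u := rfl
  refine ⟨⟨ℓ - 1, hℓ1, hcop, ?_⟩, ?_⟩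
  · rw [hun, ← map_pow, ← Units.val_pow_eq_pow_val, hpow, Units.val_one, map_one]
  · obtain ⟨j, hj⟩ := mem_powers_iff_mem_zpowers.2 (hg u)
    replace hj : g ^ j = u := hj
    have h1 : (n : Residue V) = (z ^ i) ^ j := by
      rw [hi, ← map_pow, ← Units.val_pow_eq_pow_val, hj, ← hun, map_natCast]
    rw [h1, hun, ← hj, Units.val_pow_eq_pow_val, map_pow, hχ]
    exact (hz.pow i).pow j

/-- The quotient of two lifts takes values in roots of unity of order prime to `ℓ` with reduction `1`. -/
theorem IsTeichmullerLift.unique (hℓ : ℓ.Prime) (hV : (ℓ : QBar) ∈ V.nonunits)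
    {χ χ' : DirichletCharacter ℂ ℓ} (h : IsTeichmullerLift V ℓ χ) (h' : IsTeichmullerLift V ℓ χ') :
    χ = χ' := by
  have : NeZero ℓ := ⟨hℓ.ne_zero⟩
  refine MulChar.ext fun a => ?_
  have ha : ((ZMod.val (a : ZMod ℓ) : ℕ) : ZMod ℓ) = a := ZMod.natCast_zmod_val _
  have hn : (ZMod.val (a : ZMod ℓ)).Coprime ℓ := ZMod.val_coe_unit_coprime a
  obtain ⟨⟨m, -, hm, h1⟩, h2⟩ := h _ hn
  obtain ⟨⟨m', -, hm', h1'⟩, h2'⟩ := h' _ hn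
  have hne := natCast_residue_ne_zero hℓ hV hn
  have h3 := h2.div h2' hne
  rw [div_self hne] at h3
  rw [ha] at h1 h1' h3
  have h0 : χ' (a : ZMod ℓ) ≠ 0 := (a.isUnit.map χ').ne_zero
  have h4 := eq_one_of_reduces_one hℓ hV (hm.mul_left hm') (by
    rw [div_pow, pow_mul, h1, one_pow, mul_comm, pow_mul, h1', one_pow, div_one]) h3
  exact (div_eq_one_iff_eq h0).1 h4

/-- The constant coefficient is `-∑ n χ⁻¹(n)`, over `0 < n < ℓ`, and every summand is congruent to `1`.
The character `χ⁻¹` is odd because `χ(-1) ≡ -1`. -/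
theorem givesTheta_teichmuller (hℓ : ℓ.Prime) (hℓ3 : 3 ≤ ℓ) (hV : (ℓ : QBar) ∈ V.nonunits)
    [NeZero N] (hN : ℓ ∣ N) {χ : DirichletCharacter ℂ ℓ} (h : IsTeichmullerLift V ℓ χ) :
    GivesTheta V ℓ N ℓ 1 χ⁻¹ ((2 * (ℓ : ℂ)) • eisenstein 1 triv χ⁻¹) := by
  have : NeZero ℓ := ⟨hℓ.ne_zero⟩
  have hred : ∀ n : ℕ, n.Coprime ℓ → Reduces V (χ⁻¹ (n : ZMod ℓ)) ((n : Residue V)⁻¹) :=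
    fun n hn => by
      rw [MulChar.inv_apply_eq_inv']
      exact (h n hn).2.inv (natCast_residue_ne_zero hℓ hV hn)
  have hℓ1 : ((ℓ - 1 : ℕ) : Residue V) = -1 := by
    rw [Nat.cast_sub hℓ.one_lt.le, natCast_residue_eq_zero hV, Nat.cast_one, zero_sub]
  have hodd : χ⁻¹.Odd := by
    refine χ⁻¹.even_or_odd.resolve_left fun he => ?_
    have h1 := hred (ℓ - 1) (Nat.coprime_of_lt_prime (Nat.sub_pos_of_lt hℓ.one_lt).ne'
      (Nat.sub_lt hℓ.pos one_pos) hℓ).symm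
    rw [hℓ1, Nat.cast_sub hℓ.one_lt.le, ZMod.natCast_self, Nat.cast_one, zero_sub, he] at h1
    have h2 := h1.unique reduces_one
    refine natCast_residue_ne_zero hℓ hV (n := 2) ((Nat.coprime_primes Nat.prime_two hℓ).2
      (by omega)) ?_
    rw [inv_neg, inv_one] at h2
    rw [Nat.cast_ofNat, ← one_add_one_eq_two]
    nth_rewrite 1 [← h2]
    exact neg_add_cancel 1
  have hℓ0 : (ℓ : ℂ) ≠ 0 := by exact_mod_cast hℓ.ne_zero
  refine .of_hasQExp_of_coprime hℓ hV hN one_pos (Nat.coprime_one_left ℓ)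
    (Submodule.smul_mem _ _ (eisenstein_one_mem hodd))
    ((hasQExp_eisenstein 1 triv χ⁻¹).smul _) ?_ (fun n hn => ?_) fun n hn _ => ?_
  · rw [if_pos rfl, eisConst_one (ne_one_of_odd hodd)]
    have hs : Reduces V (∑ n ∈ Finset.range ℓ, χ⁻¹ (n : ZMod ℓ) * n)
        (∑ n ∈ Finset.range ℓ, if n = 0 then 0 else 1) := by
      refine Reduces.sum _ fun n hn => ?_
      split_ifs with h0
      · rw [h0, Nat.cast_zero (R := ℂ), mul_zero]
        exact reduces_zero
      · have hc := (Nat.coprime_of_lt_prime h0 (Finset.mem_range.1 hn) hℓ).symm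
        have := (hred n hc).mul (reduces_natCast n)
        rwa [inv_mul_cancel₀ (natCast_residue_ne_zero hℓ hV hc)] at this
    have he : (∑ n ∈ Finset.range ℓ, if n = 0 then 0 else 1 : Residue V) = -1 := by
      rw [← Nat.sub_add_cancel hℓ.one_lt.le, Finset.sum_range_succ']
      simp [hℓ1]
    rw [he] at hs
    convert hs.neg using 1
    · field_simp
    · rw [neg_neg]
  · rw [if_neg hn]
    have := reduces_zero_of_natCast_mul hV
      ((isIntegral_charSigma triv χ⁻¹ (1 - 1) n).mul (isIntegral_natCast (B := ℂ) (a := 2)))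
    convert this using 1
    push_cast
    ring
  · rw [Nat.cast_one, zpow_neg, zpow_one]
    exact hred n hn

end Teichmuller

/-! ### Characters of order a power of 2 -/

section PowerOfTwo

variable {V : ValuationSubring QBar} {N p : ℕ}

theorem orderOf_generator [Fact p.Prime] {g : (ZMod p)ˣ}
    (hg : ∀ x, x ∈ Subgroup.zpowers g) : orderOf g = p - 1 := by
  rw [orderOf_eq_card_of_forall_mem_zpowers hg, Nat.card_eq_fintype_card, ZMod.card_units]

/-- A weighted character sum over `0 ≤ n < p`, along the powers of a primitive root. -/
theorem sum_range_char_mul_eq [Fact p.Prime] {g : (ZMod p)ˣ}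
    (hg : ∀ x, x ∈ Subgroup.zpowers g) (χ : DirichletCharacter ℂ p) :
    ∑ n ∈ Finset.range p, χ (n : ZMod p) * n =
      ∑ k ∈ Finset.range (p - 1), χ g ^ k * (((g : ZMod p) ^ k).val : ℂ) := by
  have h1 : ∑ u : (ZMod p)ˣ, χ u * ((u : ZMod p).val : ℂ) =
      ∑ n ∈ Finset.range p, χ (n : ZMod p) * n := by
    refine Finset.sum_of_injOn (fun u => (u : ZMod p).val) (fun u _ v _ h => ?_) (fun u _ => ?_)
      (fun n hn h => ?_) fun u _ => ?_
    · exact Units.ext (ZMod.val_injective p h)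
    · exact Finset.mem_coe.2 (Finset.mem_range.2 (ZMod.val_lt _))
    · rw [MulChar.map_nonunit, zero_mul]
      rintro ⟨u, hu⟩
      refine h ⟨u, Finset.mem_coe.2 (Finset.mem_univ u), ?_⟩
      simp only [hu, ZMod.val_natCast_of_lt (Finset.mem_range.1 hn)]
    · simp only [ZMod.natCast_zmod_val]
  rw [← h1, ← IsCyclic.image_range_orderOf hg, Finset.sum_image, orderOf_generator hg]
  · refine Finset.sum_congr rfl fun k _ => ?_
    rw [Units.val_pow_eq_pow_val, map_pow]
  · intro a ha b hb h
    exact pow_injOn_Iio_orderOf (by simpa using ha) (by simpa using hb) h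

/-- This power has square `1`, but is not `1`. -/
theorem generator_pow_half [Fact p.Prime] {g : (ZMod p)ˣ}
    (hg : ∀ x, x ∈ Subgroup.zpowers g) {h : ℕ} (h0 : 0 < h) (hp : p - 1 = 2 * h) :
    (g : ZMod p) ^ h = -1 := by
  have h2 : ((g : ZMod p) ^ h) ^ 2 = 1 := by
    rw [← pow_mul, mul_comm, ← hp, ← Units.val_pow_eq_pow_val, ← orderOf_generator hg,
      pow_orderOf_eq_one, Units.val_one]
  refine (sq_eq_one_iff.1 h2).resolve_left fun h1 => ?_
  have h3 : g ^ h = 1 := Units.ext (by rw [Units.val_pow_eq_pow_val, h1, Units.val_one])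
  have h4 := orderOf_le_of_pow_eq_one h0 h3
  rw [orderOf_generator hg] at h4
  omega

/-- In the sum over the powers of a primitive root `g`, the classes of `g ^ k` and of
`g ^ (k + h) = -g ^ k`, where `h = (p - 1) / 2`, are taken together. -/
theorem sum_range_odd_char_mul_eq [Fact p.Prime] {g : (ZMod p)ˣ}
    (hg : ∀ x, x ∈ Subgroup.zpowers g) {χ : DirichletCharacter ℂ p} (hχ : χ.Odd) {h : ℕ}
    (h0 : 0 < h) (hp : p - 1 = 2 * h) :
    ∑ n ∈ Finset.range p, χ (n : ZMod p) * n =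
      2 * ∑ k ∈ Finset.range h, χ g ^ k * (((g : ZMod p) ^ k).val : ℂ) -
        p * ∑ k ∈ Finset.range h, χ g ^ k := by
  have hh := generator_pow_half hg h0 hp
  have hχh : χ g ^ h = -1 := by rw [← map_pow, hh]; exact hχ
  rw [sum_range_char_mul_eq hg, hp, two_mul, Finset.sum_range_add, ← Finset.sum_add_distrib,
    Finset.mul_sum, Finset.mul_sum, ← Finset.sum_sub_distrib]
  refine Finset.sum_congr rfl fun k _ => ?_
  have hne : (g : ZMod p) ^ k ≠ 0 := pow_ne_zero _ g.ne_zero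
  rw [pow_add, pow_add, hχh, hh, neg_one_mul, neg_one_mul, ZMod.neg_val, if_neg hne,
    Nat.cast_sub (ZMod.val_lt _).le]
  ring

/-- A character of a cyclic group has the same order as its value at a generator. -/
theorem isPrimitiveRoot_char_generator [Fact p.Prime] {g : (ZMod p)ˣ}
    (hg : ∀ x, x ∈ Subgroup.zpowers g) (χ : DirichletCharacter ℂ p) :
    IsPrimitiveRoot (χ g) (orderOf χ) := by
  refine ⟨?_, fun d hd => orderOf_dvd_of_pow_eq_one ((MulChar.eq_iff hg _ _).2 ?_)⟩
  · rw [← MulChar.pow_apply_coe, pow_orderOf_eq_one, MulChar.one_apply_coe]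
  · rw [MulChar.pow_apply_coe, hd, MulChar.one_apply_coe]

/-- With `B = ∑ χ(n) n`, the constant coefficient is `-(ζ - 1) B / (2 p)`. If `g` is a primitive
root modulo `p` and `ω = χ(g)`, then `B = 2 R - p S`, where `R` is integral and
`S = ∑_{k < (p - 1) / 2} ω ^ k = -2 / (ω - 1)`. So the constant coefficient is congruent to
`-(ζ - 1) / (ω - 1)`, and if `ζ = ω ^ j`, this is `-(1 + ω + ⋯ + ω ^ (j - 1)) ≡ -j ≡ 1`. -/
theorem givesTheta_order_two_pow (hV : ((2 : ℕ) : QBar) ∈ V.nonunits) [NeZero N]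
    (hp : p.Prime) (hN : p ∣ N) (hp2 : Odd p) {χ : DirichletCharacter ℂ p} {ζ : ℂ}
    (hχ : orderOf χ = 2 ^ padicValNat 2 (p - 1))
    (hζ : IsPrimitiveRoot ζ (2 ^ padicValNat 2 (p - 1))) :
    GivesTheta V 2 N p 1 χ ((ζ - 1) • eisenstein 1 triv χ) := by
  have : Fact p.Prime := ⟨hp⟩
  obtain ⟨h, hh⟩ := hp2
  have hph : p - 1 = 2 * h := by omega
  have h0 : 0 < h := by
    have := hp.one_lt
    omega
  set m := padicValNat 2 (p - 1) with hm
  have hm0 : m ≠ 0 := by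
    rw [hm, hph, padicValNat.mul (by norm_num) h0.ne', padicValNat.self (by norm_num)]
    omega
  obtain ⟨g, hg⟩ := IsCyclic.exists_generator (α := (ZMod p)ˣ)
  have hω := isPrimitiveRoot_char_generator hg χ
  rw [hχ] at hω
  set ω := χ g with hωdef
  have hodd : χ.Odd := by
    refine χ.even_or_odd.resolve_left fun he => ?_
    have h1 : ω ^ h = 1 := by
      rw [hωdef, ← map_pow, generator_pow_half hg h0 hph]
      exact he
    have h2 : 2 ^ (m + 1) ∣ p - 1 := by
      rw [pow_succ', hph]
      exact mul_dvd_mul_left 2 (hω.dvd_of_pow_eq_one _ h1)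
    have h3 := (padicValNat_dvd_iff_le (p := 2) (by omega : p - 1 ≠ 0)).1 h2
    omega
  have hcop : IsCoprime (2 : ℤ) p := by
    rw [hh]
    exact ⟨-h, 1, by push_cast; ring⟩
  have hp2 : p.Coprime 2 := (Nat.isCoprime_iff_coprime.1 hcop).symm
  have hζ1 : Reduces V ζ 1 := reduces_one_of_pow_prime_pow Nat.prime_two hV hζ.pow_eq_one
  have hω1 : Reduces V ω 1 := reduces_one_of_pow_prime_pow Nat.prime_two hV hω.pow_eq_one
  have hζ0 : Reduces V (ζ - 1) 0 := by
    have := hζ1.sub reduces_one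
    rwa [sub_self] at this
  have hp0 : (p : ℂ) ≠ 0 := by exact_mod_cast hp.ne_zero
  refine .of_hasQExp_of_coprime Nat.prime_two hV hN one_pos (Nat.coprime_one_left 2)
    (Submodule.smul_mem _ _ (eisenstein_one_mem hodd))
    ((hasQExp_eisenstein 1 triv χ).smul _) ?_ (fun n hn => ?_) fun n hn hn2 => ?_
  · obtain ⟨j, -, hj, rfl⟩ := hω.isPrimitiveRoot_iff.1 hζ
    have hj2 : j.Coprime 2 := Nat.Coprime.coprime_dvd_right (dvd_pow_self 2 hm0) hj
    set R := ∑ k ∈ Finset.range h, ω ^ k * (((g : ZMod p) ^ k).val : ℂ) with hR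
    set S := ∑ k ∈ Finset.range h, ω ^ k with hS
    have hS1 : S * (ω - 1) = -2 := by
      rw [hS, geom_sum_mul, hωdef, ← map_pow, generator_pow_half hg h0 hph,
        show χ (-1) = -1 from hodd]
      norm_num
    have hR1 : Reduces V R (∑ k ∈ Finset.range h, 1 ^ k * (((g : ZMod p) ^ k).val : Residue V)) :=
      Reduces.sum _ fun k _ => (hω1.pow k).mul (reduces_natCast _)
    have hj1 : Reduces V (∑ i ∈ Finset.range j, ω ^ i) 1 := by
      have := Reduces.sum (Finset.range j) fun i _ => hω1.pow i
      simpa [natCast_residue_eq_one_of_two hV hj2] using this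
    have hfin := (((hζ0.mul hR1).div (reduces_natCast p)
      (natCast_residue_ne_zero Nat.prime_two hV hp2)).add hj1).neg
    rw [zero_mul, zero_div, zero_add] at hfin
    have h2 : (2 : Residue V) = 0 := by simpa using natCast_residue_eq_zero hV
    rw [if_pos rfl, eisConst_one (ne_one_of_odd hodd), sum_range_odd_char_mul_eq hg hodd h0 hph]
    have e : (-1 : Residue V) = 1 := by linear_combination -h2
    rw [← e]
    convert hfin using 1
    have hj3 : ω ^ j - 1 = (∑ i ∈ Finset.range j, ω ^ i) * (ω - 1) := (geom_sum_mul ω j).symm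
    change (ω ^ j - 1) * (-(2 * R - p * S) / (2 * p)) = _
    set G := ∑ i ∈ Finset.range j, ω ^ i
    have hGS : (ω ^ j - 1) * S = -2 * G := by
      rw [hj3]
      linear_combination G * hS1
    field_simp
    linear_combination (p : ℂ) * hGS
  · rw [if_neg hn]
    obtain ⟨r, hr⟩ := (IsIntegralAt.of_isIntegral (V := V)
      (isIntegral_charSigma triv χ (1 - 1) n)).exists_reduces
    have := hζ0.mul hr
    rwa [zero_mul] at this
  · rw [natCast_residue_eq_one_of_two hV hn2, one_zpow]
    exact reduces_char_of_pow_prime_pow Nat.prime_two hV (by rw [← hχ, pow_orderOf_eq_one]) hn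

end PowerOfTwo

/-! ### Characters of order 3 -/

section OrderThree

variable {V : ValuationSubring QBar} {N p : ℕ}

/-- Over a ring in which `p = 1`: multiplication by the exact power of `p` dividing `n` maps the
divisors of `n` prime to `p` to those with complementary divisor prime to `p`. -/
theorem sum_divisors_filter_eq {R : Type*} [CommRing R] (hp : p.Prime) (hp1 : (p : R) = 1) {n : ℕ}
    (hn : n ≠ 0) : ∑ d ∈ n.divisors with ¬p ∣ d, (d : R) =
      ∑ d ∈ n.divisors with ¬p ∣ n / d, (d : R) := by
  obtain ⟨a, n', hn', rfl⟩ := Nat.exists_eq_pow_mul_and_not_dvd hn p hp.ne_one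
  have hpa : p ^ a ≠ 0 := pow_ne_zero _ hp.ne_zero
  refine Finset.sum_nbij' (p ^ a * ·) (· / p ^ a) (fun d hd => ?_) (fun d hd => ?_)
    (fun d _ => ?_) (fun d hd => ?_) fun d _ => ?_
  all_goals simp only [Finset.mem_filter, Nat.mem_divisors] at *
  · obtain ⟨⟨hd, -⟩, hpd⟩ := hd
    obtain ⟨e, rfl⟩ : d ∣ n' := Nat.Coprime.dvd_of_dvd_mul_left
      (((Nat.Prime.coprime_iff_not_dvd hp).2 hpd).symm.pow_right a) hd
    have hd0 : 0 < d := Nat.pos_of_ne_zero fun h => hpd (h ▸ dvd_zero p)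
    refine ⟨⟨⟨e, (mul_assoc _ _ _).symm⟩, hn⟩, ?_⟩
    rw [← mul_assoc, Nat.mul_div_cancel_left e (by positivity)]
    exact fun h => hn' (h.mul_left d)
  · obtain ⟨⟨⟨e, he⟩, -⟩, hpd⟩ := hd
    have hd0 : 0 < d := Nat.pos_of_ne_zero fun h => hn (by rw [he, h, zero_mul])
    rw [he, Nat.mul_div_cancel_left e hd0] at hpd
    obtain ⟨f, rfl⟩ : p ^ a ∣ d := Nat.Coprime.dvd_of_dvd_mul_right
      (((Nat.Prime.coprime_iff_not_dvd hp).2 hpd).pow_left a) (he ▸ dvd_mul_right _ _)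
    rw [Nat.mul_div_cancel_left f (Nat.pos_of_ne_zero hpa)]
    rw [mul_assoc, Nat.mul_right_inj hpa] at he
    exact ⟨⟨(Dvd.intro e he.symm).mul_left _, hn⟩, fun h => hn' (he ▸ h.mul_right e)⟩
  · exact Nat.mul_div_cancel_left d (Nat.pos_of_ne_zero hpa)
  · obtain ⟨⟨⟨e, he⟩, -⟩, hpd⟩ := hd
    have hd0 : 0 < d := Nat.pos_of_ne_zero fun h => hn (by rw [he, h, zero_mul])
    rw [he, Nat.mul_div_cancel_left e hd0] at hpd
    exact Nat.mul_div_cancel' (Nat.Coprime.dvd_of_dvd_mul_right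
      (((Nat.Prime.coprime_iff_not_dvd hp).2 hpd).pow_left a) (he ▸ dvd_mul_right _ _))
  · rw [Nat.cast_mul, Nat.cast_pow, hp1, one_pow, one_mul]

/-- At a place above `3`, a character `χ` modulo `p` of order `3` takes the value `1` at the
integers prime to `p`. -/
theorem reduces_char_of_order_three (hV : ((3 : ℕ) : QBar) ∈ V.nonunits) (hp : p.Prime)
    {χ : DirichletCharacter ℂ p} (hχ : orderOf χ = 3) (n : ℕ) :
    Reduces V (χ (n : ZMod p)) (if ¬p ∣ n then 1 else 0) := by
  by_cases h : ¬p ∣ n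
  · rw [if_pos h]
    have hn := ((Nat.Prime.coprime_iff_not_dvd hp).2 h).symm
    exact reduces_char_of_pow_prime_pow Nat.prime_three hV (m := 1)
      (by rw [pow_one, ← hχ, pow_orderOf_eq_one]) hn
  · rw [if_neg h, (ZMod.natCast_eq_zero_iff n p).2 (not_not.1 h)]
    have : Fact p.Prime := ⟨hp⟩
    rw [MulChar.map_zero]
    exact reduces_zero

/-- Modulo the place, `B_{2,χ} = p⁻¹ ∑ χ(n) n² - ∑ χ(n) n` becomes `∑ n² - ∑ n`, where the sums are
over `0 ≤ n < p`. -/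
theorem reduces_genBernoulli_two (hV : ((3 : ℕ) : QBar) ∈ V.nonunits) (hp : p.Prime)
    (hp9 : p ≡ 4 [MOD 9]) {χ : DirichletCharacter ℂ p} (hχ : orderOf χ = 3) :
    Reduces V (genBernoulli 2 (charMul triv χ)) (-1) := by
  have : Fact p.Prime := ⟨hp⟩
  have hχ1 : χ ≠ 1 := by
    rintro rfl
    simp at hχ
  have hp0 : (p : ℂ) ≠ 0 := by exact_mod_cast hp.ne_zero
  have h3 : (3 : Residue V) = 0 := by simpa using natCast_residue_eq_zero hV
  obtain ⟨t, ht⟩ : ∃ t, p = 9 * t + 4 := ⟨p / 9, by have : p % 9 = 4 := hp9; omega⟩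
  have hp1 : (p : Residue V) = 1 := by
    rw [ht]
    push_cast
    linear_combination (3 * t + 1 : Residue V) * h3
  have e : genBernoulli 2 (charMul triv χ) = (∑ n ∈ Finset.range p, χ (n : ZMod p) * n ^ 2) / p -
      ∑ n ∈ Finset.range p, χ (n : ZMod p) * n := by
    have h0 : (p : ℂ) * 6⁻¹ * ∑ n ∈ Finset.range p, χ (n : ZMod p) = 0 := by
      rw [sum_range_char_eq_zero hχ1, mul_zero]
    rw [genBernoulli_two_charMul hp.ne_one, ← sub_eq_zero, ← h0, Finset.mul_sum, Finset.mul_sum,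
      Finset.sum_div, ← Finset.sum_sub_distrib, ← Finset.sum_sub_distrib]
    refine Finset.sum_congr rfl fun n _ => ?_
    field_simp
    ring
  have hmul : ∀ i ≠ 0, ∀ n ∈ Finset.range p, Reduces V (χ (n : ZMod p) * (n : ℂ) ^ i)
      ((n ^ i : ℕ) : Residue V) := by
    intro i hi n hn
    have := (reduces_char_of_order_three hV hp hχ n).mul ((reduces_natCast n).pow i)
    convert this using 1
    by_cases hd : ¬p ∣ n
    · simp [hd]
    · have : n = 0 := Nat.eq_zero_of_dvd_of_lt (not_not.1 hd) (Finset.mem_range.1 hn)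
      simp [this, hi]
  have s1 : ((∑ n ∈ Finset.range p, n ^ 1 : ℕ) : Residue V) = 0 := by
    have : (∑ n ∈ Finset.range p, n ^ 1) * 2 = p * (p - 1) := by
      simpa using Finset.sum_range_id_mul_two p
    have h' := congrArg (Nat.cast : ℕ → Residue V) this
    rw [show p - 1 = 3 * (3 * t + 1) by omega] at h'
    push_cast at h' ⊢
    linear_combination 2 * h' - (∑ n ∈ Finset.range p, (n : Residue V) ^ 1 -
      2 * p * (3 * t + 1)) * h3
  have s2 : ((∑ n ∈ Finset.range p, n ^ 2 : ℕ) : Residue V) = -1 := by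
    have hsq : ∀ m : ℕ, (∑ n ∈ Finset.range (m + 1), n ^ 2) * 6 = m * (m + 1) * (2 * m + 1) := by
      intro m
      induction m with
      | zero => simp
      | succ m ih =>
        rw [Finset.sum_range_succ, add_mul, ih]
        ring
    have h0 := hsq (p - 1)
    rw [Nat.sub_add_cancel hp.one_lt.le, show p - 1 = 3 * (3 * t + 1) by omega] at h0
    have : (∑ n ∈ Finset.range p, n ^ 2) * 2 =
        (3 * t + 1) * (3 * (3 * t + 1) + 1) * (2 * (3 * (3 * t + 1)) + 1) := by
      refine Nat.eq_of_mul_eq_mul_left three_pos ?_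
      linear_combination h0 + 3 * (3 * t + 1) * (2 * (3 * (3 * t + 1)) + 1) * ht
    have h' := congrArg (Nat.cast : ℕ → Residue V) this
    have hR : (((3 * t + 1) * (3 * (3 * t + 1) + 1) * (2 * (3 * (3 * t + 1)) + 1) : ℕ) :
        Residue V) = 1 := by
      push_cast
      rw [h3]
      ring
    rw [hR] at h'
    push_cast at h' ⊢
    linear_combination (∑ n ∈ Finset.range p, (n : Residue V) ^ 2) * h3 - h'
  have hs := ((Reduces.sum _ (hmul 2 two_ne_zero)).div (reduces_natCast p)
    (by rw [hp1]; exact one_ne_zero)).sub (Reduces.sum _ (hmul 1 one_ne_zero))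
  rw [← Nat.cast_sum, ← Nat.cast_sum, s1, s2, hp1, div_one, sub_zero] at hs
  rw [e]
  simpa only [pow_one] using hs

/-- The factor `3 / (p - 1)` is a unit congruent to `1`, as `p ≡ 4` modulo `9`, so it is the difference of
the two Eisenstein series that has to be congruent to `1`. The constant term of the second one is
zero, and modulo the place both have the same coefficients at `q ^ n` for `n > 0`, by
`sum_divisors_filter_eq`. -/
theorem givesTheta_order_three (hV : ((3 : ℕ) : QBar) ∈ V.nonunits) [NeZero N] (hp : p.Prime)
    (hN : p ∣ N) (hp9 : p ≡ 4 [MOD 9]) {χ : DirichletCharacter ℂ p} (hχ : orderOf χ = 3) :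
    GivesTheta V 3 N p 2 χ
      ((3 / ((p : ℂ) - 1)) • (eisenstein 2 triv χ - eisenstein 2 χ triv)) := by
  have : Fact p.Prime := ⟨hp⟩
  have hχ1 : χ ≠ 1 := by
    rintro rfl
    simp at hχ
  have h3 : (3 : Residue V) = 0 := by simpa using natCast_residue_eq_zero hV
  obtain ⟨t, ht⟩ : ∃ t, p = 9 * t + 4 := ⟨p / 9, by have : p % 9 = 4 := hp9; omega⟩
  have hp1 : (p : Residue V) = 1 := by
    rw [ht]
    push_cast
    linear_combination (3 * t + 1 : Residue V) * h3
  have heven : χ.Even := by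
    have h3 : χ (-1) ^ 3 = 1 := by
      rw [← MulChar.pow_apply' χ three_ne_zero, ← hχ, pow_orderOf_eq_one,
        MulChar.one_apply isUnit_one.neg]
    refine χ.even_or_odd.resolve_right fun ho => ?_
    rw [show χ (-1) = -1 from ho] at h3
    norm_num at h3
  -- `(p - 1) / 3` is congruent to `1` modulo `3`.
  have hu : Reduces V (3 / ((p : ℂ) - 1)) 1 := by
    have h1 : ((3 * t + 1 : ℕ) : Residue V) = 1 := by
      push_cast
      rw [h3, zero_mul, zero_add]
    have := reduces_one.div (reduces_natCast (V := V) (3 * t + 1)) (by rw [h1]; exact one_ne_zero)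
    rw [h1, div_one] at this
    convert this using 1
    have h0 : ((3 * t + 1 : ℕ) : ℂ) ≠ 0 := by exact_mod_cast (3 * t).succ_ne_zero
    have h2 : (p : ℂ) - 1 = 3 * (3 * t + 1 : ℕ) := by
      rw [ht]
      push_cast
      ring
    rw [h2]
    field_simp
  refine .of_hasQExp_of_coprime Nat.prime_three hV hN two_pos (by norm_num)
    (Submodule.smul_mem _ _ (Submodule.sub_mem _ (eisenstein_two_mem heven hχ1)
      (eisenstein_two_swap_mem heven hχ1)))
    (((hasQExp_eisenstein 2 triv χ).sub (hasQExp_eisenstein 2 χ triv)).smul _) ?_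
    (fun n hn => ?_) fun n hn hn3 => ?_
  · rw [if_pos rfl, if_pos rfl, eisConst_two hχ1, eisConst, if_pos (Or.inl ⟨le_rfl, hχ1⟩), sub_zero]
    have h4 : ((4 : ℕ) : Residue V) = 1 := by
      push_cast
      linear_combination h3
    have := hu.mul ((reduces_genBernoulli_two hV hp hp9 hχ).neg.div (reduces_natCast 4)
      (by rw [h4]; exact one_ne_zero))
    rwa [h4, neg_neg, div_one, mul_one, Nat.cast_ofNat] at this
  · rw [if_neg hn, if_neg hn, charSigma_triv_left, charSigma_triv_right]
    have hred := reduces_char_of_order_three hV hp hχ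
    have h1 := Reduces.sum n.divisors fun d _ => ((reduces_natCast d).pow (2 - 1)).mul (hred d)
    have h2 := Reduces.sum n.divisors fun d _ => ((reduces_natCast d).pow (2 - 1)).mul (hred (n / d))
    have := hu.mul (h1.sub h2)
    convert this using 1
    simp only [Nat.add_one_sub_one, pow_one, mul_ite, mul_one, mul_zero, ← Finset.sum_filter,
      sum_divisors_filter_eq hp hp1 hn, sub_self]
  · rw [natCast_residue_zpow_neg_two hV hn3]
    exact reduces_char_of_pow_prime_pow Nat.prime_three hV (m := 1)
      (by rw [pow_one, ← hχ, pow_orderOf_eq_one]) hn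

end OrderThree

end ThetaLift

end

open ThetaLift in
theorem mainTheorem6 (ℓ : ℕ) (hℓ : ℓ.Prime) (V : ValuationSubring ThetaLift.QBar)
    (hV : (ℓ : ThetaLift.QBar) ∈ V.nonunits) (N : ℕ) [NeZero N] :
    -- The lemma on the operator attached to a form satisfying the conditions.
    (∀ (kA : ℕ) (χA : DirichletCharacter ℂ N) (A : ℍ → ℂ), ThetaLift.ThetaCond V ℓ N kA χA A →
      -- The operator is a well defined linear map on the graded space of forms of level `N`.
      (∃ Θ : (⨁ k : ℕ, ModularForm (ThetaLift.G1 N) (k : ℤ)) →ₗ[ℂ]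
            (⨁ k : ℕ, ModularForm (ThetaLift.G1 N) (k : ℤ)),
          ∀ (k : ℕ) (g : ModularForm (ThetaLift.G1 N) (k : ℤ)),
            ∃ h : ModularForm (ThetaLift.G1 N) ((k + kA + 2 : ℕ) : ℤ),
              (h : ℍ → ℂ) = ThetaLift.thetaTilde kA A k g ∧
              Θ (DirectSum.lof ℂ ℕ (fun j : ℕ => ModularForm (ThetaLift.G1 N) (j : ℤ)) k g) =
                DirectSum.lof ℂ ℕ (fun j : ℕ => ModularForm (ThetaLift.G1 N) (j : ℤ))
                  (k + kA + 2) h) ∧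
      ∀ (k : ℕ) (ε : DirichletCharacter ℂ N) (g : ℍ → ℂ), g ∈ ThetaLift.ModForms N k ε →
        ThetaLift.HasIntegralCoeffs V g →
        (ThetaLift.thetaTilde kA A k g ∈ ThetaLift.ModForms N (k + kA + 2) (ε * χA) ∧
          ThetaLift.HasIntegralCoeffs V (ThetaLift.thetaTilde kA A k g)) ∧
        ThetaLift.FormCong V (ThetaLift.thetaTilde kA A k g) (ThetaLift.theta g) ∧
        ∀ (p : ℕ) (hp : p.Prime), ThetaLift.IsNormalisedMod V g →
          (∃ lam, ThetaLift.IsHeckeEigenMod V p hp N k ε g lam) →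
          ThetaLift.IsNormalisedMod V (ThetaLift.thetaTilde kA A k g) ∧
          ∃ r, ThetaLift.Reduces V (ThetaLift.coeffAt p g) r ∧
            ThetaLift.IsHeckeEigenMod V p hp N (k + kA + 2) (ε * χA)
              (ThetaLift.thetaTilde kA A k g) ((p : ThetaLift.Residue V) * r)) ∧
    -- `ℓ ≥ 5`, any level.
    (5 ≤ ℓ → ThetaLift.GivesTheta V ℓ N 1 (ℓ - 1) ThetaLift.triv
      ((-2 * (ℓ : ℂ)) • ThetaLift.eisensteinOne (ℓ - 1))) ∧
    -- `ℓ ≥ 5` and `ℓ ∣ N`.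
    (5 ≤ ℓ → ℓ ∣ N →
      (∃! χ : DirichletCharacter ℂ ℓ, ThetaLift.IsTeichmullerLift V ℓ χ) ∧
      ∀ χ : DirichletCharacter ℂ ℓ, ThetaLift.IsTeichmullerLift V ℓ χ →
        ThetaLift.GivesTheta V ℓ N ℓ 1 χ⁻¹
          ((2 * (ℓ : ℂ)) • ThetaLift.eisenstein 1 ThetaLift.triv χ⁻¹)) ∧
    -- `ℓ = 2` and `4 ∣ N`.
    (ℓ = 2 → 4 ∣ N → ∀ χ : DirichletCharacter ℂ 4, χ ≠ 1 →
      ThetaLift.GivesTheta V ℓ N 4 1 χ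
        ((4 : ℂ) • ThetaLift.eisenstein 1 ThetaLift.triv χ)) ∧
    -- `ℓ = 2` and `N` has an odd prime divisor.
    (ℓ = 2 → ∀ p : ℕ, IsLeast {q : ℕ | q.Prime ∧ q ∣ N ∧ Odd q} p →
      ∀ (χ : DirichletCharacter ℂ p) (ζ : ℂ), orderOf χ = 2 ^ padicValNat 2 (p - 1) →
        IsPrimitiveRoot ζ (2 ^ padicValNat 2 (p - 1)) →
        ThetaLift.GivesTheta V ℓ N p 1 χ
          ((ζ - 1) • ThetaLift.eisenstein 1 ThetaLift.triv χ)) ∧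
    -- `ℓ = 2` and `N = 2`.
    (ℓ = 2 → N = 2 → ThetaLift.GivesTheta V ℓ N 2 2 1
      ((24 : ℂ) • ThetaLift.eisenstein 2 ThetaLift.triv (1 : DirichletCharacter ℂ 2))) ∧
    -- `ℓ = 2` and `N = 1`.
    (ℓ = 2 → N = 1 → ThetaLift.GivesTheta V ℓ N 1 4 ThetaLift.triv
      ((240 : ℂ) • ThetaLift.eisensteinOne 4)) ∧
    -- `ℓ = 3` and `3 ∣ N`.
    (ℓ = 3 → 3 ∣ N → ∀ χ : DirichletCharacter ℂ 3, χ ≠ 1 →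
      ThetaLift.GivesTheta V ℓ N 3 1 χ
        ((6 : ℂ) • ThetaLift.eisenstein 1 ThetaLift.triv χ)) ∧
    -- `ℓ = 3` and `N` has a prime divisor congruent to `2` modulo `3`.
    (ℓ = 3 → ∀ p : ℕ, IsLeast {q : ℕ | q.Prime ∧ q ∣ N ∧ q ≡ 2 [MOD 3]} p →
      ThetaLift.GivesTheta V ℓ N p 2 1
        ((24 / ((p : ℂ) - 1)) •
          ThetaLift.eisenstein 2 ThetaLift.triv (1 : DirichletCharacter ℂ p))) ∧
    -- `ℓ = 3` and `N` has a prime divisor congruent to `4` modulo `9`.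
    (ℓ = 3 → ∀ p : ℕ, IsLeast {q : ℕ | q.Prime ∧ q ∣ N ∧ q ≡ 4 [MOD 9]} p →
      ∀ χ : DirichletCharacter ℂ p, orderOf χ = 3 →
        ThetaLift.GivesTheta V ℓ N p 2 χ
          ((3 / ((p : ℂ) - 1)) • (ThetaLift.eisenstein 2 ThetaLift.triv χ -
            ThetaLift.eisenstein 2 χ ThetaLift.triv))) ∧
    -- `ℓ = 3` and all prime divisors of `N` are congruent to `1` modulo `9`.
    (ℓ = 3 → (∀ q : ℕ, q.Prime → q ∣ N → q ≡ 1 [MOD 9]) →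
      ThetaLift.GivesTheta V ℓ N 1 4 ThetaLift.triv
        ((240 : ℂ) • ThetaLift.eisensteinOne 4)) ∧
    -- In particular, for every level and every place there is a form satisfying the conditions.
    (∃ (kA : ℕ) (χA : DirichletCharacter ℂ N) (A : ℍ → ℂ),
      ThetaLift.ThetaCond V ℓ N kA χA A) := by
  refine ⟨fun kA χA A hA => ⟨?_, fun k ε g hg hgint => ⟨⟨thetaTilde_mem hA.mem hg, fun n => ?_⟩,
    fun n => ?_, fun p hp hnorm ⟨lam, heig⟩ => ⟨?_, ?_⟩⟩⟩, fun h5 => ?_, fun h5 hN => ⟨?_, ?_⟩,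
    ?_, ?_, ?_, ?_, ?_, ?_, ?_, ?_, ?_⟩
  · obtain ⟨⟨F, rfl⟩, -⟩ := hA.mem
    exact exists_thetaTilde_directSum F
  · choose r hr using fun n => (hgint n).exists_reduces
    exact (hA.reduces_thetaTilde hg hr n).isIntegralAt
  · choose r hr using fun n => (hgint n).exists_reduces
    refine .of_reduces (hA.reduces_thetaTilde hg hr n) ?_
    rw [(ModForms.hasQExp hg).theta.coeffAt_eq]
    exact (reduces_natCast n).mul (hr n)
  · choose r hr using fun n => (hgint n).exists_reduces
    have h1 := hA.reduces_thetaTilde hg hr 1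
    rw [(hr 1).unique (hnorm.reduces reduces_one), Nat.cast_one, one_mul] at h1
    exact .of_reduces h1 reduces_one
  · obtain ⟨a, ha⟩ := (hgint p).exists_reduces
    exact ⟨a, ha, hA.eigen_thetaTilde hℓ hV hg hp hnorm heig ha⟩
  · exact givesTheta_eisensteinOne hℓ hV h5
  · obtain ⟨χ, hχ⟩ := exists_isTeichmullerLift hℓ hV
    exact ⟨χ, hχ, fun χ' hχ' => hχ'.unique hℓ hV hχ⟩
  · exact fun χ hχ => givesTheta_teichmuller hℓ (by omega) hV hN hχ
  · rintro rfl h4 χ hχ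
    exact givesTheta_four hV h4 hχ
  · rintro rfl p ⟨⟨hp, hN, hp2⟩, -⟩ χ ζ hχ hζ
    exact givesTheta_order_two_pow hV hp hN hp2 hχ hζ
  · rintro rfl rfl
    exact givesTheta_two hV dvd_rfl
  · exact fun h2 _ => givesTheta_eisensteinOne_four hℓ hV (.inl h2)
  · rintro rfl h3 χ hχ
    exact givesTheta_three hV h3 hχ
  · rintro rfl p ⟨⟨hp, hN, hp3⟩, -⟩
    exact givesTheta_prime_two_mod_three hV hp hN hp3
  · rintro rfl p ⟨⟨hp, hN, hp9⟩, -⟩ χ hχ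
    exact givesTheta_order_three hV hp hN hp9 hχ
  · exact fun h3 _ => givesTheta_eisensteinOne_four hℓ hV (.inr h3)
  · by_cases h5 : 5 ≤ ℓ
    · obtain ⟨-, _, h⟩ := givesTheta_eisensteinOne (N := N) hℓ hV h5
      exact ⟨_, _, _, h⟩
    · have h23 : ℓ = 2 ∨ ℓ = 3 := by
        have := hℓ.two_le
        have : ℓ ≠ 4 := by
          rintro rfl
          exact absurd hℓ (by norm_num)
        omega
      obtain ⟨-, _, h⟩ := givesTheta_eisensteinOne_four (N := N) hℓ hV h23
      exact ⟨_, _, _, h⟩
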